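/- **Setting.** Let $V\subset\mathbb C^2$ be bounded and open, $X$ a holomorphic vector field on $V$ with $\|X\|_V\le M$, and $\zeta\in V$. Suppose the complex-time orbit $t\mapsto\phi_X^t(\zeta)\in V$ is defined for $|\mathrm{Im}\,t|<s_*$, takes equal values at $t,t'$ exactly when $t-t'\in T\mathbb Z$ ($T>0$), and that $X(\zeta)\notin\mathbb C e_2$, $e_2=(0,1)$. Let $a>0$, $p>20(a+1)$, $s'>0$, $0<\nu_1\le\nu_2<1/3$, $K>0$. For $\delta>0$ and $\eta$ holomorphic on $V$ with values in $\mathbb C^2$ and $\|\eta\|_V\le M\delta^p$ put $h^t=\phi^t_{\delta X}\circ(\mathrm{id}+t\eta)$, $h=h^1$ (partially defined maps), $q=[T/\delta]$ and $$\mathcal W_{\delta,s,\nu}=\bigcup_{-\nu<t<1+\nu}h^t\bigl(\{\phi_X^{i\sigma}(\zeta)+re_2:\ \sigma\in\mathbb R,\ r\in\mathbb C,\ |\sigma|<\delta s,\ |r|<\delta s\}\bigr).$$ Write $\mathcal T_{\alpha,\beta}(z,w)=(z+\alpha,e^{2\pi i\beta}w)$. **Linearization hypothesis.** There are $\check\alpha\in(-1,0)$,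 $\check\beta\in\mathbb C$, $\check\nu,\check s\in[K^{-1},K]$ such that, with $R=\{(z,w):-\check\nu<\mathrm{Re}\,z<1+\check\nu,\ |\mathrm{Im}\,z|<\check s,\ |w|<\check s\}$, there is an injective holomorphic map $N^{-1}$ from $R\cup\mathcal T_{1,0}(R)\cup\mathcal T_{\check\alpha,\check\beta}(R)$ to $\mathbb C^2$ satisfying $h\circ N^{-1}=N^{-1}\circ\mathcal T_{1,0}$ and $h^{q}\circ N^{-1}=N^{-1}\circ\mathcal T_{\check\alpha,\check\beta}$ on $R$ (so $h$ and $h^q$ are defined on $\check{\mathcal W}:=N^{-1}(R)$), and $$\mathcal W_{\delta,\delta^{p/2+2},\nu_1}\subset\check{\mathcal W}\subset\mathcal W_{\delta,s',\nu_2},\qquad N^{-1}(0,0)\in\mathbb D(\zeta_1,\delta^{p-a})\times\mathbb D(\zeta_2,\delta^{p-a}),\qquad \sup_R\|\partial_zN^{-1}-\delta X\circ N^{-1}\|\le K\delta^{p/2-a}.$$ Put $\check{\mathcal C}=\bigcup_{l=0}^{q}h^{-l}(\check{\mathcal W})$. The pair $(\check\alpha,\check\beta)$ is *non-resonant* if $k\check\alpha+(l-1)\check\beta-m=0$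 with $k,m\in\mathbb Z$, $l\in\mathbb N$ forces $k=0,\ l=1,\ m=0$. An *invariant rotation annulus* of $h$ is the image $A=F(\mathbb T_s)$ of a holomorphic embedding $F:\mathbb T_s=(\mathbb R+i(-s,s))/\mathbb Z\to\mathbb C^2$, $s>0$, with $h\circ F=F(\cdot+\alpha)$ for some $\alpha\in\mathbb R$, called its rotation number in the coordinate $F$. **Theorem 8.3.** There are $C,\delta_0>0$, depending only on $V,X,M,\zeta,T,s_*,a,p,s',\nu_1,\nu_2,K$, such that for all $\delta\in(0,\delta_0)$ with $\{T/\delta\}\in(1/10,9/10)$, all $\eta$ as above, and all $\check\alpha,\check\beta,\check\nu,\check s,N$ as in the linearization hypothesis with $(\check\alpha,\check\beta)$ non-resonant and $\mathrm{Im}\,\check\beta>0$, there is an invariant rotation annulus $\mathcal A$ of $h$, relatively compact in $\check{\mathcal C}$, containing $N^{-1}(0,0)$, with a rotation number $\alpha$ such that $|\alpha-\delta/T|\le C\delta^2$, having the following properties. 1. $\mathcal A$ is attracting, with a nonempty open basin of attraction in $\check{\mathcal C}$: there is a nonempty open set $U$ with $\mathcal A\subset U\subset\check{\mathcal C}$ such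 that for every $x\in U$ all iterates $h^n(x)$, $n\ge0$, are defined and $\mathrm{dist}(h^n(x),\mathcal A)\to0$. 2. $\mathcal A$ is $\delta^{(2/3)p}$-isolated: if $\mathcal A'$ is any invariant rotation annulus of $h$ whose Hausdorff distance to $\mathcal A$ is at most $\delta^{(2/3)p}$, or which contains a point at distance at most $2\delta^{(2/3)p}$ from the periodic orbit $\{\phi_X^t(\zeta):t\in\mathbb R\}$, then $\mathcal A\cap\mathcal A'$ contains a nonempty invariant rotation annulus of $h$. -/

import Mathlib

open Set Filter Topology

/-- The phase space `ℂ²` with its `l²` norm. -/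
abbrev C2 : Type := EuclideanSpace ℂ (Fin 2)

/-- Horizontal strip `ℝ + i(-s,s)`; its quotient by `ℤ` is the annulus `𝕋_s`. -/
def strip (s : ℝ) : Set ℂ := {t | |t.im| < s}

/-- `FlowRel V X t x y`: the time-`t` map of the vector field `X` on `V` is defined at `x` and equals
`y`, i.e. the integral curve of `t X` from `x` stays in `V` on `[0,1]` and ends at `y`. -/
def FlowRel (V : Set C2) (X : C2 → C2) (t : ℝ) (x y : C2) : Prop :=
  ∃ γ : ℝ → C2, γ 0 = x ∧ γ 1 = y ∧
    ∀ u ∈ Icc (0 : ℝ) 1, γ u ∈ V ∧ HasDerivWithinAt γ (t • X (γ u)) (Icc 0 1) u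

/-- The isotopy `h^t = φ^t_{δX} ∘ (id + tη)`, as a partially defined map (graph relation). -/
def IsotopyRel (V : Set C2) (X η : C2 → C2) (δ t : ℝ) (x y : C2) : Prop :=
  x ∈ V ∧ FlowRel V X (t * δ) (x + t • η x) y

/-- The diffeomorphism `h = φ^1_{δX} ∘ (id + η)`, as a partially defined map. -/
def HRel (V : Set C2) (X η : C2 → C2) (δ : ℝ) : C2 → C2 → Prop :=
  IsotopyRel V X η δ 1

/-- `IterRel h n x y`: the `n`-th iterate of the partial map `h` is defined at `x` and equals `y`. -/
def IterRel (h : C2 → C2 → Prop) : ℕ → C2 → C2 → Prop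
  | 0, x, y => x = y
  | n + 1, x, y => ∃ z, h x z ∧ IterRel h n z y

/-- `Φ t = φ_X^t(ζ)`, `|Im t| < sstar`, is the complex-time orbit of `ζ` under the holomorphic vector
field `X`; it is periodic with period exactly `T > 0` and injective modulo `T`, so that its image is
an annulus on which `X` is conjugate to `(1/T) ∂_θ`.  The annulus is transverse at `ζ` to the
complex line `ζ + ℂ e₂`. -/
structure VectorFieldAnnulus (V : Set C2) (X : C2 → C2) (ζ : C2) (T sstar : ℝ) (Φ : ℂ → C2) :
    Prop where
  T_pos : 0 < T
  sstar_pos : 0 < sstar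
  base : Φ 0 = ζ
  mem : ∀ t ∈ strip sstar, Φ t ∈ V
  deriv : ∀ t ∈ strip sstar, HasDerivAt Φ (X (Φ t)) t
  period : ∀ t ∈ strip sstar, ∀ t' ∈ strip sstar,
    (Φ t = Φ t' ↔ ∃ k : ℤ, t' = t + (k : ℂ) * (T : ℂ))
  transverse : X ζ 0 ≠ 0

/-- The three-dimensional transversal
`Σ_{δ,s} = {φ_X^θ(ζ) + r e₂ : θ ∈ iδ(-s,s), |r| < δ s}`. -/
def transversal (Φ : ℂ → C2) (δ s : ℝ) : Set C2 :=
  {x | ∃ σ : ℝ, ∃ r : ℂ, |σ| < δ * s ∧ ‖r‖ < δ * s ∧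
    x = Φ (σ * Complex.I) + EuclideanSpace.single 1 r}

/-- The box `𝒲^η_{δ,s,ν} = ⋃_{t ∈ (-ν,1+ν)} h^t(Σ_{δ,s})`. -/
def box (V : Set C2) (X η : C2 → C2) (Φ : ℂ → C2) (δ s ν : ℝ) : Set C2 :=
  {y | ∃ t ∈ Ioo (-ν) (1 + ν), ∃ x ∈ transversal Φ δ s, IsotopyRel V X η δ t x y}

/-- The model map `𝒯_{α,β}(z,w) = (z + α, e^{2πiβ} w)`. -/
noncomputable def modelMap (α β : ℂ) (u : C2) : C2 :=
  !₂[u 0 + α, Complex.exp (2 * Real.pi * Complex.I * β) * u 1]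

/-- The model domain `((-ν,1+ν) + i(-s,s)) × 𝔻(0,s)`. -/
def modelDomain (ν s : ℝ) : Set C2 :=
  {u | -ν < (u 0).re ∧ (u 0).re < 1 + ν ∧ |(u 0).im| < s ∧ ‖u 1‖ < s}

/-- The pair `(h, h^q)` on `P(modelDomain ν s)` is holomorphically conjugate, by `N = P⁻¹`, to the
pair `(𝒯_{1,0}, 𝒯_{α,β})` on `modelDomain ν s`.  As for every conjugation of commuting pairs, the
conjugating diffeomorphism is defined on the union of the domain with its two images. -/
structure ConjugatesPair (h : C2 → C2 → Prop) (q : ℕ) (α : ℝ) (β : ℂ) (ν s : ℝ) (P : C2 → C2) :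
    Prop where
  holo : DifferentiableOn ℂ P
    (modelDomain ν s ∪ modelMap 1 0 '' modelDomain ν s ∪ modelMap α β '' modelDomain ν s)
  inj : InjOn P
    (modelDomain ν s ∪ modelMap 1 0 '' modelDomain ν s ∪ modelMap α β '' modelDomain ν s)
  conj_one : ∀ u ∈ modelDomain ν s, h (P u) (P (modelMap 1 0 u))
  conj_q : ∀ u ∈ modelDomain ν s, IterRel h q (P u) (P (modelMap α β u))

/-- The set `𝒞 = ⋃_{l=0}^{q} h^{-l}(W)`. -/
def backwardUnion (h : C2 → C2 → Prop) (q : ℕ) (W : Set C2) : Set C2 :=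
  {x | ∃ l ≤ q, ∃ y ∈ W, IterRel h l x y}

/-- Non-resonance of a pair of frequencies. -/
def NonResonant (α β : ℂ) : Prop :=
  ∀ (k : ℤ) (l : ℕ) (m : ℤ), (k : ℂ) * α + ((l : ℂ) - 1) * β - (m : ℂ) = 0 → k = 0 ∧ l = 1 ∧ m = 0

/-- `A` is an `h`-invariant annulus in `ℂ²` on which `h` is conjugate to the rotation by `α`: `A` is
the image of a holomorphic embedding `F` of `𝕋_s` for some `s > 0`, written as a `1`-periodic map on
the strip, and `h ∘ F = F(· + α)`.  The fourth clause says that the inverse of `F : 𝕋_s → A` is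
continuous. -/
def IsRotationAnnulus (h : C2 → C2 → Prop) (α : ℝ) (A : Set C2) : Prop :=
  ∃ s > 0, ∃ F : ℂ → C2,
    DifferentiableOn ℂ F (strip s) ∧
    (∀ θ ∈ strip s, deriv F θ ≠ 0) ∧
    (∀ θ ∈ strip s, ∀ θ' ∈ strip s, (F θ = F θ' ↔ ∃ k : ℤ, θ' = θ + k)) ∧
    (∀ θ ∈ strip s, ∀ ε > 0, ∃ r > 0, ∀ θ' ∈ strip s,
      dist (F θ') (F θ) < r → ∃ k : ℤ, ‖θ' - θ - k‖ < ε) ∧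
    F '' strip s = A ∧
    ∀ θ ∈ strip s, h (F θ) (F (θ + α))

/-- The basin of `A`: points all of whose forward iterates are defined and whose forward orbit
converges to `A`. -/
def basin (h : C2 → C2 → Prop) (A : Set C2) : Set C2 :=
  {x | ∃ o : ℕ → C2, o 0 = x ∧ (∀ n, h (o n) (o (n + 1))) ∧
    Tendsto (fun n => Metric.infDist (o n) A) atTop (𝓝 0)}

/-!
The invariant annulus is the curve `{w = 0}` of the linearizing coordinates, continued by the
dynamics. Put `L = q - α'`. On the model domain `h` is `(z, w) ↦ (z + 1, w)` and `h^q` is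
`(z, w) ↦ (z + α', e^{2πiβ'} w)`, so the suspension of the model is the quotient of `ℂ²` by
`(z, w) ∼ (z + L, e^{-2πiβ'} w)`, in which `{w = 0}` is the cylinder `ℂ / Lℤ` and `h` acts as the
translation by `1`. Writing `z = z' + m + kL` with `0 ≤ Re z' < 1` and `0 ≤ Re z' + m < L`, the map
`f(z) = h^m(P(z', 0))` (`gluedCurve`) is well defined, `L`-periodic and satisfies
`f(z + 1) = h(f(z))`. Its holomorphy across the seams comes from the analytic continuation of the
relation `h ∘ P = P ∘ 𝒯_{1,0}` (`LinearizedPair.step_P_image`). The annulus is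
`f(|Im z| < š / 2)`, with rotation number `1 / L`. As `Im β' > 0`, the powers of the multiplier
`e^{2πiβ'}` tend to zero, so every point of the linearized box is attracted to the curve
(`LinearizedPair.attractedTo_P`); the basin is a union of preimages of an open part of the box.

That `f` is an embedding is a perturbative fact. The relation `h` is the graph of a Lipschitz map
near the orbit `Φ` of the vector field (`hRel_iff`), and it is holomorphic along holomorphic curves,
being a uniform limit of Euler schemes (`differentiableOn_stepMap_comp`). Grönwall's inequality and
the bound on `∂_z P - δ X ∘ P` show that `f(z)` is `O(δ²)`-close to `Φ(δz)`. The orbit is injective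
modulo `T` in a quantitative way (`VectorFieldAnnulus.exists_norm_sub_le`); hence `δL` is close to
`T`, which gives the estimate of the rotation number, and two parameters of one point of the curve
are close modulo `L`. The dynamics carries both into the box, where `P` is injective
(`LinearizedPair.gluedCurve_injective`).

For the isolation, a rotation annulus `A'` with a point near the orbit has one near the segment
`Φ([0, δ])`, whose neighbourhood of size a small multiple of `δ^{p/2+3}` lies in the box
(`mem_box_of_norm_sub_le`). Points of `A'` are recurrent and points of the box are attracted to the
curve, so the points of `A'` in the box lie on the curve (`LinearizedPair.exists_eq_gluedCurve`).
The open mapping theorem then gives a disc contained in both, and as non-resonance makes `L`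
irrational, the forward orbit of this disc fills a common annulus
(`LinearizedPair.exists_common_annulus`).
-/

/-! ### Holomorphic maps -/

/-- A bounded holomorphic map is Lipschitz on the ball of half the radius, by Cauchy's estimate. -/
theorem norm_sub_le_of_differentiableOn_ball {E F : Type*} [NormedAddCommGroup E]
    [NormedSpace ℂ E] [NormedAddCommGroup F] [NormedSpace ℂ F] {f : E → F} {c : E} {r B : ℝ}
    (hr : 0 < r) (hf : DifferentiableOn ℂ f (Metric.ball c (2 * r)))
    (hB : ∀ x ∈ Metric.ball c (2 * r), ‖f x‖ ≤ B) {x y : E} (hx : x ∈ Metric.ball c r)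
    (hy : y ∈ Metric.ball c r) : ‖f x - f y‖ ≤ 2 * B / r * ‖x - y‖ := by
  have hsub : ∀ z ∈ Metric.ball c r, Metric.ball z r ⊆ Metric.ball c (2 * r) := fun z hz =>
    Metric.ball_subset_ball' (by rw [Metric.mem_ball] at hz; linarith)
  refine (convex_ball c r).norm_image_sub_le_of_norm_fderiv_le (𝕜 := ℂ) (fun z hz => ?_)
    (fun z hz => ?_) hy hx
  · exact hf.differentiableAt (Metric.isOpen_ball.mem_nhds
      (hsub z hz (Metric.mem_ball_self hr)))
  · refine Complex.norm_fderiv_le_div_of_mapsTo_ball (hf.mono (hsub z hz)) (fun w hw => ?_) hr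
    rw [Metric.mem_closedBall, dist_eq_norm]
    have h1 := hB w (hsub z hz hw)
    have h2 := hB z (hsub z hz (Metric.mem_ball_self hr))
    linarith [norm_sub_le (f w) (f z)]

/-- Holomorphic maps on open sets of normed spaces are strictly differentiable: Cauchy's estimate
for a difference of translates makes the derivative continuous. -/
theorem hasStrictFDerivAt_of_differentiableOn {E F : Type*} [NormedAddCommGroup E]
    [NormedSpace ℂ E] [NormedAddCommGroup F] [NormedSpace ℂ F] {f : E → F} {U : Set E}
    (hU : IsOpen U) (hf : DifferentiableOn ℂ f U) {x : E} (hx : x ∈ U) :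
    HasStrictFDerivAt f (fderiv ℂ f x) x := by
  have hd : ∀ y ∈ U, DifferentiableAt ℂ f y := fun y hy => hf.differentiableAt (hU.mem_nhds hy)
  refine hasStrictFDerivAt_of_hasFDerivAt_of_continuousAt (f' := fderiv ℂ f)
    (by filter_upwards [hU.mem_nhds hx] with y hy using (hd y hy).hasFDerivAt) ?_
  -- `f` is bounded, hence Lipschitz, near `x`; Cauchy's estimate for a difference of translates
  have hb : ∀ᶠ y in 𝓝 x, y ∈ U ∧ ‖f y‖ < ‖f x‖ + 1 :=
    (hU.eventually_mem hx).and
      ((hd x hx).continuousAt.norm.eventually_lt_const (by linarith))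
  obtain ⟨ε, hε, hball⟩ := Metric.eventually_nhds_iff_ball.1 hb
  set r := ε / 4 with hr
  have hr0 : 0 < r := by positivity
  set C := 2 * (‖f x‖ + 1) / (2 * r) with hC
  have hC0 : 0 ≤ C := by positivity
  have hlip : ∀ y ∈ Metric.ball x (2 * r), ∀ z ∈ Metric.ball x (2 * r),
      ‖f y - f z‖ ≤ C * ‖y - z‖ := fun y hy z hz =>
    norm_sub_le_of_differentiableOn_ball (by positivity)
      (hf.mono fun w hw => (hball w (by rw [hr] at hw; convert hw using 2; ring)).1)
      (fun w hw => (hball w (by rw [hr] at hw; convert hw using 2; ring)).2.le) hy hz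
  have key : ∀ y ∈ Metric.ball x r, ‖fderiv ℂ f y - fderiv ℂ f x‖ ≤ 2 * (C * ‖y - x‖) / r := by
    intro y hy
    have hmem : ∀ z ∈ Metric.ball x r, z + (y - x) ∈ Metric.ball x (2 * r) := by
      intro z hz
      rw [mem_ball_iff_norm] at *
      calc ‖z + (y - x) - x‖ = ‖(z - x) + (y - x)‖ := by congr 1; abel
        _ ≤ _ := norm_add_le _ _
        _ < 2 * r := by linarith
    have hmem' : ∀ z ∈ Metric.ball x (2 * r), z ∈ U := fun z hz =>
      (hball z (Metric.ball_subset_ball (by rw [hr]; linarith) hz)).1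
    have hsub : Metric.ball x r ⊆ Metric.ball x (2 * r) := Metric.ball_subset_ball (by linarith)
    have hg : ∀ z ∈ Metric.ball x r, HasFDerivAt (fun z => f (z + (y - x)) - f z)
        (fderiv ℂ f (z + (y - x)) - fderiv ℂ f z) z := fun z hz =>
      ((hasFDerivAt_comp_add_right (y - x)).2 (hd _ (hmem' _ (hmem z hz))).hasFDerivAt).sub
        (hd _ (hmem' _ (hsub hz))).hasFDerivAt
    have h1 := (hg x (Metric.mem_ball_self hr0)).fderiv
    rw [add_sub_cancel] at h1
    rw [← h1]
    refine Complex.norm_fderiv_le_div_of_mapsTo_ball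
      (fun z hz => (hg z hz).differentiableAt.differentiableWithinAt) (fun z hz => ?_) hr0
    have e1 : ∀ z ∈ Metric.ball x r, ‖f (z + (y - x)) - f z‖ ≤ C * ‖y - x‖ := fun z hz => by
      simpa using hlip _ (hmem z hz) _ (hsub hz)
    rw [Metric.mem_closedBall, dist_eq_norm]
    refine (norm_sub_le _ _).trans ?_
    have := e1 z hz
    have := e1 x (Metric.mem_ball_self hr0)
    linarith
  rw [ContinuousAt, tendsto_iff_norm_sub_tendsto_zero]
  refine squeeze_zero' (Eventually.of_forall fun _ => norm_nonneg _)
    (by filter_upwards [Metric.ball_mem_nhds x hr0] with y hy using key y hy) ?_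
  have : Continuous fun y : E => 2 * (C * ‖y - x‖) / r := by fun_prop
  simpa using this.tendsto x

/-- An injective function of one complex variable has nonvanishing derivative: near a zero of order
`n ≥ 2` of `G - G(w₀)` one has `G - G(w₀) = g(w₀) ψⁿ` with `ψ` a local coordinate, and `ψ`, `ωψ`
with `ω` a primitive `n`-th root of unity give two preimages. -/
theorem deriv_ne_zero_of_injOn {G : ℂ → ℂ} {w₀ : ℂ} {S : Set ℂ} (hG : AnalyticAt ℂ G w₀)
    (hS : S ∈ 𝓝 w₀) (hinj : InjOn G S) : deriv G w₀ ≠ 0 := by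
  intro h0
  have hG' : AnalyticAt ℂ (fun z => G z - G w₀) w₀ := hG.sub analyticAt_const
  have hnc : ¬ ∀ᶠ z in 𝓝 w₀, G z - G w₀ = 0 := by
    intro h
    obtain ⟨z, ⟨hz1, hz2⟩, hz3⟩ : ∃ z, (G z - G w₀ = 0 ∧ z ∈ S) ∧ z ≠ w₀ :=
      (((h.and hS).filter_mono nhdsWithin_le_nhds).and self_mem_nhdsWithin :
        ∀ᶠ z in 𝓝[≠] w₀, (G z - G w₀ = 0 ∧ z ∈ S) ∧ z ≠ w₀).exists
    exact hz3 (hinj hz2 (mem_of_mem_nhds hS) (sub_eq_zero.1 hz1))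
  obtain ⟨n, g, hg, hg0, hgn⟩ := hG'.exists_eventuallyEq_pow_smul_nonzero_iff.2 hnc
  have hn0 : n ≠ 0 := by
    rintro rfl
    have := hgn.self_of_nhds
    simp at this
    exact hg0 this.symm
  have hn1 : n ≠ 1 := by
    rintro rfl
    have h1 : HasDerivAt (fun z => (z - w₀) ^ 1 • g z) (g w₀) w₀ := by
      have := ((hasDerivAt_id w₀).sub_const w₀).mul hg.differentiableAt.hasDerivAt
      simpa using! this
    have h2 : HasDerivAt (fun z => G z - G w₀) (g w₀) w₀ := h1.congr_of_eventuallyEq hgn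
    have h3 := (hG.differentiableAt.hasDerivAt.sub_const (G w₀)).unique h2
    exact hg0 (h3 ▸ h0)
  -- an analytic `n`-th root
  set r : ℂ → ℂ := fun z => Complex.exp (Complex.log (g z / g w₀) / n) with hr
  have hrA : AnalyticAt ℂ r w₀ := by
    refine AnalyticAt.cexp (AnalyticAt.div (AnalyticAt.clog (hg.div analyticAt_const hg0) ?_)
      analyticAt_const (by exact_mod_cast hn0))
    simp [div_self hg0]
  have hr0 : r w₀ = 1 := by simp [hr, div_self hg0]
  set ψ : ℂ → ℂ := fun z => (z - w₀) * r z with hψ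
  have hψA : AnalyticAt ℂ ψ w₀ := (analyticAt_id.sub analyticAt_const).mul hrA
  have hψ' : HasStrictDerivAt ψ 1 w₀ := by
    have h1 : HasDerivAt ψ (1 * r w₀ + (w₀ - w₀) * deriv r w₀) w₀ :=
      ((hasDerivAt_id w₀).sub_const w₀).mul hrA.differentiableAt.hasDerivAt
    have h2 := hψA.hasStrictDerivAt
    rw [h1.deriv, hr0] at h2
    simpa using h2
  have hgne : ∀ᶠ z in 𝓝 w₀, g z ≠ 0 := hg.continuousAt.eventually_ne hg0
  have hpow : ∀ᶠ z in 𝓝 w₀, G z - G w₀ = g w₀ * ψ z ^ n := by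
    filter_upwards [hgn, hgne] with z hz hz0
    rw [hz, hψ]
    have : r z ^ n = g z / g w₀ := by
      rw [hr]
      simp only
      rw [← Complex.exp_nat_mul, mul_div_cancel₀ _ (by exact_mod_cast hn0),
        Complex.exp_log (div_ne_zero hz0 hg0)]
    simp only [mul_pow, this, smul_eq_mul]
    field_simp
  have hT : ψ '' (S ∩ {z | G z - G w₀ = g w₀ * ψ z ^ n}) ∈ 𝓝 (0 : ℂ) := by
    have := hψ'.map_nhds_eq (by simp)
    rw [show (0 : ℂ) = ψ w₀ by simp [hψ], ← this]
    exact image_mem_map (inter_mem hS hpow)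
  set ω : ℂ := Complex.exp (2 * Real.pi * Complex.I / n) with hω
  have hprim := Complex.isPrimitiveRoot_exp n hn0
  have hω1 : ω ≠ 1 := hprim.ne_one (by omega)
  have hωn : ω ^ n = 1 := hprim.pow_eq_one
  have hT' : ∀ᶠ t in 𝓝 (0 : ℂ), ω * t ∈ ψ '' (S ∩ {z | G z - G w₀ = g w₀ * ψ z ^ n}) := by
    have : Tendsto (fun t : ℂ => ω * t) (𝓝 0) (𝓝 0) := by
      have : Continuous fun t : ℂ => ω * t := by fun_prop
      simpa using this.tendsto 0
    exact this hT
  obtain ⟨t, ⟨⟨z₁, ⟨hz1, hz1'⟩, e1⟩, ⟨z₂, ⟨hz2, hz2'⟩, e2⟩⟩, ht⟩ :=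
    ((((Filter.eventually_mem_set.2 hT).and hT').filter_mono nhdsWithin_le_nhds).and
      (self_mem_nhdsWithin : ∀ᶠ t in 𝓝[≠] (0 : ℂ), t ≠ 0)).exists
  have : G z₁ = G z₂ := by
    have h1 : G z₁ - G w₀ = g w₀ * ψ z₁ ^ n := hz1'
    have h2 : G z₂ - G w₀ = g w₀ * ψ z₂ ^ n := hz2'
    rw [e1] at h1
    rw [e2, mul_pow, hωn, one_mul] at h2
    exact sub_left_injective (h1.trans h2.symm)
  have h12 := hinj hz1 hz2 this
  rw [h12, e2] at e1
  exact hω1 (mul_right_cancel₀ ht (e1.trans (one_mul t).symm))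

/-- The map `u ↦ (P₀(u), u₁)` straightens the level sets of `P₀` when `∂P₀/∂z ≠ 0`; this is its
derivative, as an isomorphism. -/
theorem exists_equiv_of_partial_ne_zero (D : C2 →L[ℂ] C2)
    (h : D (EuclideanSpace.single 0 1) 0 ≠ 0) :
    ∃ e : C2 ≃L[ℂ] ℂ × ℂ, (e : C2 →L[ℂ] ℂ × ℂ) =
      ((EuclideanSpace.proj 0 : C2 →L[ℂ] ℂ).comp D).prod (EuclideanSpace.proj 1) := by
  set T : C2 →L[ℂ] ℂ × ℂ :=
    ((EuclideanSpace.proj 0 : C2 →L[ℂ] ℂ).comp D).prod (EuclideanSpace.proj 1) with hT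
  have hinj : Function.Injective (T : C2 →ₗ[ℂ] ℂ × ℂ) := by
    rw [← LinearMap.ker_eq_bot, LinearMap.ker_eq_bot']
    intro v hv
    have h0 : D v 0 = 0 := congrArg Prod.fst hv
    have h1 : v 1 = 0 := congrArg Prod.snd hv
    have hv' : v = v 0 • EuclideanSpace.single 0 1 := by
      ext i; fin_cases i <;> simp [h1]
    rw [hv'] at h0
    have h2 : v 0 * D (EuclideanSpace.single 0 1) 0 = 0 := by simpa using h0
    have h3 : v 0 = 0 := (mul_eq_zero.1 h2).resolve_right h
    rw [hv', h3, zero_smul]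
  refine ⟨(LinearMap.linearEquivOfInjective (T : C2 →ₗ[ℂ] ℂ × ℂ) hinj
    (by simp)).toContinuousLinearEquiv, ?_⟩
  ext v <;> rfl

/-- An injective holomorphic map of `ℂ²` whose first component has nonvanishing `z`-derivative
is open: along the level curves of the first component, the second one is an injective function of
one variable, so that its derivative cannot vanish. -/
theorem map_nhds_eq_of_injOn {P : C2 → C2} {U : Set C2} (hU : IsOpen U)
    (hP : DifferentiableOn ℂ P U) (hinj : InjOn P U)
    (h0 : ∀ u ∈ U, fderiv ℂ P u (EuclideanSpace.single 0 1) 0 ≠ 0) {u : C2} (hu : u ∈ U) :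
    map P (𝓝 u) = 𝓝 (P u) := by
  set Ψ : C2 → ℂ × ℂ := fun v => (P v 0, v 1) with hΨ
  have hΨs : ∀ v ∈ U, ∃ e : C2 ≃L[ℂ] ℂ × ℂ, HasStrictFDerivAt Ψ (e : C2 →L[ℂ] ℂ × ℂ) v ∧
      ∀ x, e x = (fderiv ℂ P v x 0, x 1) := by
    intro v hv
    obtain ⟨e, he⟩ := exists_equiv_of_partial_ne_zero _ (h0 v hv)
    refine ⟨e, ?_, fun x => ?_⟩
    · rw [he]
      exact ((EuclideanSpace.proj 0 : C2 →L[ℂ] ℂ).hasStrictFDerivAt.comp v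
        (hasStrictFDerivAt_of_differentiableOn hU hP hv)).prodMk
        (EuclideanSpace.proj 1 : C2 →L[ℂ] ℂ).hasStrictFDerivAt
    · change (e : C2 →L[ℂ] ℂ × ℂ) x = _
      rw [he]; rfl
  obtain ⟨e, he, hev⟩ := hΨs u hu
  have hstrict := hasStrictFDerivAt_of_differentiableOn hU hP hu
  have hDinj : Function.Injective (fderiv ℂ P u : C2 →ₗ[ℂ] C2) := by
    rw [← LinearMap.ker_eq_bot, LinearMap.ker_eq_bot']
    intro v hv
    by_contra hv0
    have hDv : fderiv ℂ P u v = 0 := hv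
    have hev' : e v = (0, v 1) := by rw [hev, hDv]; rfl
    have hv1 : v 1 ≠ 0 := by
      intro h
      apply hv0
      apply e.injective
      rw [hev', h, map_zero]; rfl
    set φ := he.toOpenPartialHomeomorph Ψ with hφ
    have hφc : ∀ x, φ x = Ψ x := fun x => rfl
    have husrc : u ∈ φ.source := he.mem_toOpenPartialHomeomorph_source
    have hutgt : (P u 0, u 1) ∈ φ.target := φ.map_source husrc
    have hsymm : φ.symm (P u 0, u 1) = u := φ.left_inv husrc
    -- the level curve of the first component through `u`
    set c : ℂ → C2 := fun w => φ.symm (P u 0, w) with hc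
    have hcu : c (u 1) = u := hsymm
    have hS : {w : ℂ | (P u 0, w) ∈ φ.target ∧ c w ∈ U} ∈ 𝓝 (u 1) := by
      have h1 : Tendsto (fun w : ℂ => (P u 0, w)) (𝓝 (u 1)) (𝓝 (P u 0, u 1)) := by
        have : Continuous fun w : ℂ => (P u 0, w) := by fun_prop
        exact this.tendsto _
      have h2 : Tendsto c (𝓝 (u 1)) (𝓝 u) := by
        have := (φ.continuousAt_symm hutgt).tendsto.comp h1
        rwa [hsymm] at this
      exact (h1.eventually_mem (φ.open_target.mem_nhds hutgt)).and
        (h2.eventually_mem (hU.mem_nhds hu))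
    have hcd : ∀ w ∈ {w : ℂ | (P u 0, w) ∈ φ.target ∧ c w ∈ U}, DifferentiableAt ℂ c w := by
      rintro w ⟨hw1, hw2⟩
      obtain ⟨e', he', -⟩ := hΨs _ hw2
      have := (φ.hasStrictFDerivAt_symm hw1 he').hasFDerivAt.differentiableAt
      exact this.comp w (by fun_prop : DifferentiableAt ℂ (fun w : ℂ => (P u 0, w)) w)
    have hPd : ∀ v ∈ U, DifferentiableAt ℂ P v := fun v hv => hP.differentiableAt (hU.mem_nhds hv)
    set G : ℂ → ℂ := fun w => P (c w) 1 with hG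
    have hGd : ∀ w ∈ {w : ℂ | (P u 0, w) ∈ φ.target ∧ c w ∈ U}, DifferentiableAt ℂ G w :=
      fun w hw => ((EuclideanSpace.proj 1 : C2 →L[ℂ] ℂ).differentiableAt).comp w
        ((hPd _ hw.2).comp w (hcd w hw))
    have hGA : AnalyticAt ℂ G (u 1) := by
      rw [Complex.analyticAt_iff_eventually_differentiableAt]
      filter_upwards [hS] with w hw using hGd w hw
    have hright : ∀ w, (P u 0, w) ∈ φ.target → P (c w) 0 = P u 0 ∧ (c w) 1 = w := by
      intro w hw
      have : Ψ (c w) = (P u 0, w) := φ.right_inv hw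
      exact ⟨congrArg Prod.fst this, congrArg Prod.snd this⟩
    refine deriv_ne_zero_of_injOn hGA hS ?_ ?_
    · rintro w ⟨hw1, hw2⟩ w' ⟨hw1', hw2'⟩ hww
      have : P (c w) = P (c w') := by
        ext i
        fin_cases i
        · exact (hright w hw1).1.trans (hright w' hw1').1.symm
        · exact hww
      rw [← (hright w hw1).2, hinj hw2 hw2' this, (hright w' hw1').2]
    · have hcD : HasFDerivAt φ.symm (e.symm : ℂ × ℂ →L[ℂ] C2) (P u 0, u 1) := by
        refine (φ.hasStrictFDerivAt_symm hutgt ?_).hasFDerivAt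
        rw [hsymm]; exact he
      have h1 : HasDerivAt (fun w : ℂ => (P u 0, w)) ((0 : ℂ), (1 : ℂ)) (u 1) :=
        (hasDerivAt_const _ _).prodMk (hasDerivAt_id _)
      have h2 : HasDerivAt c (e.symm (0, 1)) (u 1) := hcD.comp_hasDerivAt (u 1) h1
      have h3 : e.symm (0, 1) = (v 1)⁻¹ • v := by
        rw [e.symm_apply_eq, map_smul, hev']
        ext <;> simp [hv1]
      have h4 : HasDerivAt (fun w => P (c w)) (fderiv ℂ P u (e.symm (0, 1))) (u 1) := by
        have := (hPd u hu).hasFDerivAt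
        rw [← hcu] at this
        have := this.comp_hasDerivAt (u 1) h2
        rwa [hcu] at this
      rw [h3, map_smul, hDv, smul_zero] at h4
      have h5 := (EuclideanSpace.proj 1 : C2 →L[ℂ] ℂ).hasFDerivAt.comp_hasDerivAt (u 1) h4
      simpa using! h5.deriv
  exact hstrict.map_nhds_eq_of_surj
    (LinearMap.range_eq_top.2 (LinearMap.injective_iff_surjective.1 hDinj))

/-! ### Integral curves -/

/-- Picard–Lindelöf, with the information that the solution does not leave the ball. -/
theorem exists_integralCurve {X : C2 → C2} {x : C2} {r M τ : ℝ} {Λ : NNReal} (hr : 0 ≤ r)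
    (hM : 0 ≤ M) (hτ : 0 ≤ τ) (hlip : LipschitzOnWith Λ X (Metric.closedBall x r))
    (hX : ∀ y ∈ Metric.closedBall x r, ‖X y‖ ≤ M) (hMτ : M * τ ≤ r) :
    ∃ β : ℝ → C2, β 0 = x ∧ ∀ t ∈ Icc (-τ) τ, β t ∈ Metric.closedBall x r ∧
      HasDerivWithinAt β (X (β t)) (Icc (-τ) τ) t := by
  lift M to NNReal using hM
  lift r to NNReal using hr
  have h0 : (0 : ℝ) ∈ Icc (-τ) τ := ⟨by linarith, hτ⟩
  have hpl : IsPicardLindelof (fun _ => X) (⟨0, h0⟩ : Icc (-τ) τ) x r 0 M Λ :=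
    IsPicardLindelof.of_time_independent hX hlip (by simpa using hMτ)
  have hx : x ∈ Metric.closedBall x ((0 : NNReal) : ℝ) := by simp
  obtain ⟨α, hα⟩ := ODE.FunSpace.exists_isFixedPt_next hpl hx
  have hmem : ∀ t, α.compProj t ∈ Metric.closedBall x r := fun t =>
    α.compProj_mem_closedBall hpl.mul_max_le
  refine ⟨α.compProj, ?_, fun t ht => ⟨hmem t, ?_⟩⟩
  · have : α.compProj ((⟨0, h0⟩ : Icc (-τ) τ) : ℝ) = x := by
      rw [ODE.FunSpace.compProj_val, ← hα, ODE.FunSpace.next_apply₀]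
    exact this
  · apply ODE.hasDerivWithinAt_picard_Icc (f := fun _ => X) h0 hpl.continuousOn_uncurry
      α.continuous_compProj.continuousOn (fun _ _ => hmem _) x ht |>.congr_of_mem _ ht
    intro t' ht'
    nth_rw 1 [← hα]
    rw [ODE.FunSpace.compProj_of_mem ht', ODE.FunSpace.next_apply]

theorem gronwallBound_le {d K ε x : ℝ} (hK : 0 ≤ K) (hε : 0 ≤ ε) :
    gronwallBound d K ε x ≤ (d + ε * x) * Real.exp (K * x) := by
  rcases eq_or_ne K 0 with rfl | h
  · simp [gronwallBound_K0]
  · rw [gronwallBound_of_K_ne_0 h, add_mul]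
    have hK' : 0 < K := lt_of_le_of_ne hK (Ne.symm h)
    have h1 : Real.exp (K * x) - 1 ≤ K * x * Real.exp (K * x) := by
      have h2 := Real.add_one_le_exp (-(K * x))
      have h3 : Real.exp (-(K * x)) * Real.exp (K * x) = 1 := by
        rw [← Real.exp_add]; simp
      nlinarith [Real.exp_pos (K * x)]
    have h4 : ε / K * (Real.exp (K * x) - 1) ≤ ε / K * (K * x * Real.exp (K * x)) := by gcongr
    have h5 : ε / K * (K * x * Real.exp (K * x)) = ε * x * Real.exp (K * x) := by
      field_simp
    linarith

/-- Grönwall's inequality for an approximate and an exact solution of `γ' = κ X(γ)` with `κ`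
complex: this covers the real flow of `X` and its complex-time orbits alike. -/
theorem norm_sub_le_of_approx_solution {X : C2 → C2} {c : C2} {R : ℝ} {Λ : NNReal} {κ : ℂ} {ε : ℝ}
    {γ₁ γ₂ d : ℝ → C2} (hlip : LipschitzOnWith Λ X (Metric.ball c R)) (hε : 0 ≤ ε)
    (h₁ : ∀ u ∈ Icc (0 : ℝ) 1, γ₁ u ∈ Metric.ball c R ∧ HasDerivWithinAt γ₁ (d u) (Icc 0 1) u ∧
      ‖d u - κ • X (γ₁ u)‖ ≤ ε)
    (h₂ : ∀ u ∈ Icc (0 : ℝ) 1, γ₂ u ∈ Metric.ball c R ∧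
      HasDerivWithinAt γ₂ (κ • X (γ₂ u)) (Icc 0 1) u) {u : ℝ} (hu : u ∈ Icc (0 : ℝ) 1) :
    ‖γ₁ u - γ₂ u‖ ≤ (‖γ₁ 0 - γ₂ 0‖ + ε) * Real.exp (‖κ‖ * Λ) := by
  have hIci : ∀ {γ : ℝ → C2} {d : C2} {t : ℝ}, t ∈ Ico (0 : ℝ) 1 →
      HasDerivWithinAt γ d (Icc 0 1) t → HasDerivWithinAt γ d (Ici t) t := by
    intro γ d t ht h
    refine h.mono_of_mem_nhdsWithin ?_
    exact mem_of_superset (Icc_mem_nhdsGE ht.2) (Icc_subset_Icc_left ht.1)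
  have hmem : ∀ {t : ℝ}, t ∈ Ico (0 : ℝ) 1 → t ∈ Icc (0 : ℝ) 1 := fun ht => Ico_subset_Icc_self ht
  have hlip' : LipschitzOnWith (‖κ‖₊ * Λ) (fun x => κ • X x) (Metric.ball c R) := by
    refine LipschitzOnWith.of_dist_le_mul fun x hx y hy => ?_
    rw [dist_eq_norm, ← smul_sub, norm_smul, ← dist_eq_norm]
    push_cast
    rw [mul_assoc]
    exact mul_le_mul_of_nonneg_left (hlip.dist_le_mul x hx y hy) (norm_nonneg _)
  have := dist_le_of_approx_trajectories_ODE_of_mem (v := fun _ x => κ • X x)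
    (s := fun _ => Metric.ball c R) (K := ‖κ‖₊ * Λ) (f := γ₁) (g := γ₂) (f' := d)
    (g' := fun t => κ • X (γ₂ t)) (a := 0) (b := 1) (εf := ε) (εg := 0) (δ := ‖γ₁ 0 - γ₂ 0‖)
    (fun _ _ => hlip') (fun t ht => (h₁ t ht).2.1.continuousWithinAt)
    (fun t ht => hIci ht (h₁ t (hmem ht)).2.1)
    (fun t ht => by rw [dist_eq_norm]; exact (h₁ t (hmem ht)).2.2)
    (fun t ht => (h₁ t (hmem ht)).1) (fun t ht => (h₂ t ht).2.continuousWithinAt)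
    (fun t ht => hIci ht (h₂ t (hmem ht)).2) (fun t ht => by simp)
    (fun t ht => (h₂ t (hmem ht)).1) (by rw [dist_eq_norm]) u hu
  rw [dist_eq_norm] at this
  refine this.trans ((gronwallBound_mono (norm_nonneg _) (by simpa using hε) (by positivity)
    (show u - 0 ≤ 1 by linarith [hu.2])).trans ?_)
  refine (gronwallBound_le (by positivity) (by simpa using hε)).trans (le_of_eq ?_)
  simp

theorem norm_sub_le_of_hasDerivWithinAt_Icc {γ d : ℝ → C2} {B : ℝ}
    (h : ∀ u ∈ Icc (0 : ℝ) 1, HasDerivWithinAt γ (d u) (Icc 0 1) u ∧ ‖d u‖ ≤ B) {u v : ℝ}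
    (hu : u ∈ Icc (0 : ℝ) 1) (hv : v ∈ Icc (0 : ℝ) 1) : ‖γ v - γ u‖ ≤ B * |v - u| := by
  have := (convex_Icc (0 : ℝ) 1).norm_image_sub_le_of_norm_hasDerivWithin_le
    (fun x hx => (h x hx).1) (fun x hx => (h x hx).2) hu hv
  simpa using this

/-! ### Euler's scheme -/

/-- One step of length `τ` of Euler's scheme for the vector field `X`. -/
noncomputable def eulerStep (X : C2 → C2) (τ : ℝ) (x : C2) : C2 := x + τ • X x

/-- The Euler iterates stay in `V` as long as the ball of their maximal displacement does. -/
theorem iterate_eulerStep_mem {V : Set C2} {X : C2 → C2} {M τ : ℝ} (hM : ∀ x ∈ V, ‖X x‖ ≤ M)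
    (hτ : 0 ≤ τ) {x : C2} {n : ℕ} (hx : Metric.closedBall x (n * τ * M) ⊆ V) (hM0 : 0 ≤ M) :
    ∀ k ≤ n, (eulerStep X τ)^[k] x ∈ Metric.closedBall x (k * τ * M) := by
  intro k
  induction k with
  | zero => simp
  | succ k ih =>
    intro hk
    have h1 := ih (by omega)
    have hkn : (k : ℝ) ≤ n := by exact_mod_cast (by omega : k ≤ n)
    have h2 : (eulerStep X τ)^[k] x ∈ V :=
      hx (Metric.closedBall_subset_closedBall (by gcongr) h1)
    rw [Function.iterate_succ_apply', mem_closedBall_iff_norm] at *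
    set y := (eulerStep X τ)^[k] x
    calc ‖y + τ • X y - x‖ = ‖(y - x) + τ • X y‖ := by congr 1; abel
      _ ≤ ‖y - x‖ + ‖τ • X y‖ := norm_add_le _ _
      _ ≤ k * τ * M + τ * M := by
        gcongr
        rw [norm_smul, Real.norm_of_nonneg hτ]
        gcongr
        exact hM _ h2
      _ = ((k + 1 : ℕ) : ℝ) * τ * M := by push_cast; ring

/-- Euler's scheme with `n` steps approximates the time-one map of `δX` up to `O(1/n)`. -/
theorem norm_iterate_eulerStep_sub_le {V : Set C2} {X : C2 → C2} {c : C2} {R M δ : ℝ} {Λ : NNReal}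
    (hM : ∀ x ∈ V, ‖X x‖ ≤ M) (hM0 : 0 ≤ M) (hV : Metric.ball c R ⊆ V)
    (hlip : LipschitzOnWith Λ X (Metric.ball c R)) (hδ : 0 ≤ δ) {γ : ℝ → C2}
    (hγ : ∀ u ∈ Icc (0 : ℝ) 1, γ u ∈ Metric.ball c R ∧
      HasDerivWithinAt γ (δ • X (γ u)) (Icc 0 1) u)
    (hx : Metric.closedBall (γ 0) (δ * M) ⊆ Metric.ball c R) {n : ℕ} (hn : 0 < n) :
    ‖(eulerStep X (δ / n))^[n] (γ 0) - γ 1‖ ≤ δ * Λ * (δ * M) / n * Real.exp (Λ * δ) := by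
  have hn0 : (0 : ℝ) < n := by exact_mod_cast hn
  have hτ : 0 ≤ δ / n := by positivity
  have hball : Metric.closedBall (γ 0) (n * (δ / n) * M) ⊆ Metric.ball c R := by
    rwa [mul_div_cancel₀ _ hn0.ne']
  have hE : ∀ k ≤ n, (eulerStep X (δ / n))^[k] (γ 0) ∈ Metric.ball c R := by
    intro k hk
    have hkn : (k : ℝ) ≤ n := by exact_mod_cast hk
    exact hball (Metric.closedBall_subset_closedBall (by gcongr)
      (iterate_eulerStep_mem hM hτ (hball.trans hV) hM0 k hk))
  have hmoveγ : ∀ u ∈ Icc (0 : ℝ) 1, ∀ v ∈ Icc (0 : ℝ) 1, ‖γ v - γ u‖ ≤ δ * M * |v - u| :=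
    fun u hu v hv => norm_sub_le_of_hasDerivWithinAt_Icc (fun w hw => ⟨(hγ w hw).2, by
      rw [norm_smul, Real.norm_of_nonneg hδ]
      gcongr
      exact hM _ (hV (hγ w hw).1)⟩) hu hv
  set A := δ * Λ * (δ * M) / n ^ 2 with hA
  have hA0 : 0 ≤ A := by positivity
  have hlocal : ∀ k < n, ‖γ ((k + 1 : ℕ) / n) - (γ (k / n) + (δ / n) • X (γ (k / n)))‖ ≤ A := by
    intro k hk
    have hk1 : ((k + 1 : ℕ) : ℝ) / n ≤ 1 := by
      rw [div_le_one hn0]; exact_mod_cast hk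
    have hk0 : (0 : ℝ) ≤ k / n := by positivity
    have hkk : (k : ℝ) / n ≤ (k + 1 : ℕ) / n := by gcongr; omega
    have hu0 : (k : ℝ) / n ∈ Icc (0 : ℝ) 1 := ⟨hk0, hkk.trans hk1⟩
    have hsub : Icc ((k : ℝ) / n) ((k + 1 : ℕ) / n) ⊆ Icc 0 1 := Icc_subset_Icc hk0 hk1
    set w := δ • X (γ (k / n))
    have hd : ∀ u ∈ Icc ((k : ℝ) / n) ((k + 1 : ℕ) / n), HasDerivWithinAt (fun u => γ u - u • w)
        (δ • X (γ u) - (1 : ℝ) • w) (Icc ((k : ℝ) / n) ((k + 1 : ℕ) / n)) u := fun u hu =>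
      ((hγ u (hsub hu)).2.mono hsub).sub ((hasDerivWithinAt_id u _).smul_const w)
    have hstep : ((k + 1 : ℕ) : ℝ) / n - k / n = 1 / n := by push_cast; ring
    have hb : ∀ u ∈ Icc ((k : ℝ) / n) ((k + 1 : ℕ) / n), ‖δ • X (γ u) - (1 : ℝ) • w‖ ≤
        δ * Λ * (δ * M) / n := by
      intro u hu
      rw [one_smul, ← smul_sub, norm_smul, Real.norm_of_nonneg hδ, ← dist_eq_norm]
      have h1 := hlip.dist_le_mul _ (hγ u (hsub hu)).1 _ (hγ _ hu0).1
      have h2 := hmoveγ _ hu0 u (hsub hu)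
      rw [← dist_eq_norm, abs_of_nonneg (by linarith [hu.1])] at h2
      calc δ * dist (X (γ u)) (X (γ (k / n))) ≤ δ * (Λ * (δ * M * (1 / n))) := by
            gcongr
            refine h1.trans (mul_le_mul_of_nonneg_left (h2.trans ?_) Λ.2)
            gcongr
            linarith [hu.2]
        _ = _ := by ring
    have := (convex_Icc _ _).norm_image_sub_le_of_norm_hasDerivWithin_le hd hb
      (left_mem_Icc.2 hkk) (right_mem_Icc.2 hkk)
    rw [hstep, Real.norm_of_nonneg (by positivity)] at this
    have e : γ ((k + 1 : ℕ) / n) - ((k + 1 : ℕ) / n : ℝ) • w - (γ (k / n) - (k / n : ℝ) • w) =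
        γ ((k + 1 : ℕ) / n) - (γ (k / n) + (δ / n) • X (γ (k / n))) := by
      have : (((k + 1 : ℕ) : ℝ) / n) • w = (k / n : ℝ) • w + (δ / n) • X (γ (k / n)) := by
        rw [show (((k + 1 : ℕ) : ℝ) / n) = k / n + 1 / n by linarith, add_smul]
        congr 1
        simp only [w, smul_smul]
        congr 1; ring
      rw [this]; abel
    rw [← e]
    refine this.trans (le_of_eq ?_)
    rw [hA]; field_simp
  have key : ∀ k ≤ n, ‖(eulerStep X (δ / n))^[k] (γ 0) - γ (k / n)‖ ≤
      k * A * Real.exp (Λ * (δ / n) * k) := by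
    intro k
    induction k with
    | zero => simp
    | succ k ih =>
      intro hk
      have h1 := ih (by omega)
      have h2 := hlocal k (by omega)
      rw [Function.iterate_succ_apply']
      set y := (eulerStep X (δ / n))^[k] (γ 0) with hy
      have hkI : (k : ℝ) / n ∈ Icc (0 : ℝ) 1 :=
        ⟨by positivity, by rw [div_le_one hn0]; exact_mod_cast (by omega : k ≤ n)⟩
      have h3 := hlip.dist_le_mul _ (hE k (by omega)) _ (hγ _ hkI).1
      rw [dist_eq_norm, dist_eq_norm] at h3
      have h4 : ‖eulerStep X (δ / n) y - γ ((k + 1 : ℕ) / n)‖ ≤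
          ‖y - γ (k / n)‖ * (1 + Λ * (δ / n)) + A := by
        have e : eulerStep X (δ / n) y - γ ((k + 1 : ℕ) / n) = (y - γ (k / n)) +
          (δ / n) • (X y - X (γ (k / n))) -
            (γ ((k + 1 : ℕ) / n) - (γ (k / n) + (δ / n) • X (γ (k / n)))) := by
          rw [eulerStep, smul_sub]; abel
        rw [e]
        refine (norm_sub_le _ _).trans (add_le_add ((norm_add_le _ _).trans ?_) h2)
        rw [norm_smul, Real.norm_of_nonneg hτ]
        have := mul_le_mul_of_nonneg_left h3 hτ
        linarith
      have h5 : 1 + Λ * (δ / n) ≤ Real.exp (Λ * (δ / n)) := by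
        linarith [Real.add_one_le_exp ((Λ : ℝ) * (δ / n))]
      have h6 : (1 : ℝ) ≤ Real.exp (Λ * (δ / n) * (k + 1 : ℕ)) := Real.one_le_exp (by positivity)
      calc _ ≤ (k * A * Real.exp (Λ * (δ / n) * k)) * Real.exp (Λ * (δ / n)) + A :=
            h4.trans (by gcongr)
        _ = k * A * Real.exp (Λ * (δ / n) * (k + 1 : ℕ)) + A := by
            rw [mul_assoc _ (Real.exp _), ← Real.exp_add]; push_cast; ring_nf
        _ ≤ k * A * Real.exp (Λ * (δ / n) * (k + 1 : ℕ)) +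
            A * Real.exp (Λ * (δ / n) * (k + 1 : ℕ)) := by
            gcongr; exact le_mul_of_one_le_right hA0 h6
        _ = _ := by push_cast; ring
  have h := key n le_rfl
  rw [div_self hn0.ne'] at h
  refine h.trans (le_of_eq ?_)
  rw [hA]
  congr 1
  · field_simp
  · congr 1; field_simp

/-! ### The time-one map near the periodic orbit -/

/-- The `ρ`-neighbourhood of the orbit annulus `Φ(strip s)`. -/
def tube (Φ : ℂ → C2) (s ρ : ℝ) : Set C2 := {x | ∃ t ∈ strip s, x ∈ Metric.ball (Φ t) ρ}

/-- Uniform control of the vector field `X` around the orbit annulus `Φ(strip s)`. -/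
structure TubeBounds (V : Set C2) (X : C2 → C2) (Φ : ℂ → C2) (s ρ M : ℝ) (Λ : NNReal) :
    Prop where
  s_pos : 0 < s
  rho_pos : 0 < ρ
  norm_le : ∀ x ∈ V, ‖X x‖ ≤ M
  ball_subset : ∀ t ∈ strip s, Metric.ball (Φ t) (4 * ρ) ⊆ V
  lipschitz : ∀ t ∈ strip s, LipschitzOnWith Λ X (Metric.ball (Φ t) (2 * ρ))
  deriv : ∀ t ∈ strip s, HasDerivAt Φ (X (Φ t)) t

theorem isOpen_strip (s : ℝ) : IsOpen (strip s) :=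
  isOpen_lt (Complex.continuous_im.abs) continuous_const

theorem convex_strip (s : ℝ) : Convex ℝ (strip s) := by
  have : strip s = Complex.imLm ⁻¹' (Ioo (-s) s) := by
    ext t; simp [strip, abs_lt]
  rw [this]
  exact (convex_Ioo _ _).linear_preimage _

theorem add_real_mem_strip {s : ℝ} {t : ℂ} (ht : t ∈ strip s) (x : ℝ) : t + x ∈ strip s := by
  simpa [strip] using ht

theorem isOpen_tube (Φ : ℂ → C2) (s ρ : ℝ) : IsOpen (tube Φ s ρ) := by
  have : tube Φ s ρ = ⋃ t ∈ strip s, Metric.ball (Φ t) ρ := by ext; simp [tube]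
  rw [this]
  exact isOpen_biUnion fun _ _ => Metric.isOpen_ball

open Classical in
/-- The function whose graph is the relation `h`; it is the identity where `h` is undefined. -/
noncomputable def stepMap (h : C2 → C2 → Prop) (x : C2) : C2 :=
  if hx : ∃ y, h x y then hx.choose else x

/-- A perturbation `η` of size `ε` and a time step `δ`, small compared with the tube. -/
structure StepBounds (V : Set C2) (η : C2 → C2) (ρ M δ ε : ℝ) : Prop where
  holo : DifferentiableOn ℂ η V
  norm_le : ∀ x ∈ V, ‖η x‖ ≤ ε
  delta_nonneg : 0 ≤ δ
  small : ε + δ * M < ρ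

section Step

variable {V : Set C2} {X η : C2 → C2} {Φ : ℂ → C2} {s ρ M δ ε : ℝ} {Λ : NNReal}

theorem TubeBounds.M_nonneg (hT : TubeBounds V X Φ s ρ M Λ) : 0 ≤ M := by
  have h0 : (0 : ℂ) ∈ strip s := by simpa [strip] using hT.s_pos
  have : Φ 0 ∈ V := hT.ball_subset 0 h0 (Metric.mem_ball_self (by linarith [hT.rho_pos]))
  exact (norm_nonneg _).trans (hT.norm_le _ this)

theorem TubeBounds.ball_subset_two (hT : TubeBounds V X Φ s ρ M Λ) {t : ℂ} (ht : t ∈ strip s) :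
    Metric.ball (Φ t) (2 * ρ) ⊆ V :=
  (Metric.ball_subset_ball (by linarith [hT.rho_pos])).trans (hT.ball_subset t ht)

theorem TubeBounds.tube_subset (hT : TubeBounds V X Φ s ρ M Λ) : tube Φ s ρ ⊆ V := by
  rintro x ⟨t, ht, hx⟩
  exact hT.ball_subset_two ht (Metric.ball_subset_ball (by linarith [hT.rho_pos]) hx)

theorem TubeBounds.mem (hT : TubeBounds V X Φ s ρ M Λ) {t : ℂ} (ht : t ∈ strip s) : Φ t ∈ V :=
  hT.ball_subset t ht (Metric.mem_ball_self (by linarith [hT.rho_pos]))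

theorem TubeBounds.norm_sub_le (hT : TubeBounds V X Φ s ρ M Λ) {t t' : ℂ} (ht : t ∈ strip s)
    (ht' : t' ∈ strip s) : ‖Φ t' - Φ t‖ ≤ M * ‖t' - t‖ :=
  (convex_strip s).norm_image_sub_le_of_norm_hasDerivWithin_le
    (fun x hx => (hT.deriv x hx).hasDerivWithinAt) (fun _ hx => hT.norm_le _ (hT.mem hx)) ht ht'

theorem StepBounds.eps_nonneg (hη : StepBounds V η ρ M δ ε) (hT : TubeBounds V X Φ s ρ M Λ) :
    0 ≤ ε := by
  have h0 : (0 : ℂ) ∈ strip s := by simpa [strip] using hT.s_pos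
  exact (norm_nonneg _).trans (hη.norm_le _ (hT.mem h0))

theorem FlowRel.exists_curve (hM : ∀ x ∈ V, ‖X x‖ ≤ M) {τ : ℝ} {x y : C2}
    (h : FlowRel V X τ x y) : ∃ γ : ℝ → C2, γ 0 = x ∧ γ 1 = y ∧
    ∀ u ∈ Icc (0 : ℝ) 1, γ u ∈ V ∧ HasDerivWithinAt γ (τ • X (γ u)) (Icc 0 1) u ∧
      ‖γ u - x‖ ≤ |τ| * M := by
  obtain ⟨γ, h0, h1, hγ⟩ := h
  refine ⟨γ, h0, h1, fun u hu => ⟨(hγ u hu).1, (hγ u hu).2, ?_⟩⟩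
  have hb : ∀ w ∈ Icc (0 : ℝ) 1, HasDerivWithinAt γ (τ • X (γ w)) (Icc 0 1) w ∧
      ‖τ • X (γ w)‖ ≤ |τ| * M := fun w hw => ⟨(hγ w hw).2, by
    rw [norm_smul, Real.norm_eq_abs]
    exact mul_le_mul_of_nonneg_left (hM _ (hγ w hw).1) (abs_nonneg _)⟩
  have := norm_sub_le_of_hasDerivWithinAt_Icc hb ⟨le_rfl, zero_le_one⟩ hu
  rw [h0, sub_zero, abs_of_nonneg hu.1] at this
  refine this.trans (mul_le_of_le_one_right ((norm_nonneg _).trans (hb u hu).2) hu.2)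

theorem FlowRel.norm_sub_le (hM : ∀ x ∈ V, ‖X x‖ ≤ M) {τ : ℝ} {x y : C2}
    (h : FlowRel V X τ x y) : ‖y - x‖ ≤ |τ| * M := by
  obtain ⟨γ, h0, h1, hγ⟩ := h.exists_curve hM
  rw [← h1]
  exact (hγ 1 ⟨zero_le_one, le_rfl⟩).2.2

theorem StepBounds.norm_add_sub_lt (hη : StepBounds V η ρ M δ ε) (hT : TubeBounds V X Φ s ρ M Λ)
    {t : ℂ} (ht : t ∈ strip s) {x : C2} (hx : x ∈ Metric.ball (Φ t) ρ) {z : C2}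
    (hz : ‖z - (x + η x)‖ ≤ δ * M) : z ∈ Metric.ball (Φ t) (2 * ρ) := by
  have h1 := hη.norm_le x (hT.tube_subset ⟨t, ht, hx⟩)
  rw [mem_ball_iff_norm] at *
  calc ‖z - Φ t‖ = ‖(z - (x + η x)) + η x + (x - Φ t)‖ := by congr 1; abel
    _ ≤ ‖z - (x + η x)‖ + ‖η x‖ + ‖x - Φ t‖ := norm_add₃_le
    _ < 2 * ρ := by linarith [hη.small]

theorem HRel.exists_curve (hη : StepBounds V η ρ M δ ε) (hT : TubeBounds V X Φ s ρ M Λ) {t : ℂ}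
    (ht : t ∈ strip s) {x y : C2} (hx : x ∈ Metric.ball (Φ t) ρ) (h : HRel V X η δ x y) :
    ∃ γ : ℝ → C2, γ 0 = x + η x ∧ γ 1 = y ∧ ∀ u ∈ Icc (0 : ℝ) 1,
      γ u ∈ Metric.ball (Φ t) (2 * ρ) ∧ HasDerivWithinAt γ (δ • X (γ u)) (Icc 0 1) u := by
  obtain ⟨-, h⟩ := h
  rw [one_mul, one_smul] at h
  obtain ⟨γ, h0, h1, hγ⟩ := h.exists_curve hT.norm_le
  refine ⟨γ, h0, h1, fun u hu => ⟨hη.norm_add_sub_lt hT ht hx ?_, (hγ u hu).2.1⟩⟩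
  simpa [abs_of_nonneg hη.delta_nonneg] using (hγ u hu).2.2

/-- Near the orbit annulus `h` is defined everywhere. -/
theorem exists_hRel (hη : StepBounds V η ρ M δ ε) (hT : TubeBounds V X Φ s ρ M Λ) {x : C2}
    (hx : x ∈ tube Φ s ρ) : ∃ y, HRel V X η δ x y := by
  obtain ⟨t, ht, hxt⟩ := hx
  have hsub : Metric.closedBall (x + η x) (δ * M) ⊆ Metric.ball (Φ t) (2 * ρ) := fun z hz =>
    hη.norm_add_sub_lt hT ht hxt (mem_closedBall_iff_norm.1 hz)
  obtain ⟨β, h0, hβ⟩ := exists_integralCurve (mul_nonneg hη.delta_nonneg hT.M_nonneg)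
    hT.M_nonneg hη.delta_nonneg ((hT.lipschitz t ht).mono hsub)
    (fun y hy => hT.norm_le y (hT.ball_subset_two ht (hsub hy))) (mul_comm _ _).le
  refine ⟨β δ, hT.tube_subset ⟨t, ht, hxt⟩, fun u => β (u * δ), by simpa using h0, by simp,
    fun u hu => ?_⟩
  have hδ := hη.delta_nonneg
  have hmaps : MapsTo (fun u : ℝ => u * δ) (Icc 0 1) (Icc (-δ) δ) := fun w hw =>
    ⟨by nlinarith [hw.1], by nlinarith [hw.2]⟩
  refine ⟨hT.ball_subset_two ht (hsub (hβ _ (hmaps hu)).1), ?_⟩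
  have := (hβ _ (hmaps hu)).2.scomp u ((hasDerivWithinAt_id u (Icc 0 1)).mul_const δ) hmaps
  simpa using! this

/-- Grönwall's inequality for two orbits of length one of the map `h`. -/
theorem HRel.norm_sub_le (hη : StepBounds V η ρ M δ ε) (hT : TubeBounds V X Φ s ρ M Λ) {t : ℂ}
    (ht : t ∈ strip s) {x x' y y' : C2} (hx : x ∈ Metric.ball (Φ t) ρ)
    (hx' : x' ∈ Metric.ball (Φ t) ρ) (h : HRel V X η δ x y) (h' : HRel V X η δ x' y') :
    ‖y - y'‖ ≤ ‖(x + η x) - (x' + η x')‖ * Real.exp (δ * Λ) := by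
  obtain ⟨γ, h0, h1, hγ⟩ := h.exists_curve hη hT ht hx
  obtain ⟨γ', h0', h1', hγ'⟩ := h'.exists_curve hη hT ht hx'
  have := norm_sub_le_of_approx_solution (κ := δ) (γ₁ := γ) (γ₂ := γ') (d := fun u => δ • X (γ u))
    (hT.lipschitz t ht) le_rfl
    (fun u hu => ⟨(hγ u hu).1, (hγ u hu).2, by rw [Complex.coe_smul]; simp⟩)
    (fun u hu => ⟨(hγ' u hu).1, by rw [Complex.coe_smul]; exact (hγ' u hu).2⟩)
    (right_mem_Icc.2 zero_le_one)
  rw [h0, h0', h1, h1', add_zero, Complex.norm_real, Real.norm_of_nonneg hη.delta_nonneg] at this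
  exact this

/-- Near the orbit annulus `h` is single valued, by uniqueness of integral curves. -/
theorem hRel_iff (hη : StepBounds V η ρ M δ ε) (hT : TubeBounds V X Φ s ρ M Λ) {x : C2}
    (hx : x ∈ tube Φ s ρ) (y : C2) :
    HRel V X η δ x y ↔ y = stepMap (HRel V X η δ) x := by
  have hex := exists_hRel hη hT hx
  have hs : HRel V X η δ x (stepMap (HRel V X η δ) x) := by
    rw [stepMap, dif_pos hex]; exact hex.choose_spec
  refine ⟨fun h => ?_, fun h => h ▸ hs⟩
  obtain ⟨t, ht, hxt⟩ := hx
  have := h.norm_sub_le hη hT ht hxt hxt hs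
  rw [sub_self, norm_zero, zero_mul] at this
  exact sub_eq_zero.1 (norm_le_zero_iff.1 this)

theorem hRel_stepMap (hη : StepBounds V η ρ M δ ε) (hT : TubeBounds V X Φ s ρ M Λ) {x : C2}
    (hx : x ∈ tube Φ s ρ) : HRel V X η δ x (stepMap (HRel V X η δ) x) :=
  (hRel_iff hη hT hx _).2 rfl

theorem norm_stepMap_sub_le (hη : StepBounds V η ρ M δ ε) (hT : TubeBounds V X Φ s ρ M Λ) {t : ℂ}
    (ht : t ∈ strip s) {x x' : C2} (hx : x ∈ Metric.ball (Φ t) ρ)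
    (hx' : x' ∈ Metric.ball (Φ t) ρ) :
    ‖stepMap (HRel V X η δ) x - stepMap (HRel V X η δ) x'‖ ≤
      (1 + ε / ρ) * Real.exp (δ * Λ) * ‖x - x'‖ := by
  have hρ := hT.rho_pos
  have h1 := (hRel_stepMap hη hT ⟨t, ht, hx⟩).norm_sub_le hη hT ht hx hx'
    (hRel_stepMap hη hT ⟨t, ht, hx'⟩)
  have hsub : Metric.ball (Φ t) ρ ⊆ Metric.ball (Φ t) (2 * ρ) :=
    Metric.ball_subset_ball (by linarith)
  have h4 : (2 : ℝ) * (2 * ρ) = 4 * ρ := by ring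
  have h2 := norm_sub_le_of_differentiableOn_ball (r := 2 * ρ) (B := ε) (by linarith)
    (hη.holo.mono (h4 ▸ hT.ball_subset t ht))
    (fun x hx => hη.norm_le x (hT.ball_subset t ht (h4 ▸ hx))) (hsub hx) (hsub hx')
  have h3 : ‖(x + η x) - (x' + η x')‖ ≤ (1 + ε / ρ) * ‖x - x'‖ := by
    calc _ = ‖(x - x') + (η x - η x')‖ := by congr 1; abel
      _ ≤ ‖x - x'‖ + 2 * ε / (2 * ρ) * ‖x - x'‖ := (norm_add_le _ _).trans (by gcongr)
      _ = _ := by field_simp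
  calc _ ≤ (1 + ε / ρ) * ‖x - x'‖ * Real.exp (δ * Λ) := h1.trans (by gcongr)
    _ = _ := by ring

/-- One step of `h` shadows the time `δ` of the orbit `Φ`. -/
theorem norm_stepMap_sub_orbit_le (hη : StepBounds V η ρ M δ ε) (hT : TubeBounds V X Φ s ρ M Λ)
    {t : ℂ} (ht : t ∈ strip s) {x : C2} (hx : x ∈ Metric.ball (Φ t) ρ) :
    ‖stepMap (HRel V X η δ) x - Φ (t + δ)‖ ≤ (‖x - Φ t‖ + ε) * Real.exp (δ * Λ) := by
  have hδ := hη.delta_nonneg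
  obtain ⟨γ, h0, h1, hγ⟩ := (hRel_stepMap hη hT ⟨t, ht, hx⟩).exists_curve hη hT ht hx
  have hmem : ∀ u : ℝ, t + (u * δ : ℝ) ∈ strip s := fun u => add_real_mem_strip ht _
  have hε := hη.eps_nonneg hT
  have hV := hT.tube_subset ⟨t, ht, hx⟩
  have := norm_sub_le_of_approx_solution (κ := δ) (γ₁ := γ) (γ₂ := fun u => Φ (t + (u * δ : ℝ)))
    (d := fun u => δ • X (γ u)) (hT.lipschitz t ht) le_rfl
    (fun u hu => ⟨(hγ u hu).1, (hγ u hu).2, by rw [Complex.coe_smul]; simp⟩)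
    (fun u hu => ⟨?_, ?_⟩) (right_mem_Icc.2 zero_le_one)
  · rw [h0, h1, add_zero, Complex.norm_real, Real.norm_of_nonneg hδ] at this
    simp only [one_mul, zero_mul, Complex.ofReal_zero, add_zero] at this
    refine this.trans ?_
    gcongr
    calc ‖x + η x - Φ t‖ = ‖(x - Φ t) + η x‖ := by congr 1; abel
      _ ≤ _ := (norm_add_le _ _).trans (by gcongr; exact hη.norm_le x hV)
  · rw [mem_ball_iff_norm]
    have h2 := hT.norm_sub_le ht (hmem u)
    rw [add_sub_cancel_left, Complex.norm_real, Real.norm_eq_abs,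
      abs_of_nonneg (mul_nonneg hu.1 hδ)] at h2
    have h3 : M * (u * δ) ≤ δ * M := by
      nlinarith [hu.2, mul_nonneg hδ hT.M_nonneg]
    linarith [hη.small, hT.rho_pos]
  · have hd : HasDerivAt (fun u : ℝ => t + ((u * δ : ℝ) : ℂ)) (δ : ℂ) u := by
      have := (((hasDerivAt_id u).mul_const δ).ofReal_comp).const_add t
      simpa using! this
    have := (hT.deriv _ (hmem u)).scomp u hd
    exact this.hasDerivWithinAt

/-- Along a holomorphic curve the time-one map is holomorphic, being a uniform limit of Euler
schemes. -/
theorem differentiableOn_stepMap_comp (hX : DifferentiableOn ℂ X V)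
    (hη : StepBounds V η ρ M δ ε) (hT : TubeBounds V X Φ s ρ M Λ) {D : Set ℂ} (hD : IsOpen D)
    {c : ℂ → C2} (hc : DifferentiableOn ℂ c D) (hcm : MapsTo c D (tube Φ s ρ)) :
    DifferentiableOn ℂ (fun z => stepMap (HRel V X η δ) (c z)) D := by
  have hM := hT.M_nonneg
  have hδ := hη.delta_nonneg
  have hball : ∀ z ∈ D, ∃ t ∈ strip s, c z ∈ Metric.ball (Φ t) ρ ∧
      Metric.closedBall (c z + η (c z)) (δ * M) ⊆ Metric.ball (Φ t) (2 * ρ) := by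
    intro z hz
    obtain ⟨t, ht, hxt⟩ := hcm hz
    exact ⟨t, ht, hxt, fun w hw => hη.norm_add_sub_lt hT ht hxt (mem_closedBall_iff_norm.1 hw)⟩
  set F : ℕ → ℂ → C2 := fun n z => (eulerStep X (δ / n))^[n] (c z + η (c z)) with hF
  have hlim : TendstoLocallyUniformlyOn F (fun z => stepMap (HRel V X η δ) (c z)) atTop D := by
    apply TendstoUniformlyOn.tendstoLocallyUniformlyOn
    rw [Metric.tendstoUniformlyOn_iff]
    intro e he
    have h0 : Tendsto (fun n : ℕ => δ * Λ * (δ * M) / n * Real.exp (Λ * δ)) atTop (𝓝 0) := by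
      have := (tendsto_const_div_atTop_nhds_zero_nat (δ * Λ * (δ * M))).mul_const
        (Real.exp (Λ * δ))
      simpa using this
    filter_upwards [h0.eventually_lt_const he, eventually_gt_atTop 0] with n hn hn0 z hz
    obtain ⟨t, ht, hxt, hsub⟩ := hball z hz
    obtain ⟨γ, g0, g1, hγ⟩ := (hRel_stepMap hη hT ⟨t, ht, hxt⟩).exists_curve hη hT ht hxt
    rw [dist_comm, dist_eq_norm]
    have := norm_iterate_eulerStep_sub_le hT.norm_le hM (hT.ball_subset_two ht)
      (hT.lipschitz t ht) hδ hγ (by rwa [g0]) hn0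
    rw [g0, g1] at this
    exact this.trans_lt hn
  refine hlim.differentiableOn ?_ hD
  filter_upwards [eventually_gt_atTop 0] with n hn
  have hn0 : (0 : ℝ) < n := by exact_mod_cast hn
  have hit : ∀ k ≤ n, DifferentiableOn ℂ
      (fun z => (eulerStep X (δ / n))^[k] (c z + η (c z))) D := by
    intro k
    induction k with
    | zero =>
      intro _
      exact hc.add (hη.holo.comp hc fun z hz => hT.tube_subset (hcm hz))
    | succ k ih =>
      intro hk
      have h1 := ih (by omega)
      simp only [Function.iterate_succ_apply']
      refine h1.add (DifferentiableOn.fun_const_smul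
        (DifferentiableOn.fun_comp hX h1 fun z hz => ?_) _)
      obtain ⟨t, ht, hxt, hsub⟩ := hball z hz
      have hkn : (k : ℝ) ≤ n := by exact_mod_cast (by omega : k ≤ n)
      have hsub' : Metric.closedBall (c z + η (c z)) (n * (δ / n) * M) ⊆ V := by
        rw [mul_div_cancel₀ _ hn0.ne']
        exact hsub.trans (hT.ball_subset_two ht)
      exact hsub' (Metric.closedBall_subset_closedBall (by gcongr)
        (iterate_eulerStep_mem hT.norm_le (by positivity) hsub' hM k (by omega)))
  exact hit n le_rfl

theorem continuousOn_stepMap (hη : StepBounds V η ρ M δ ε) (hT : TubeBounds V X Φ s ρ M Λ) :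
    ContinuousOn (stepMap (HRel V X η δ)) (tube Φ s ρ) := by
  rintro x ⟨t, ht, hx⟩
  have hl : LipschitzOnWith (Real.toNNReal ((1 + ε / ρ) * Real.exp (δ * Λ)))
      (stepMap (HRel V X η δ)) (Metric.ball (Φ t) ρ) := by
    refine LipschitzOnWith.of_dist_le' fun y hy z hz => ?_
    rw [dist_eq_norm, dist_eq_norm]
    exact norm_stepMap_sub_le hη hT ht hy hz
  exact (hl.continuousOn.continuousAt (Metric.isOpen_ball.mem_nhds hx)).continuousWithinAt

end Step

/-! ### Gluing the linearized pair into an invariant curve -/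

/-- A linearized pair `(h, h^q)` together with an open set `N` on which the relation `h` is the
graph of a map which is locally Lipschitz and holomorphic along holomorphic curves, and in which
the first `q + 1` iterates of the linearized box remain. -/
structure LinearizedPair (h : C2 → C2 → Prop) (N : Set C2) (q : ℕ) (α : ℝ) (β : ℂ) (ν s : ℝ)
    (P : C2 → C2) : Prop where
  isOpen : IsOpen N
  rel_iff : ∀ x ∈ N, ∀ y, h x y ↔ y = stepMap h x
  continuousOn : ContinuousOn (stepMap h) N
  holo_comp : ∀ (D : Set ℂ) (c : ℂ → C2), IsOpen D → DifferentiableOn ℂ c D → MapsTo c D N →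
    DifferentiableOn ℂ (fun z => stepMap h (c z)) D
  lipschitz_at : ∀ x ∈ N, ∃ C : ℝ, ∀ᶠ y in 𝓝 x, ‖stepMap h y - stepMap h x‖ ≤ C * ‖y - x‖
  conj : ConjugatesPair h q α β ν s P
  orbit_mem : ∀ u ∈ modelDomain ν s, ∀ j ≤ q + 1, (stepMap h)^[j] (P u) ∈ N
  two_le : 2 ≤ q
  nu_pos : 0 < ν
  s_pos : 0 < s
  alpha_mem : α ∈ Ioo (-1 : ℝ) 0
  beta_pos : 0 < β.im

/-- The multiplier `e^{2πiβ}` of the model map in the direction `w`. -/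
noncomputable def multiplier (β : ℂ) : ℂ := Complex.exp (2 * Real.pi * Complex.I * β)

/-- The curve `{w = 0}` continued along the orbit: writing `z = z' + m + kL` with `L = q - α`,
`0 ≤ Re z' < 1` and `0 ≤ Re z' + m < L`, its value at `z` is `h^m(P(z', 0))`. -/
noncomputable def gluedCurve (h : C2 → C2 → Prop) (P : C2 → C2) (L : ℝ) (z : ℂ) : C2 :=
  (stepMap h)^[⌊z.re - ⌊z.re / L⌋ * L⌋₊]
    (P !₂[z - (⌊z.re / L⌋ : ℂ) * L - (⌊z.re - ⌊z.re / L⌋ * L⌋₊ : ℂ), 0])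

theorem norm_multiplier_lt_one {β : ℂ} (hβ : 0 < β.im) : ‖multiplier β‖ < 1 := by
  rw [multiplier, Complex.norm_exp, Real.exp_lt_one_iff]
  have : (2 * Real.pi * Complex.I * β).re = -(2 * Real.pi * β.im) := by simp
  rw [this]
  have := Real.pi_pos
  have := mul_pos (mul_pos two_pos this) hβ
  linarith

theorem modelMap_one_zero (z w : ℂ) : modelMap 1 0 !₂[z, w] = !₂[z + 1, w] := by
  ext i; fin_cases i <;> simp [modelMap]

theorem modelMap_mk (α β z w : ℂ) : modelMap α β !₂[z, w] = !₂[z + α, multiplier β * w] := by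
  ext i; fin_cases i <;> simp [modelMap, multiplier]

theorem mk_mem_modelDomain {ν s : ℝ} {z w : ℂ} :
    !₂[z, w] ∈ modelDomain ν s ↔ -ν < z.re ∧ z.re < 1 + ν ∧ |z.im| < s ∧ ‖w‖ < s := by
  simp [modelDomain]

theorem isOpen_modelDomain (ν s : ℝ) : IsOpen (modelDomain ν s) := by
  have h0 : Continuous fun u : C2 => u 0 := (EuclideanSpace.proj 0 : C2 →L[ℂ] ℂ).continuous
  have h1 : Continuous fun u : C2 => u 1 := (EuclideanSpace.proj 1 : C2 →L[ℂ] ℂ).continuous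
  exact ((isOpen_lt continuous_const (Complex.continuous_re.comp h0)).inter
    ((isOpen_lt (Complex.continuous_re.comp h0) continuous_const).inter
    ((isOpen_lt (Complex.continuous_im.comp h0).abs continuous_const).inter
    (isOpen_lt h1.norm continuous_const))))

theorem eta_C2 (u : C2) : !₂[u 0, u 1] = u := by
  ext i; fin_cases i <;> rfl

theorem mk_eq_add_smul (z z₀ w : ℂ) :
    !₂[z, w] = !₂[z₀, w] + (z - z₀) • (EuclideanSpace.single 0 1 : C2) := by
  ext i; fin_cases i <;> simp

theorem hasDerivAt_mk (w z : ℂ) :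
    HasDerivAt (fun z : ℂ => (!₂[z, w] : C2)) (EuclideanSpace.single 0 1) z := by
  have : (fun z : ℂ => (!₂[z, w] : C2)) =
      fun z => !₂[0, w] + (z - 0) • (EuclideanSpace.single 0 1 : C2) :=
    funext fun z => mk_eq_add_smul z 0 w
  rw [this]
  simpa using (((hasDerivAt_id z).sub_const 0).smul_const
    (EuclideanSpace.single 0 1 : C2)).const_add (!₂[0, w] : C2)

theorem continuous_mk : Continuous fun p : ℂ × ℂ => (!₂[p.1, p.2] : C2) := by
  refine (PiLp.continuous_toLp 2 _).comp (continuous_pi fun i => ?_)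
  fin_cases i
  · exact continuous_fst
  · exact continuous_snd

theorem exists_nat_int_add_sub_mem {L : ℝ} (hL : 0 < L) (x : ℝ) :
    ∃ (n : ℕ) (k : ℤ), x + n - k * L ∈ Ico (0 : ℝ) 1 := by
  have h1 : x ≤ ⌈x / L⌉ * L := by
    have := Int.le_ceil (x / L)
    rwa [div_le_iff₀ hL] at this
  refine ⟨⌈⌈x / L⌉ * L - x⌉₊, ⌈x / L⌉, ?_, ?_⟩
  · linarith [Nat.le_ceil (⌈x / L⌉ * L - x)]
  · linarith [Nat.ceil_lt_add_one (a := ⌈x / L⌉ * L - x) (by linarith)]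

namespace LinearizedPair

variable {h : C2 → C2 → Prop} {N : Set C2} {q : ℕ} {α : ℝ} {β : ℂ} {ν s : ℝ} {P : C2 → C2}

theorem iterRel_iff (hp : LinearizedPair h N q α β ν s P) {n : ℕ} {x y : C2}
    (hx : ∀ j < n, (stepMap h)^[j] x ∈ N) : IterRel h n x y ↔ y = (stepMap h)^[n] x := by
  induction n generalizing x with
  | zero => simp [IterRel, eq_comm]
  | succ n ih =>
    have hx0 : x ∈ N := hx 0 (by omega)
    have := @ih (stepMap h x) fun j hj => by
      rw [← Function.iterate_succ_apply]; exact hx (j + 1) (by omega)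
    simp only [IterRel, hp.rel_iff x hx0, exists_eq_left, this, Function.iterate_succ_apply]

theorem step_P (hp : LinearizedPair h N q α β ν s P) {z w : ℂ}
    (hz : !₂[z, w] ∈ modelDomain ν s) : stepMap h (P !₂[z, w]) = P !₂[z + 1, w] := by
  have := hp.conj.conj_one _ hz
  have hN : P !₂[z, w] ∈ N := hp.orbit_mem _ hz 0 (by omega)
  rw [hp.rel_iff _ hN, modelMap_one_zero] at this
  exact this.symm

theorem iterate_q_P (hp : LinearizedPair h N q α β ν s P) {z w : ℂ}
    (hz : !₂[z, w] ∈ modelDomain ν s) :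
    (stepMap h)^[q] (P !₂[z, w]) = P !₂[z + α, multiplier β * w] := by
  have := hp.conj.conj_q _ hz
  rw [hp.iterRel_iff (fun j hj => hp.orbit_mem _ hz j (by omega)), modelMap_mk] at this
  exact this.symm

theorem differentiableOn_P (hp : LinearizedPair h N q α β ν s P) :
    DifferentiableOn ℂ P (modelDomain ν s) :=
  hp.conj.holo.mono fun _ hu => Or.inl (Or.inl hu)

theorem hasDerivAt_slice (hp : LinearizedPair h N q α β ν s P) {z w : ℂ}
    (hz : !₂[z, w] ∈ modelDomain ν s) : HasDerivAt (fun z => P !₂[z, w])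
      (fderiv ℂ P !₂[z, w] (EuclideanSpace.single 0 1)) z :=
  (hp.differentiableOn_P.differentiableAt
    ((isOpen_modelDomain ν s).mem_nhds hz)).hasFDerivAt.comp_hasDerivAt z (hasDerivAt_mk w z)

theorem isOpen_slice (ν s : ℝ) (w : ℂ) : IsOpen {z : ℂ | !₂[z, w] ∈ modelDomain ν s} :=
  (isOpen_modelDomain ν s).preimage
    (continuous_mk.comp (Continuous.prodMk continuous_id continuous_const))

theorem differentiableOn_iterate (hp : LinearizedPair h N q α β ν s P) (w : ℂ) :
    ∀ j ≤ q + 1, DifferentiableOn ℂ (fun z => (stepMap h)^[j] (P !₂[z, w]))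
      {z : ℂ | !₂[z, w] ∈ modelDomain ν s} := by
  intro j
  induction j with
  | zero => exact fun _ z hz => (hp.hasDerivAt_slice hz).differentiableAt.differentiableWithinAt
  | succ j ih =>
    intro hj
    simp only [Function.iterate_succ_apply']
    exact hp.holo_comp _ _ (isOpen_slice ν s w) (ih (by omega))
      fun z hz => hp.orbit_mem _ hz j (by omega)

theorem continuousOn_iterate (hp : LinearizedPair h N q α β ν s P) :
    ∀ j ≤ q + 1, ContinuousOn (fun u => (stepMap h)^[j] (P u)) (modelDomain ν s) := by
  intro j
  induction j with
  | zero => exact fun _ => hp.differentiableOn_P.continuousOn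
  | succ j ih =>
    intro hj
    simp only [Function.iterate_succ_apply']
    exact hp.continuousOn.comp (ih (by omega)) fun u hu => hp.orbit_mem u hu j (by omega)

theorem norm_mul_lt (hp : LinearizedPair h N q α β ν s P) {w : ℂ} (hw : ‖w‖ < s) (k : ℕ) :
    ‖multiplier β ^ k * w‖ < s := by
  rw [norm_mul, norm_pow]
  exact (mul_le_of_le_one_left (norm_nonneg w) (pow_le_one₀ (norm_nonneg _)
    (norm_multiplier_lt_one hp.beta_pos).le)).trans_lt hw

/-- The relation `h ∘ P = P ∘ 𝒯_{1,0}` persists on the image of the domain under `𝒯_{α,β}`, by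
analytic continuation from the part which is mapped into the domain by `𝒯_{1,0}`. -/
theorem step_P_image (hp : LinearizedPair h N q α β ν s P) {z w : ℂ}
    (hz : !₂[z, w] ∈ modelDomain ν s) (hz' : z.re < -α + ν) :
    stepMap h (P !₂[z + α, multiplier β * w]) = P !₂[z + α + 1, multiplier β * w] := by
  have hα := hp.alpha_mem
  have hν := hp.nu_pos
  obtain ⟨hz1, -, hz3, hw⟩ := mk_mem_modelDomain.1 hz
  have hw' : ‖multiplier β * w‖ < s := by simpa using hp.norm_mul_lt hw 1
  set D : Set ℂ := {z | z.re ∈ Ioo (-ν) (-α + ν)} ∩ {z | z.im ∈ Ioo (-s) s} with hD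
  have hDmem : ∀ z ∈ D, !₂[z, w] ∈ modelDomain ν s := fun z hz =>
    mk_mem_modelDomain.2 ⟨hz.1.1, by linarith [hz.1.2, hα.1], abs_lt.2 hz.2, hw⟩
  have hDmem' : ∀ z ∈ D, !₂[z + α + 1, multiplier β * w] ∈ modelDomain ν s := fun z hz =>
    mk_mem_modelDomain.2 ⟨by simp; linarith [hz.1.1, hα.1], by simp; linarith [hz.1.2],
      by simpa using abs_lt.2 hz.2, hw'⟩
  have hDo : IsOpen D := (isOpen_Ioo.preimage Complex.continuous_re).inter
    (isOpen_Ioo.preimage Complex.continuous_im)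
  have hDc : Convex ℝ D :=
    ((convex_Ioo (-ν) (-α + ν)).linear_preimage Complex.reLm).inter
      ((convex_Ioo (-s) s).linear_preimage Complex.imLm)
  have h1 : AnalyticOnNhd ℂ (fun z => (stepMap h)^[q + 1] (P !₂[z, w])) D :=
    ((hp.differentiableOn_iterate w (q + 1) le_rfl).mono hDmem).analyticOnNhd hDo
  have h2 : AnalyticOnNhd ℂ (fun z : ℂ => P !₂[z + α + 1, multiplier β * w]) D := by
    refine DifferentiableOn.analyticOnNhd (fun z hz => ?_) hDo
    have := (hp.hasDerivAt_slice (hDmem' z hz)).comp_add_const (z + α) 1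
    exact (this.comp_add_const z (α : ℂ)).differentiableAt.differentiableWithinAt
  have h0 : (0 : ℂ) ∈ D := ⟨⟨by simpa using hν, by simp; linarith [hα.2]⟩,
    ⟨by simpa using hp.s_pos, by simpa using hp.s_pos⟩⟩
  have hev : (fun z => (stepMap h)^[q + 1] (P !₂[z, w])) =ᶠ[𝓝 0]
      fun z : ℂ => P !₂[z + α + 1, multiplier β * w] := by
    have : {z : ℂ | z.re < ν} ∈ 𝓝 (0 : ℂ) :=
      (isOpen_lt Complex.continuous_re continuous_const).mem_nhds (by simpa using hν)
    filter_upwards [hDo.mem_nhds h0, this] with z hzD hzν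
    have hzν' : z.re < ν := hzν
    have hz1 : !₂[z + 1, w] ∈ modelDomain ν s := mk_mem_modelDomain.2
      ⟨by simp; linarith [hzD.1.1], by simp; linarith, by simpa using abs_lt.2 hzD.2, hw⟩
    rw [Function.iterate_succ_apply, hp.step_P (hDmem z hzD), hp.iterate_q_P hz1]
    congr 2; ring_nf
  have := h1.eqOn_of_preconnected_of_eventuallyEq h2 hDc.isPreconnected h0 hev
    (show z ∈ D from ⟨⟨hz1, hz'⟩, abs_lt.1 hz3⟩)
  simp only [Function.iterate_succ_apply'] at this
  rw [← hp.iterate_q_P hz, this]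

theorem period_mem (hp : LinearizedPair h N q α β ν s P) :
    (q : ℝ) < q - α ∧ (q : ℝ) - α < q + 1 :=
  ⟨by linarith [hp.alpha_mem.2], by linarith [hp.alpha_mem.1]⟩

theorem period_pos (hp : LinearizedPair h N q α β ν s P) : 0 < (q : ℝ) - α :=
  (Nat.cast_nonneg q).trans_lt hp.period_mem.1

theorem le_q (hp : LinearizedPair h N q α β ν s P) {x : ℝ} {m : ℕ} (hx : 0 ≤ x)
    (hm : x + m < q - α) : m ≤ q := by
  have h1 := hp.period_mem.2
  have : (m : ℝ) < (q + 1 : ℕ) := by push_cast; linarith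
  have := Nat.cast_lt.1 this
  omega

theorem mem_of_canonical (hp : LinearizedPair h N q α β ν s P) {z w : ℂ}
    (hz : z.re ∈ Ico (0 : ℝ) 1) (hzi : |z.im| < s) (hw : ‖w‖ < s) :
    !₂[z, w] ∈ modelDomain ν s :=
  mk_mem_modelDomain.2 ⟨by linarith [hz.1, hp.nu_pos], by linarith [hz.2, hp.nu_pos], hzi, hw⟩

/-- One application of `h` to the point `h^m(P(z, w))` of the suspension. -/
theorem exists_advance (hp : LinearizedPair h N q α β ν s P) {z w : ℂ} {m : ℕ}
    (hz : z.re ∈ Ico (0 : ℝ) 1) (hzi : |z.im| < s) (hw : ‖w‖ < s) (hm : z.re + m < q - α) :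
    ∃ (k m' : ℕ) (z' : ℂ), z'.re ∈ Ico (0 : ℝ) 1 ∧ z'.im = z.im ∧ z'.re + m' < q - α ∧
      z' + m' + k * ((q - α : ℝ) : ℂ) = z + m + 1 ∧
      stepMap h ((stepMap h)^[m] (P !₂[z, w])) =
        (stepMap h)^[m'] (P !₂[z', multiplier β ^ k * w]) := by
  have hα := hp.alpha_mem
  have hα1 := hα.1
  have hα2 := hα.2
  have hz0 := hz.1
  have hq := hp.two_le
  have hmem := hp.mem_of_canonical hz hzi hw
  by_cases h1 : z.re + (m + 1 : ℕ) < q - α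
  · exact ⟨0, m + 1, z, hz, rfl, h1, by push_cast; ring, by
      simp [Function.iterate_succ_apply']⟩
  push Not at h1
  have hmq := hp.le_q hz.1 hm
  have hmq' : q - 1 ≤ m := by
    have : (q : ℝ) < (m + 2 : ℕ) := by push_cast at *; linarith [hz.2, hα.2]
    have := Nat.cast_lt.1 this
    omega
  -- the step crosses `L`: it is `h ∘ h^q` if `m = q` and `h^q` if `m = q - 1`
  rcases (by omega : m = q ∨ m + 1 = q) with rfl | hmq1
  · push_cast at h1
    have hq2 : (2 : ℝ) ≤ m := by exact_mod_cast hq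
    refine ⟨1, 0, z + α + 1, ⟨by simp; linarith [hz.1], by simp; linarith⟩, by simp,
      by simp; linarith,
      by push_cast; ring, ?_⟩
    rw [hp.iterate_q_P hmem, hp.step_P_image hmem (by linarith [hp.nu_pos])]
    simp
  · have hmr : (m : ℝ) + 1 = q := by exact_mod_cast hmq1
    push_cast at h1
    refine ⟨1, 0, z + α, ⟨by simp; linarith [hz.1], by simp; linarith [hz.2]⟩, by simp,
      by simp; linarith [hz.2, hp.period_mem.1, (by exact_mod_cast hq : (2 : ℝ) ≤ q)], ?_, ?_⟩
    · rw [← hmr]; push_cast; ring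
    · rw [← Function.iterate_succ_apply' (stepMap h), Nat.succ_eq_add_one, hmq1,
        hp.iterate_q_P hmem]
      simp

/-- The whole forward orbit of a point of the box in terms of the fundamental domain
of the suspension: after `k` turns `w` is multiplied by the `k`-th power of the multiplier. -/
theorem exists_orbit (hp : LinearizedPair h N q α β ν s P) {z w : ℂ}
    (hz : z.re ∈ Ico (0 : ℝ) 1) (hzi : |z.im| < s) (hw : ‖w‖ < s) (n : ℕ) :
    ∃ (k m : ℕ) (z' : ℂ), z'.re ∈ Ico (0 : ℝ) 1 ∧ z'.im = z.im ∧ z'.re + m < q - α ∧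
      z' + m + k * ((q - α : ℝ) : ℂ) = z + n ∧
      (stepMap h)^[n] (P !₂[z, w]) = (stepMap h)^[m] (P !₂[z', multiplier β ^ k * w]) := by
  induction n with
  | zero =>
    have hq : (2 : ℝ) ≤ q := by exact_mod_cast hp.two_le
    exact ⟨0, 0, z, hz, rfl, by simp; linarith [hz.2, hp.alpha_mem.2], by simp, by simp⟩
  | succ n ih =>
    obtain ⟨k, m, z', h1, h2, h3, h4, h5⟩ := ih
    obtain ⟨k', m', z'', g1, g2, g3, g4, g5⟩ :=
      hp.exists_advance h1 (h2 ▸ hzi) (hp.norm_mul_lt hw k) h3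
    refine ⟨k' + k, m', z'', g1, g2.trans h2, g3, ?_, ?_⟩
    · push_cast at *
      linear_combination g4 + h4
    · rw [Function.iterate_succ_apply', h5, g5, pow_add, mul_assoc]

/-! ### The glued curve -/

/-- The glued curve computed from any representation `z' + m + kL` in the fundamental domain. -/
theorem gluedCurve_canonical {L : ℝ} (hL : 0 < L) {z : ℂ} {m : ℕ} (k : ℤ)
    (hz : z.re ∈ Ico (0 : ℝ) 1) (hm : z.re + m < L) :
    gluedCurve h P L (z + m + k * L) = (stepMap h)^[m] (P !₂[z, 0]) := by
  have hre : (z + m + k * (L : ℂ)).re = z.re + m + k * L := by simp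
  have h1 : ⌊(z.re + m + k * L) / L⌋ = k := by
    rw [Int.floor_eq_iff, le_div_iff₀ hL, div_lt_iff₀ hL]
    have : (0 : ℝ) ≤ m := Nat.cast_nonneg m
    constructor <;> nlinarith [hz.1]
  have h2 : ⌊z.re + m + k * L - k * L⌋₊ = m := by
    rw [Nat.floor_eq_iff (by have : (0 : ℝ) ≤ m := Nat.cast_nonneg m; linarith [hz.1])]
    constructor <;> linarith [hz.1, hz.2]
  rw [gluedCurve, hre, h1, h2]
  congr 3
  ring_nf

/-- Reduction modulo `L` to the fundamental domain, written as an integer plus a number with real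
part in `[0, 1)`. -/
theorem exists_canonical {L : ℝ} (hL : 0 < L) (z : ℂ) : ∃ (z' : ℂ) (m : ℕ) (k : ℤ),
    z'.re ∈ Ico (0 : ℝ) 1 ∧ z'.im = z.im ∧ z'.re + m < L ∧ z = z' + m + k * L := by
  set k := ⌊z.re / L⌋ with hk
  have hk1 : k * L ≤ z.re := by
    have := Int.floor_le (z.re / L); rwa [← hk, le_div_iff₀ hL] at this
  have hk2 : z.re < (k + 1) * L := by
    have := Int.lt_floor_add_one (z.re / L); rwa [← hk, div_lt_iff₀ hL] at this
  set m := ⌊z.re - k * L⌋₊ with hm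
  have hm1 : (m : ℝ) ≤ z.re - k * L := Nat.floor_le (by linarith)
  have hm2 : z.re - k * L < m + 1 := Nat.lt_floor_add_one _
  refine ⟨z - m - k * L, m, k, ⟨by simp; linarith, by simp; linarith⟩, by simp,
    by simp; linarith, by ring⟩

theorem gluedCurve_add_period {L : ℝ} (hL : 0 < L) (z : ℂ) (k : ℤ) :
    gluedCurve h P L (z + k * L) = gluedCurve h P L z := by
  obtain ⟨z', m, j, h1, -, h2, rfl⟩ := exists_canonical hL z
  rw [gluedCurve_canonical hL j h1 h2, ← gluedCurve_canonical hL (j + k) h1 h2]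
  push_cast; ring_nf

theorem gluedCurve_mem (hp : LinearizedPair h N q α β ν s P) {z : ℂ} (hz : z ∈ strip s) :
    gluedCurve h P (q - α) z ∈ N := by
  obtain ⟨z', m, j, h1, h3, h2, rfl⟩ := exists_canonical hp.period_pos z
  rw [gluedCurve_canonical hp.period_pos j h1 h2]
  exact hp.orbit_mem _ (hp.mem_of_canonical h1 (h3 ▸ hz) (by simpa using hp.s_pos)) m
    ((hp.le_q h1.1 h2).trans (Nat.le_succ q))

theorem gluedCurve_add_one (hp : LinearizedPair h N q α β ν s P) {z : ℂ} (hz : z ∈ strip s) :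
    gluedCurve h P (q - α) (z + 1) = stepMap h (gluedCurve h P (q - α) z) := by
  obtain ⟨z', m, j, h1, h3, h2, rfl⟩ := exists_canonical hp.period_pos z
  obtain ⟨k, m', z'', g1, -, g3, g4, g5⟩ :=
    hp.exists_advance (w := 0) h1 (h3 ▸ hz) (by simpa using hp.s_pos) h2
  rw [gluedCurve_canonical hp.period_pos j h1 h2, g5, mul_zero,
    ← gluedCurve_canonical hp.period_pos (j + k) g1 g3]
  congr 1
  push_cast at *
  linear_combination -g4

theorem gluedCurve_add_nat (hp : LinearizedPair h N q α β ν s P) {z : ℂ} (hz : z ∈ strip s)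
    (n : ℕ) : gluedCurve h P (q - α) (z + n) = (stepMap h)^[n] (gluedCurve h P (q - α) z) := by
  induction n with
  | zero => simp
  | succ n ih =>
    rw [Function.iterate_succ_apply', ← ih,
      ← hp.gluedCurve_add_one (by simpa using! add_real_mem_strip hz n)]
    push_cast; ring_nf

theorem gluedCurve_eq_P_Ico (hp : LinearizedPair h N q α β ν s P) {z : ℂ}
    (hz : z.re ∈ Ico (0 : ℝ) 1) : gluedCurve h P (q - α) z = P !₂[z, 0] := by
  have hq : (2 : ℝ) ≤ q := by exact_mod_cast hp.two_le
  have hz' := hz.2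
  have := gluedCurve_canonical (h := h) (P := P) (m := 0) hp.period_pos 0 hz
    (by simp; linarith [hp.alpha_mem.2])
  simpa using this

/-- The glued curve coincides with `P(·, 0)` beyond the fundamental interval `[0, 1)` on both sides,
so that its pieces fit together holomorphically. -/
theorem gluedCurve_eq_P (hp : LinearizedPair h N q α β ν s P) {r : ℝ} (hr : r ≤ ν) (hr' : r < 1)
    {z : ℂ} (hz : z ∈ strip s) (hz1 : -r < z.re) (hz2 : z.re < 1 + r) :
    gluedCurve h P (q - α) z = P !₂[z, 0] := by
  obtain ⟨hα1, hα2⟩ := hp.alpha_mem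
  have hq : (2 : ℝ) ≤ q := by exact_mod_cast hp.two_le
  have hs := hp.s_pos
  rcases lt_or_ge z.re 0 with h0 | h0
  · rw [← gluedCurve_add_period hp.period_pos z 1]
    have hmem : !₂[z - α, 0] ∈ modelDomain ν s := mk_mem_modelDomain.2
      ⟨by simp; linarith, by simp; linarith, by simpa using! hz, by simpa using hs⟩
    have hend : (stepMap h)^[q] (P !₂[z - α, 0]) = P !₂[z, 0] := by
      rw [hp.iterate_q_P hmem]; simp
    rcases lt_or_ge (z.re - α) 0 with h1 | h1
    · have hq1 : ((q - 1 : ℕ) : ℝ) = q - 1 := by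
        rw [Nat.cast_sub (by have := hp.two_le; omega)]; simp
      have := gluedCurve_canonical (h := h) (P := P) (z := z - α + 1) (m := q - 1) hp.period_pos 0
        ⟨by simp; linarith, by simp; linarith⟩ (by simp [hq1]; linarith)
      have hq1' : ((q - 1 : ℕ) : ℂ) = q - 1 := by exact_mod_cast congrArg (fun x : ℝ => (x : ℂ)) hq1
      rw [← hp.step_P hmem, ← Function.iterate_succ_apply, Nat.succ_eq_add_one,
        Nat.sub_add_cancel (by have := hp.two_le; omega), hend] at this
      rw [← this]
      congr 1
      rw [hq1']; push_cast; ring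
    · have := gluedCurve_canonical (h := h) (P := P) (z := z - α) (m := q) hp.period_pos 0
        ⟨by simp; linarith, by simp; linarith⟩ (by simp; linarith)
      rw [hend] at this
      rw [← this]
      congr 1
      push_cast; ring
  · rcases lt_or_ge z.re 1 with h1 | h1
    · exact hp.gluedCurve_eq_P_Ico ⟨h0, h1⟩
    · have hz' : (z - 1).re ∈ Ico (0 : ℝ) 1 := ⟨by simp; linarith, by simp; linarith⟩
      have hzs : z - 1 ∈ strip s := by simpa [strip] using hz
      have := hp.gluedCurve_add_one hzs
      rw [sub_add_cancel, hp.gluedCurve_eq_P_Ico hz', hp.step_P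
        (hp.mem_of_canonical hz' hzs (by simpa using hs)), sub_add_cancel] at this
      exact this

theorem differentiableOn_gluedCurve (hp : LinearizedPair h N q α β ν s P) :
    DifferentiableOn ℂ (gluedCurve h P (q - α)) (strip s) := by
  set r := min ν (1 / 2) with hr
  have hr0 : 0 < r := lt_min hp.nu_pos (by norm_num)
  have hr1 : r < 1 := (min_le_right _ _).trans_lt (by norm_num)
  set f := gluedCurve h P (q - α) with hf
  set D : ℕ → Set ℂ := fun m => {z | -r < (z - m).re ∧ (z - m).re < 1 + r} ∩ strip s with hD
  have hDo : ∀ m, IsOpen (D m) := fun m =>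
    ((isOpen_lt continuous_const (Complex.continuous_re.comp (continuous_id.sub continuous_const))
      ).inter (isOpen_lt (Complex.continuous_re.comp (continuous_id.sub continuous_const))
        continuous_const)).inter (isOpen_strip s)
  -- `f` is `P(·, 0)` on the first of the overlapping domains; the others follow by applying `h`
  have hdiff : ∀ m, DifferentiableOn ℂ f (D m) := by
    intro m
    induction m with
    | zero =>
      have : ∀ z ∈ D 0, f z = P !₂[z, 0] := fun z hz => hp.gluedCurve_eq_P (min_le_left _ _) hr1
        hz.2 (by have := hz.1.1; simpa only [Nat.cast_zero, sub_zero] using this)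
        (by have := hz.1.2; simpa only [Nat.cast_zero, sub_zero] using this)
      refine DifferentiableOn.congr (fun z hz => ?_) this
      refine (hp.hasDerivAt_slice (mk_mem_modelDomain.2
        ⟨?_, ?_, hz.2, by simpa using hp.s_pos⟩)).differentiableAt.differentiableWithinAt
      · have := hz.1.1; rw [Nat.cast_zero, sub_zero] at this; linarith [min_le_left ν (1 / 2)]
      · have := hz.1.2; rw [Nat.cast_zero, sub_zero] at this; linarith [min_le_left ν (1 / 2)]
    | succ m ih =>
      have hmaps : ∀ z ∈ D (m + 1), z - 1 ∈ D m := fun z hz =>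
        ⟨by
          have e : z - 1 - m = z - (m + 1 : ℕ) := by push_cast; ring
          change -r < (z - 1 - m).re ∧ (z - 1 - m).re < 1 + r
          rw [e]; exact hz.1, by simpa [strip] using hz.2⟩
      have h1 : DifferentiableOn ℂ (fun z => f (z - 1)) (D (m + 1)) :=
        DifferentiableOn.comp ih (differentiable_id.sub_const 1).differentiableOn hmaps
      refine (hp.holo_comp _ _ (hDo (m + 1)) h1
        fun z hz => hp.gluedCurve_mem (hmaps z hz).2).congr fun z hz => ?_
      rw [← hp.gluedCurve_add_one (hmaps z hz).2, sub_add_cancel]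
  intro z hz
  obtain ⟨z', m, k, h1, h3, h2, rfl⟩ := exists_canonical hp.period_pos z
  have hmem : z' + m ∈ D m := ⟨⟨by simp; linarith [h1.1], by simp; linarith [h1.2]⟩,
    by simpa [strip] using hz⟩
  have h4 := (hdiff m).differentiableAt ((hDo m).mem_nhds hmem)
  have h5 : f = fun w => f (w - k * ((q - α : ℝ) : ℂ)) := by
    funext w
    conv_lhs => rw [← sub_add_cancel w (k * ((q - α : ℝ) : ℂ)), hf,
      gluedCurve_add_period hp.period_pos]
  rw [h5]
  refine (DifferentiableAt.comp _ (?_ : DifferentiableAt ℂ f _)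
    (differentiableAt_id.sub_const _)).differentiableWithinAt
  simpa using h4

/-- The derivative of the glued curve vanishes nowhere: a zero would propagate along the forward
orbit into the linearized box. -/
theorem deriv_gluedCurve_ne_zero (hp : LinearizedPair h N q α β ν s P)
    (hP : ∀ u ∈ modelDomain ν s, fderiv ℂ P u (EuclideanSpace.single 0 1) ≠ 0) {z : ℂ}
    (hz : z ∈ strip s) : deriv (gluedCurve h P (q - α)) z ≠ 0 := by
  intro h0
  set f := gluedCurve h P (q - α) with hf
  have hd : ∀ z ∈ strip s, DifferentiableAt ℂ f z := fun z hz =>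
    hp.differentiableOn_gluedCurve.differentiableAt ((isOpen_strip s).mem_nhds hz)
  have hstep : ∀ z ∈ strip s, deriv f z = 0 → deriv f (z + 1) = 0 := by
    intro z hz h0
    obtain ⟨C, hC⟩ := hp.lipschitz_at _ (hp.gluedCurve_mem hz)
    have h1 : HasDerivAt f 0 z := h0 ▸ (hd z hz).hasDerivAt
    have h2 : HasDerivAt (fun w => f (w + 1)) 0 z := by
      rw [hasDerivAt_iff_isLittleO] at h1 ⊢
      refine Asymptotics.IsBigO.trans_isLittleO (Asymptotics.IsBigO.of_bound C ?_) h1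
      filter_upwards [(hd z hz).continuousAt.eventually hC, (isOpen_strip s).mem_nhds hz]
        with w hw hws
      simp only [smul_zero, sub_zero]
      rw [hf, hp.gluedCurve_add_one hws, hp.gluedCurve_add_one hz]
      exact hw
    have h3 : HasDerivAt f 0 (z + 1) := by
      have h4 : HasDerivAt (fun w => f (w + 1)) 0 (z + 1 - 1) := by simpa using h2
      have := h4.comp_sub_const (z + 1) 1
      simpa using this
    exact h3.deriv
  have hn : ∀ n : ℕ, deriv f (z + n) = 0 := by
    intro n
    induction n with
    | zero => simpa using h0
    | succ n ih =>
      have := hstep _ (by simpa using! add_real_mem_strip hz n) ih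
      rw [← this]; push_cast; ring_nf
  obtain ⟨n, k, hnk⟩ := exists_nat_int_add_sub_mem hp.period_pos z.re
  set z₁ : ℂ := z + n - k * ((q - α : ℝ) : ℂ) with hz₁
  have hz₁re : z₁.re ∈ Ico (0 : ℝ) 1 := by
    have : z₁.re = z.re + n - k * (q - α) := by simp [hz₁]
    rwa [this]
  have hz₁s : z₁ ∈ strip s := by
    have : z₁.im = z.im := by simp [hz₁]
    simpa [strip, this] using hz
  have hz₁d : deriv f z₁ = 0 := by
    have h5 : f = fun w => f (w + k * ((q - α : ℝ) : ℂ)) := by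
      funext w; rw [hf, gluedCurve_add_period hp.period_pos]
    rw [h5, deriv_comp_add_const, hz₁, sub_add_cancel, hn]
  have hmem := hp.mem_of_canonical hz₁re hz₁s (w := 0) (by simpa using hp.s_pos)
  have hr0 : 0 < min ν (1 / 2) := lt_min hp.nu_pos (by norm_num)
  have heq : f =ᶠ[𝓝 z₁] fun z => P !₂[z, 0] := by
    have h1 : {w : ℂ | -min ν (1 / 2) < w.re} ∈ 𝓝 z₁ :=
      (isOpen_lt continuous_const Complex.continuous_re).mem_nhds
        (show -min ν (1 / 2) < z₁.re by linarith [hz₁re.1])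
    have h2 : {w : ℂ | w.re < 1 + min ν (1 / 2)} ∈ 𝓝 z₁ :=
      (isOpen_lt Complex.continuous_re continuous_const).mem_nhds
        (show z₁.re < 1 + min ν (1 / 2) by linarith [hz₁re.2])
    filter_upwards [h1, h2, (isOpen_strip s).mem_nhds hz₁s] with w g1 g2 g3
    exact hp.gluedCurve_eq_P (min_le_left _ _) ((min_le_right _ _).trans_lt (by norm_num)) g3 g1 g2
  rw [heq.deriv_eq, (hp.hasDerivAt_slice hmem).deriv] at hz₁d
  exact hP _ hmem hz₁d

end LinearizedPair

/-! ### Attraction to the glued curve -/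

/-- The forward orbit of `x` under `h` remains in `N` and converges to `Γ`. -/
def AttractedTo (h : C2 → C2 → Prop) (N Γ : Set C2) (x : C2) : Prop :=
  (∀ n : ℕ, (stepMap h)^[n] x ∈ N) ∧
    Tendsto (fun n : ℕ => Metric.infDist ((stepMap h)^[n] x) Γ) atTop (𝓝 0)

theorem attractedTo_iff_step {h : C2 → C2 → Prop} {N Γ : Set C2} {x : C2} :
    AttractedTo h N Γ x ↔ x ∈ N ∧ AttractedTo h N Γ (stepMap h x) := by
  simp only [AttractedTo, ← Function.iterate_succ_apply]
  rw [tendsto_add_atTop_iff_nat (f := fun n => Metric.infDist ((stepMap h)^[n] x) Γ) 1,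
    ← and_assoc]
  refine and_congr_left fun _ => ⟨fun h => ⟨h 0, fun n => h (n + 1)⟩, fun h n => ?_⟩
  cases n with
  | zero => exact h.1
  | succ n => exact h.2 n

namespace LinearizedPair

variable {h : C2 → C2 → Prop} {N : Set C2} {q : ℕ} {α : ℝ} {β : ℂ} {ν s : ℝ} {P : C2 → C2}

theorem tendsto_iterate_multiplier (hp : LinearizedPair h N q α β ν s P) {c : ℝ} (hc : |c| < s)
    {w : ℂ} (hw : ‖w‖ < s) {ε : ℝ} (hε : 0 < ε) {m : ℕ} (hm : m ≤ q) :
    ∀ᶠ k : ℕ in atTop, ∀ z : ℂ, z.re ∈ Ico (0 : ℝ) 1 → z.im = c →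
      dist ((stepMap h)^[m] (P !₂[z, multiplier β ^ k * w])) ((stepMap h)^[m] (P !₂[z, 0])) <
        ε := by
  set K : Set (ℂ × ℂ) := (Icc (0 : ℝ) 1 ×ℂ {c}) ×ˢ Metric.closedBall 0 ‖w‖ with hK
  have hKc : IsCompact K := (isCompact_Icc.reProdIm isCompact_singleton).prod
    (isCompact_closedBall _ _)
  have hKmem : MapsTo (fun p : ℂ × ℂ => (!₂[p.1, p.2] : C2)) K (modelDomain ν s) := by
    rintro ⟨z, w'⟩ ⟨hz, hw'⟩
    rw [Complex.mem_reProdIm] at hz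
    have h2 : z.im = c := hz.2
    exact mk_mem_modelDomain.2 ⟨by linarith [hz.1.1, hp.nu_pos], by linarith [hz.1.2, hp.nu_pos],
      by rwa [h2], (mem_closedBall_zero_iff.1 hw').trans_lt hw⟩
  have hcont : ContinuousOn (fun p : ℂ × ℂ => (stepMap h)^[m] (P !₂[p.1, p.2])) K :=
    (hp.continuousOn_iterate m (hm.trans (Nat.le_succ q))).comp continuous_mk.continuousOn hKmem
  have huc := hKc.uniformContinuousOn_of_continuous hcont
  rw [Metric.uniformContinuousOn_iff] at huc
  obtain ⟨d, hd, hd'⟩ := huc ε hε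
  have hlim : Tendsto (fun k : ℕ => ‖multiplier β ^ k * w‖) atTop (𝓝 0) := by
    simpa using ((tendsto_pow_atTop_nhds_zero_of_norm_lt_one
      (norm_multiplier_lt_one hp.beta_pos)).mul_const w).norm
  filter_upwards [hlim.eventually_lt_const hd] with k hk z hz hzc
  have hle : ‖multiplier β ^ k * w‖ ≤ ‖w‖ := by
    rw [norm_mul, norm_pow]
    exact mul_le_of_le_one_left (norm_nonneg w) (pow_le_one₀ (norm_nonneg _)
      (norm_multiplier_lt_one hp.beta_pos).le)
  have hzmem : z ∈ Icc (0 : ℝ) 1 ×ℂ {c} := Complex.mem_reProdIm.2 ⟨⟨hz.1, hz.2.le⟩, hzc⟩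
  refine hd' (z, multiplier β ^ k * w) ⟨hzmem, by simpa using hle⟩ (z, 0) ⟨hzmem, by simp⟩ ?_
  rw [Prod.dist_eq, dist_self, max_eq_right dist_nonneg]
  simpa using hk

/-- The `w`-coordinate tends to zero along the orbit, while the imaginary part of `z` is
preserved. -/
theorem attractedTo_P_canonical (hp : LinearizedPair h N q α β ν s P) {z w : ℂ}
    (hz : z.re ∈ Ico (0 : ℝ) 1) (hzi : |z.im| < s) (hw : ‖w‖ < s) :
    AttractedTo h N (gluedCurve h P (q - α) '' {ξ | ξ.im = z.im}) (P !₂[z, w]) := by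
  constructor
  · intro n
    obtain ⟨k, m, z', h1, h2, h3, -, h5⟩ := hp.exists_orbit hz hzi hw n
    rw [h5]
    exact hp.orbit_mem _ (hp.mem_of_canonical h1 (h2 ▸ hzi) (hp.norm_mul_lt hw k)) m
      ((hp.le_q h1.1 h3).trans (Nat.le_succ q))
  · rw [Metric.tendsto_atTop]
    intro ε hε
    obtain ⟨k₀, hk₀⟩ := eventually_atTop.1 ((Set.finite_Iic q).eventually_all.2
      fun m hm => hp.tendsto_iterate_multiplier hzi hw hε hm)
    obtain ⟨n₀, hn₀⟩ := exists_nat_gt ((k₀ + 2) * ((q : ℝ) - α))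
    refine ⟨n₀, fun n hn => ?_⟩
    obtain ⟨k, m, z', h1, h2, h3, h4, h5⟩ := hp.exists_orbit hz hzi hw n
    have hk : k₀ ≤ k := by
      have h6 := congrArg Complex.re h4
      simp only [Complex.add_re, Complex.natCast_re, Complex.mul_re,
        Complex.ofReal_re, Complex.natCast_im, zero_mul, sub_zero] at h6
      have h7 : (n₀ : ℝ) ≤ n := by exact_mod_cast hn
      have h8 : (k₀ : ℝ) * (q - α) < (k : ℝ) * (q - α) := by
        linarith [hz.1, hp.period_pos]
      have := lt_of_mul_lt_mul_right h8 hp.period_pos.le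
      exact_mod_cast this.le
    rw [Real.dist_0_eq_abs, abs_of_nonneg Metric.infDist_nonneg, h5]
    refine (Metric.infDist_le_dist_of_mem ?_).trans_lt
      (hk₀ k hk m (mem_Iic.2 (hp.le_q h1.1 h3)) z' h1 h2)
    refine ⟨z' + m, by simpa using h2, ?_⟩
    have := gluedCurve_canonical (h := h) (P := P) hp.period_pos 0 h1 h3
    simpa using this

/-- Every point of the linearized box is attracted to the circle of the glued curve at its own
height `Im z`; points outside the fundamental interval are moved there by `h` or `h⁻¹`. -/
theorem attractedTo_P (hp : LinearizedPair h N q α β ν s P) {z w : ℂ}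
    (hz : !₂[z, w] ∈ modelDomain ν s) :
    AttractedTo h N (gluedCurve h P (q - α) '' {ξ | ξ.im = z.im}) (P !₂[z, w]) := by
  have key : ∀ (n : ℕ) (z : ℂ), !₂[z, w] ∈ modelDomain ν s → -(n : ℝ) ≤ z.re → z.re < n + 1 →
      AttractedTo h N (gluedCurve h P (q - α) '' {ξ | ξ.im = z.im}) (P !₂[z, w]) := by
    intro n
    induction n with
    | zero =>
      intro z hz h1 h2
      obtain ⟨-, -, hz3, hz4⟩ := mk_mem_modelDomain.1 hz
      exact hp.attractedTo_P_canonical ⟨by simpa using h1, by simpa using h2⟩ hz3 hz4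
    | succ n ih =>
      intro z hz h1 h2
      obtain ⟨hz1, hz2, hz3, hz4⟩ := mk_mem_modelDomain.1 hz
      push_cast at h1 h2
      have hn : (0 : ℝ) ≤ n := Nat.cast_nonneg n
      have hν := hp.nu_pos
      rcases lt_or_ge z.re 0 with h0 | h0
      · have := ih (z + 1) (mk_mem_modelDomain.2 ⟨by simp; linarith, by simp; linarith,
          by simpa using hz3, hz4⟩) (by simp; linarith) (by simp; linarith)
        rw [attractedTo_iff_step, hp.step_P hz]
        exact ⟨hp.orbit_mem _ hz 0 (by omega), by simpa using this⟩
      · rcases lt_or_ge z.re 1 with h1' | h1'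
        · exact hp.attractedTo_P_canonical ⟨h0, h1'⟩ hz3 hz4
        · have hmem : !₂[z - 1, w] ∈ modelDomain ν s := mk_mem_modelDomain.2
            ⟨by simp; linarith, by simp; linarith, by simpa using hz3, hz4⟩
          have := ih (z - 1) hmem (by simp; linarith) (by simp; linarith)
          rw [attractedTo_iff_step, hp.step_P hmem] at this
          simpa using this.2
  obtain ⟨n, hn⟩ := exists_nat_ge |z.re|
  exact key n z hz (by linarith [neg_abs_le z.re]) (by linarith [le_abs_self z.re])

/-! ### Rotation annuli on the glued curve -/

/-- The image under the glued curve of any substrip is an invariant rotation annulus, provided that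
the glued curve is injective modulo its period. -/
theorem isRotationAnnulus (hp : LinearizedPair h N q α β ν s P)
    (hP : ∀ u ∈ modelDomain ν s, fderiv ℂ P u (EuclideanSpace.single 0 1) ≠ 0)
    (hinj : ∀ z ∈ strip s, ∀ z' ∈ strip s,
      gluedCurve h P (q - α) z = gluedCurve h P (q - α) z' →
        ∃ k : ℤ, z' = z + k * ((q - α : ℝ) : ℂ)) {c r : ℝ} (hr : 0 < r) (hcr : |c| + r < s) :
    IsRotationAnnulus h (1 / (q - α)) (gluedCurve h P (q - α) '' {z | |z.im - c| < r}) := by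
  set L : ℝ := q - α with hL
  have hL0 : 0 < L := hp.period_pos
  have hLc : (L : ℂ) ≠ 0 := by exact_mod_cast hL0.ne'
  set f := gluedCurve h P L with hf
  set g : ℂ → ℂ := fun θ => L * θ + c * Complex.I with hg
  have hgim : ∀ θ, (g θ).im - c = L * θ.im := fun θ => by simp [hg]
  have hclosed : ∀ z : ℂ, |z.im - c| ≤ r → z ∈ strip s := by
    intro z hz
    have : |z.im| ≤ |z.im - c| + |c| := by
      have := abs_add_le (z.im - c) c
      rwa [sub_add_cancel] at this
    exact lt_of_le_of_lt this (by linarith)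
  have hgs' : ∀ θ, θ ∈ strip (r / L) ↔ |(g θ).im - c| < r := by
    intro θ
    rw [hgim, abs_mul, abs_of_pos hL0, strip, mem_ofPred_eq, lt_div_iff₀ hL0, mul_comm]
  have hgs : ∀ θ ∈ strip (r / L), g θ ∈ strip s := fun θ hθ => hclosed _ ((hgs' θ).1 hθ).le
  have hd : ∀ z ∈ strip s, DifferentiableAt ℂ f z := fun z hz =>
    hp.differentiableOn_gluedCurve.differentiableAt ((isOpen_strip s).mem_nhds hz)
  have hgd : ∀ θ, HasDerivAt g (L : ℂ) θ := fun θ => by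
    have := ((hasDerivAt_id θ).const_mul (L : ℂ)).add_const (c * Complex.I)
    rwa [mul_one] at this
  have hFd : ∀ θ ∈ strip (r / L), HasDerivAt (fun θ => f (g θ)) ((L : ℂ) • deriv f (g θ)) θ :=
    fun θ hθ => (hd _ (hgs θ hθ)).hasDerivAt.scomp θ (hgd θ)
  refine ⟨r / L, by positivity, fun θ => f (g θ), fun θ hθ =>
    (hFd θ hθ).differentiableAt.differentiableWithinAt, fun θ hθ => ?_, fun θ hθ θ' hθ' => ?_,
    fun θ hθ ε hε => ?_, ?_, fun θ hθ => ?_⟩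
  · rw [(hFd θ hθ).deriv]
    exact smul_ne_zero hLc (hp.deriv_gluedCurve_ne_zero hP (hgs θ hθ))
  · constructor
    · intro heq
      obtain ⟨k, hk⟩ := hinj _ (hgs θ hθ) _ (hgs θ' hθ') heq
      refine ⟨k, mul_left_cancel₀ hLc ?_⟩
      simp only [hg] at hk
      linear_combination hk
    · rintro ⟨k, rfl⟩
      have : g (θ + k) = g θ + k * L := by simp only [hg]; ring
      simp only [this]
      exact (gluedCurve_add_period hL0 _ k).symm
  -- the inverse is continuous: the parameters far from `θ` modulo `1` form a compact set `K`
  · set K : Set ℂ := (Icc (0 : ℝ) L ×ℂ Icc (c - r) (c + r)) ∩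
      {ξ | ∀ k : ℤ, ε * L ≤ ‖ξ - g θ - k * L‖} with hK
    have hKc : IsCompact K := by
      refine (isCompact_Icc.reProdIm isCompact_Icc).inter_right ?_
      rw [ofPred_forall]
      exact isClosed_iInter fun k => isClosed_le continuous_const (by fun_prop)
    have hKs : ∀ ξ ∈ K, ξ ∈ strip s := fun ξ hξ => hclosed ξ (by
      have := (Complex.mem_reProdIm.1 hξ.1).2
      rw [abs_le]; constructor <;> linarith [this.1, this.2])
    have hfK : IsCompact (f '' K) :=
      hKc.image_of_continuousOn fun ξ hξ => (hd ξ (hKs ξ hξ)).continuousAt.continuousWithinAt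
    have hnot : f (g θ) ∈ (f '' K)ᶜ := by
      rintro ⟨ξ, hξ, heq⟩
      obtain ⟨k, hk⟩ := hinj _ (hgs θ hθ) _ (hKs ξ hξ) heq.symm
      have := hξ.2 k
      rw [hk, add_sub_cancel_left, sub_self, norm_zero] at this
      exact absurd this (not_le.2 (by positivity))
    obtain ⟨ρ, hρ, hball⟩ := Metric.mem_nhds_iff.1 (hfK.isClosed.isOpen_compl.mem_nhds hnot)
    refine ⟨ρ, hρ, fun θ' hθ' hdist => ?_⟩
    by_contra hcon
    push Not at hcon
    set j : ℤ := ⌊(g θ').re / L⌋ with hj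
    have hj1 : j * L ≤ (g θ').re := by
      have := Int.floor_le ((g θ').re / L); rwa [← hj, le_div_iff₀ hL0] at this
    have hj2 : (g θ').re < (j + 1) * L := by
      have := Int.lt_floor_add_one ((g θ').re / L); rwa [← hj, div_lt_iff₀ hL0] at this
    refine hball (Metric.mem_ball.2 hdist) ⟨g θ' - j * L, ⟨Complex.mem_reProdIm.2 ?_, ?_⟩, ?_⟩
    · have him : (g θ' - j * L).im = (g θ').im := by simp
      have hre : (g θ' - j * L).re = (g θ').re - j * L := by simp
      have h3 := abs_lt.1 ((hgs' θ').1 hθ')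
      rw [him, hre]
      exact ⟨⟨by linarith, by linarith⟩, ⟨by linarith, by linarith⟩⟩
    · intro k
      have e : g θ' - j * L - g θ - k * L = L * (θ' - θ - ((j + k : ℤ) : ℂ)) := by
        simp only [hg]; push_cast; ring
      rw [e, norm_mul, Complex.norm_real, Real.norm_of_nonneg hL0.le, mul_comm]
      exact mul_le_mul_of_nonneg_left (hcon (j + k)) hL0.le
    · have := gluedCurve_add_period (h := h) (P := P) hL0 (g θ' - j * L) j
      rw [sub_add_cancel] at this
      exact this.symm
  · ext x
    constructor
    · rintro ⟨θ, hθ, rfl⟩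
      exact ⟨g θ, (hgs' θ).1 hθ, rfl⟩
    · rintro ⟨z, hz, rfl⟩
      have e : g ((z - c * Complex.I) / L) = z := by
        simp only [hg]; field_simp; ring
      exact ⟨(z - c * Complex.I) / L, (hgs' _).2 (by rwa [e]), by simp only [e]⟩
  · have e : g (θ + ((1 / L : ℝ) : ℂ)) = g θ + 1 := by
      simp only [hg]; push_cast; field_simp; ring
    simp only [e]
    rw [hp.rel_iff _ (hp.gluedCurve_mem (hgs θ hθ))]
    exact hp.gluedCurve_add_one (hgs θ hθ)

/-- Every point of the glued curve enters the linearized box within `q` iterations. -/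
theorem exists_iterate_gluedCurve (hp : LinearizedPair h N q α β ν s P) {z : ℂ}
    (hz : z ∈ strip s) : ∃ k ≤ q, ∃ z' : ℂ, !₂[z', 0] ∈ modelDomain ν s ∧ z'.im = z.im ∧
      (stepMap h)^[k] (gluedCurve h P (q - α) z) = P !₂[z', 0] := by
  have hL := hp.period_pos
  have hs : ‖(0 : ℂ)‖ < s := by simpa using hp.s_pos
  obtain ⟨z₁, m, j, h1, h3, h2, rfl⟩ := exists_canonical hL z
  have hz₁ : |z₁.im| < s := h3 ▸ hz
  rcases Nat.eq_zero_or_pos m with rfl | hm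
  · refine ⟨0, by omega, z₁, hp.mem_of_canonical h1 hz₁ hs, h3, ?_⟩
    rw [gluedCurve_canonical hL j h1 h2]; rfl
  -- the number of iterations needed to reach `L`
  set k := ⌈(q - α) - (z₁.re + m)⌉₊ with hk
  have hk1 : (q - α) - (z₁.re + m) ≤ k := Nat.le_ceil _
  have hk2 : (k : ℝ) < (q - α) - (z₁.re + m) + 1 := Nat.ceil_lt_add_one (by linarith)
  have hm1 : (1 : ℝ) ≤ m := by exact_mod_cast hm
  have hkq : k ≤ q := by
    have : (k : ℝ) < (q + 1 : ℕ) := by push_cast; linarith [h1.1, hp.period_mem.2]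
    have := Nat.cast_lt.1 this
    omega
  set z' : ℂ := z₁ + m + k - ((q - α : ℝ) : ℂ) with hz'
  have hre : z'.re ∈ Ico (0 : ℝ) 1 := ⟨by simp [hz']; linarith, by simp [hz']; linarith⟩
  have him : z'.im = z₁.im := by simp [hz']
  refine ⟨k, hkq, z', hp.mem_of_canonical hre (him ▸ hz₁) hs, him.trans h3, ?_⟩
  rw [← hp.gluedCurve_add_nat hz k, ← hp.gluedCurve_eq_P_Ico hre,
    ← gluedCurve_add_period hL z' (j + 1)]
  congr 1
  rw [hz']; push_cast; ring

theorem mem_backwardUnion (hp : LinearizedPair h N q α β ν s P) {z : ℂ} (hz : z ∈ strip s) :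
    gluedCurve h P (q - α) z ∈ backwardUnion h q (P '' modelDomain ν s) := by
  obtain ⟨k, hk, z', h1, -, h2⟩ := hp.exists_iterate_gluedCurve hz
  refine ⟨k, hk, _, mem_image_of_mem P h1, (hp.iterRel_iff fun j _ => ?_).2 h2.symm⟩
  rw [← hp.gluedCurve_add_nat hz j]
  exact hp.gluedCurve_mem (by simpa using! add_real_mem_strip hz j)

/-- A relatively compact rotation annulus on the glued curve attracts a neighbourhood of itself. -/
theorem exists_basin (hp : LinearizedPair h N q α β ν s P)
    (hopen : ∀ u ∈ modelDomain ν s, map P (𝓝 u) = 𝓝 (P u)) {r : ℝ} (hr : 0 < r) (hrs : r ≤ s) :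
    ∃ U : Set C2, IsOpen U ∧ U.Nonempty ∧ gluedCurve h P (q - α) '' strip r ⊆ U ∧
      U ⊆ backwardUnion h q (P '' modelDomain ν s) ∧
      U ⊆ basin h (gluedCurve h P (q - α) '' strip r) := by
  set f := gluedCurve h P (q - α) with hf
  set D : Set C2 := modelDomain ν s ∩ {u | u 0 ∈ strip r} with hD
  have hDo : IsOpen D := (isOpen_modelDomain ν s).inter
    ((isOpen_strip r).preimage (EuclideanSpace.proj 0 : C2 →L[ℂ] ℂ).continuous)
  have hPD : IsOpen (P '' D) := by
    rw [isOpen_iff_mem_nhds]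
    rintro _ ⟨u, hu, rfl⟩
    rw [← hopen u hu.1]
    exact image_mem_map (hDo.mem_nhds hu)
  -- `G k` consists of the points whose first `k` iterates remain in `N` and whose `k`-th iterate is
  -- in `P '' D`
  set G : ℕ → Set C2 := fun k => Nat.rec (P '' D) (fun _ S => N ∩ stepMap h ⁻¹' S) k with hG
  have hGs : ∀ k, G (k + 1) = N ∩ stepMap h ⁻¹' (G k) := fun k => rfl
  have hGo : ∀ k, IsOpen (G k) := by
    intro k
    induction k with
    | zero => exact hPD
    | succ k ih => exact hp.continuousOn.isOpen_inter_preimage hp.isOpen ih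
  have hGmem : ∀ k x, x ∈ G k ↔ (∀ j < k, (stepMap h)^[j] x ∈ N) ∧ (stepMap h)^[k] x ∈ P '' D := by
    intro k
    induction k with
    | zero => simp [hG]
    | succ k ih =>
      intro x
      rw [hGs, mem_inter_iff, mem_preimage, ih, ← and_assoc, ← Function.iterate_succ_apply]
      refine and_congr_left fun _ => ⟨fun h j hj => ?_, fun h => ⟨h 0 (by omega), fun j hj => ?_⟩⟩
      · cases j with
        | zero => exact h.1
        | succ j => exact h.2 j (by omega)
      · rw [← Function.iterate_succ_apply]; exact h (j + 1) (by omega)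
  have hattr : ∀ k, ∀ x ∈ G k, ∃ c : ℝ, |c| < r ∧ AttractedTo h N (f '' {ξ | ξ.im = c}) x := by
    intro k
    induction k with
    | zero =>
      rintro _ ⟨u, hu, rfl⟩
      refine ⟨(u 0).im, hu.2, ?_⟩
      have hu' : !₂[u 0, u 1] ∈ modelDomain ν s := by rw [eta_C2]; exact hu.1
      have := hp.attractedTo_P hu'
      rwa [eta_C2] at this
    | succ k ih =>
      intro x hx
      obtain ⟨c, hc, hc'⟩ := ih _ hx.2
      exact ⟨c, hc, attractedTo_iff_step.2 ⟨hx.1, hc'⟩⟩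
  have hsub : f '' strip r ⊆ ⋃ k ≤ q, G k := by
    rintro _ ⟨z, hz, rfl⟩
    have hzs : z ∈ strip s := lt_of_lt_of_le hz hrs
    obtain ⟨k, hk, z', h1, h2, h3⟩ := hp.exists_iterate_gluedCurve hzs
    refine mem_iUnion₂.2 ⟨k, hk, (hGmem k _).2 ⟨fun j _ => ?_, ?_⟩⟩
    · rw [hf, ← hp.gluedCurve_add_nat hzs j]
      exact hp.gluedCurve_mem (by simpa using! add_real_mem_strip hzs j)
    · rw [h3]
      refine mem_image_of_mem P ⟨h1, ?_⟩
      simpa [strip, h2] using hz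
  refine ⟨⋃ k ≤ q, G k, isOpen_iUnion fun k => isOpen_iUnion fun _ => hGo k,
    Nonempty.mono hsub ⟨f 0, mem_image_of_mem f (by simpa [strip] using hr)⟩, hsub, ?_, ?_⟩
  · intro x hx
    obtain ⟨k, hk, hxk⟩ := mem_iUnion₂.1 hx
    rw [hGmem] at hxk
    exact ⟨k, hk, _, image_mono inter_subset_left hxk.2, (hp.iterRel_iff hxk.1).2 rfl⟩
  · intro x hx
    obtain ⟨k, hk, hxk⟩ := mem_iUnion₂.1 hx
    obtain ⟨c, hc, hc1, hc2⟩ := hattr k x hxk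
    refine ⟨fun n => (stepMap h)^[n] x, rfl, fun n => ?_, ?_⟩
    · rw [hp.rel_iff _ (hc1 n)]
      exact Function.iterate_succ_apply' _ _ _
    · refine squeeze_zero (fun n => Metric.infDist_nonneg) (fun n => ?_) hc2
      refine Metric.infDist_le_infDist_of_subset (image_mono fun ξ hξ => ?_)
        ⟨f (c * Complex.I), mem_image_of_mem f (by simp)⟩
      have : ξ.im = c := hξ
      rwa [strip, mem_ofPred_eq, this]

theorem isCompact_gluedCurve_image (hp : LinearizedPair h N q α β ν s P) {a b : ℝ}
    (ha : -s < a) (hb : b < s) :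
    IsCompact (gluedCurve h P (q - α) '' {z | z.im ∈ Icc a b}) := by
  have e : gluedCurve h P (q - α) '' {z | z.im ∈ Icc a b} =
      gluedCurve h P (q - α) '' (Icc 0 (q - α) ×ℂ Icc a b) := by
    apply Subset.antisymm
    · rintro _ ⟨z, hz, rfl⟩
      obtain ⟨z', m, k, h1, h3, h2, rfl⟩ := exists_canonical hp.period_pos z
      refine ⟨z' + m, Complex.mem_reProdIm.2 ⟨⟨?_, ?_⟩, ?_⟩,
        (gluedCurve_add_period hp.period_pos _ k).symm⟩
      · have : (0 : ℝ) ≤ m := Nat.cast_nonneg m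
        simp; linarith [h1.1]
      · simpa using h2.le
      · have : (z' + (m : ℂ)).im = z'.im := by simp
        rw [this, h3]; exact hz
    · exact image_mono fun z hz => (Complex.mem_reProdIm.1 hz).2
  rw [e]
  refine (isCompact_Icc.reProdIm isCompact_Icc).image_of_continuousOn
    (hp.differentiableOn_gluedCurve.continuousOn.mono fun z hz => ?_)
  obtain ⟨h1, h2⟩ := (Complex.mem_reProdIm.1 hz).2
  rw [strip, mem_ofPred_eq, abs_lt]
  constructor <;> linarith

end LinearizedPair

/-! ### The orbit annulus -/

namespace VectorFieldAnnulus

variable {V : Set C2} {X : C2 → C2} {ζ : C2} {T sstar : ℝ} {Φ : ℂ → C2}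

theorem apply_add_period (hΦ : VectorFieldAnnulus V X ζ T sstar Φ) {t : ℂ} (ht : t ∈ strip sstar)
    (k : ℤ) : Φ (t + k * T) = Φ t := by
  have h1 : t + ((k * T : ℝ) : ℂ) ∈ strip sstar := add_real_mem_strip ht _
  push_cast at h1
  exact ((hΦ.period t ht _ h1).2 ⟨k, rfl⟩).symm

theorem exists_reduced {T : ℝ} (hT : 0 < T) (t : ℂ) : ∃ k : ℤ, (t - k * T).re ∈ Icc 0 T ∧
    (t - k * T).im = t.im := by
  have h1 := Int.floor_le (t.re / T)
  have h2 := Int.lt_floor_add_one (t.re / T)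
  rw [le_div_iff₀ hT] at h1
  rw [div_lt_iff₀ hT] at h2
  exact ⟨⌊t.re / T⌋, ⟨by simp; linarith, by simp; linarith⟩, by simp⟩

/-- Uniform bounds hold on a tube, since the orbit annulus is the image of a compact rectangle. -/
theorem exists_tubeBounds (hΦ : VectorFieldAnnulus V X ζ T sstar Φ) (hV : IsOpen V)
    (hX : DifferentiableOn ℂ X V) {M : ℝ} (hM : ∀ x ∈ V, ‖X x‖ ≤ M) :
    ∃ (ρ : ℝ) (Λ : NNReal), TubeBounds V X Φ (sstar / 2) ρ M Λ := by
  have hs := hΦ.sstar_pos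
  set R : Set ℂ := Icc 0 T ×ℂ Icc (-(sstar / 2)) (sstar / 2) with hR
  have hRs : R ⊆ strip sstar := by
    intro t ht
    obtain ⟨h1, h2⟩ := (Complex.mem_reProdIm.1 ht).2
    rw [strip, mem_ofPred_eq, abs_lt]
    constructor <;> linarith
  have hc : IsCompact (Φ '' R) := (isCompact_Icc.reProdIm isCompact_Icc).image_of_continuousOn
    fun t ht => (hΦ.deriv t (hRs ht)).continuousAt.continuousWithinAt
  obtain ⟨r, hr, hrV⟩ := hc.exists_thickening_subset_open hV
    (image_subset_iff.2 fun t ht => hΦ.mem t (hRs ht))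
  have hsub : ∀ t ∈ strip (sstar / 2), Metric.ball (Φ t) r ⊆ V := by
    intro t ht
    obtain ⟨k, hk1, hk2⟩ := exists_reduced hΦ.T_pos t
    have htR : t - k * T ∈ R := by
      refine Complex.mem_reProdIm.2 ⟨hk1, ?_⟩
      rw [hk2]
      exact abs_le.1 (le_of_lt ht)
    have : Φ t = Φ (t - k * T) := by
      have := hΦ.apply_add_period (hRs htR) k
      rwa [sub_add_cancel] at this
    rw [this]
    exact (Metric.ball_subset_thickening (mem_image_of_mem Φ htR) r).trans hrV
  have h4 : 4 * (r / 4) = r := by ring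
  have hM0 : 0 ≤ M := by
    have h0 : (0 : ℂ) ∈ strip sstar := by simpa [strip] using hs
    exact (norm_nonneg _).trans (hM _ (hΦ.mem 0 h0))
  refine ⟨r / 4, Real.toNNReal (2 * M / (2 * (r / 4))), by positivity, by positivity, hM,
    fun t ht => by rw [h4]; exact hsub t ht, fun t ht => ?_, fun t ht => hΦ.deriv t ?_⟩
  · refine LipschitzOnWith.of_dist_le' fun x hx y hy => ?_
    have h5 : (2 : ℝ) * (2 * (r / 4)) = r := by ring
    rw [dist_eq_norm, dist_eq_norm]
    exact norm_sub_le_of_differentiableOn_ball (by positivity)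
      (hX.mono (by rw [h5]; exact hsub t ht)) (fun x hx => hM x (hsub t ht (h5 ▸ hx))) hx hy
  · have h6 : |t.im| < sstar / 2 := ht
    exact h6.trans (half_lt_self hs)

/-- The vector field has no zero on the orbit annulus, since a zero would be an equilibrium. -/
theorem vectorField_ne_zero (hΦ : VectorFieldAnnulus V X ζ T sstar Φ) {s ρ M : ℝ} {Λ : NNReal}
    (hT : TubeBounds V X Φ s ρ M Λ) (hs : s ≤ sstar) {t : ℂ} (ht : t ∈ strip s) :
    X (Φ t) ≠ 0 := by
  intro h0
  have hρ := hT.rho_pos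
  have hM := hT.M_nonneg
  set e : ℝ := min (ρ / (M + 1)) (T / 2) with he
  have he0 : 0 < e := lt_min (by positivity) (by linarith [hΦ.T_pos])
  have heM : M * e < 2 * ρ := by
    have h1 : e * (M + 1) ≤ ρ := by
      rw [← le_div_iff₀ (by positivity)]; exact min_le_left _ _
    nlinarith
  have hmem : ∀ u : ℝ, t + (u * e : ℝ) ∈ strip s := fun u => add_real_mem_strip ht _
  have := norm_sub_le_of_approx_solution (κ := e) (γ₁ := fun u => Φ (t + (u * e : ℝ)))
    (γ₂ := fun _ => Φ t) (d := fun u => (e : ℂ) • X (Φ (t + (u * e : ℝ)))) (hT.lipschitz t ht)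
    le_rfl (fun u hu => ⟨?_, ?_, by simp⟩)
    (fun u hu => ⟨Metric.mem_ball_self (by linarith), by
      rw [h0, smul_zero]; exact hasDerivWithinAt_const _ _ _⟩) (right_mem_Icc.2 zero_le_one)
  · simp only [zero_mul, Complex.ofReal_zero, add_zero, sub_self, norm_zero, one_mul] at this
    have heq : Φ t = Φ (t + e) := (sub_eq_zero.1 (norm_le_zero_iff.1 this)).symm
    have hmem' : t + (e : ℂ) ∈ strip s := by simpa using hmem 1
    obtain ⟨k, hk⟩ := (hΦ.period t (lt_of_lt_of_le ht hs) _ (lt_of_lt_of_le hmem' hs)).1 heq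
    have hk' : e = k * T := by
      have := add_left_cancel hk
      exact_mod_cast this
    have heT : e ≤ T / 2 := min_le_right _ _
    have hTp := hΦ.T_pos
    have h1 : (0 : ℝ) < k := by
      by_contra hcon
      push Not at hcon
      nlinarith
    have h2 : (k : ℝ) < 1 := by
      by_contra hcon
      push Not at hcon
      nlinarith
    have h3 : (0 : ℤ) < k := by exact_mod_cast h1
    have h4 : k < (1 : ℤ) := by exact_mod_cast h2
    omega
  · rw [mem_ball_iff_norm]
    have h2 := hT.norm_sub_le ht (hmem u)
    rw [add_sub_cancel_left, Complex.norm_real, Real.norm_eq_abs,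
      abs_of_nonneg (mul_nonneg hu.1 he0.le)] at h2
    refine h2.trans_lt (lt_of_le_of_lt ?_ heM)
    gcongr
    exact mul_le_of_le_one_left he0.le hu.2
  · have hd : HasDerivAt (fun u : ℝ => t + ((u * e : ℝ) : ℂ)) (e : ℂ) u := by
      have := (((hasDerivAt_id u).mul_const e).ofReal_comp).const_add t
      simpa using! this
    exact ((hT.deriv _ (hmem u)).scomp u hd).hasDerivWithinAt

theorem hasStrictDerivAt (hΦ : VectorFieldAnnulus V X ζ T sstar Φ) {t : ℂ}
    (ht : t ∈ strip sstar) : HasStrictDerivAt Φ (X (Φ t)) t := by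
  have hd : DifferentiableOn ℂ Φ (strip sstar) := fun t ht =>
    (hΦ.deriv t ht).differentiableAt.differentiableWithinAt
  have := (hd.analyticAt ((isOpen_strip sstar).mem_nhds ht)).hasStrictDerivAt
  rwa [(hΦ.deriv t ht).deriv] at this

/-- The orbit is injective modulo its period in a quantitative way: near the diagonal modulo `T`
because `Φ' = X ∘ Φ` does not vanish, elsewhere by compactness. -/
theorem exists_norm_sub_le (hΦ : VectorFieldAnnulus V X ζ T sstar Φ) {s ρ M : ℝ} {Λ : NNReal}
    (hT : TubeBounds V X Φ s ρ M Λ) (hs : s ≤ sstar) : ∃ κ > 0, ∀ t ∈ strip (s / 2),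
      ∀ t' ∈ strip (s / 2), ∃ k : ℤ, ‖t' - t - k * T‖ ≤ κ * ‖Φ t' - Φ t‖ := by
  have hs0 := hT.s_pos
  set R : Set ℂ := Icc 0 T ×ℂ Icc (-(s / 2)) (s / 2) with hR
  have hRc : IsCompact R := isCompact_Icc.reProdIm isCompact_Icc
  have hRs : R ⊆ strip s := by
    intro t ht
    obtain ⟨h1, h2⟩ := (Complex.mem_reProdIm.1 ht).2
    rw [strip, mem_ofPred_eq, abs_lt]
    constructor <;> linarith
  have hss : strip s ⊆ strip sstar := fun t ht => lt_of_lt_of_le ht hs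
  have hcont : ∀ t ∈ strip s, ContinuousAt Φ t := fun t ht => (hT.deriv t ht).continuousAt
  have hloc : ∃ κ : ℝ, ∀ p ∈ R ×ˢ R, ∃ k : ℤ, ‖p.2 - p.1 - k * T‖ ≤ κ * ‖Φ p.2 - Φ p.1‖ := by
    refine (hRc.prod hRc).induction_on (p := fun S => ∃ κ : ℝ, ∀ p ∈ S, ∃ k : ℤ,
      ‖p.2 - p.1 - k * T‖ ≤ κ * ‖Φ p.2 - Φ p.1‖) ⟨0, by simp⟩ ?_ ?_ ?_
    · rintro S S' hSS' ⟨κ, hκ⟩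
      exact ⟨κ, fun p hp => hκ p (hSS' hp)⟩
    · rintro S S' ⟨κ, hκ⟩ ⟨κ', hκ'⟩
      refine ⟨max κ κ', fun p hp => ?_⟩
      rcases hp with hp | hp
      · obtain ⟨k, hk⟩ := hκ p hp
        exact ⟨k, hk.trans (by gcongr; exact le_max_left _ _)⟩
      · obtain ⟨k, hk⟩ := hκ' p hp
        exact ⟨k, hk.trans (by gcongr; exact le_max_right _ _)⟩
    · rintro ⟨t, t'⟩ ⟨ht, ht'⟩
      have ht := hRs ht
      have ht' := hRs ht'
      by_cases heq : Φ t = Φ t'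
      · obtain ⟨k, rfl⟩ := (hΦ.period t (hss ht) t' (hss ht')).1 heq
        set v := X (Φ t) with hv
        have hv0 : 0 < ‖v‖ := norm_pos_iff.2 (hΦ.vectorField_ne_zero hT hs ht)
        have hstr := (hΦ.hasStrictDerivAt (hss ht)).isLittleO.def
          (show (0 : ℝ) < ‖v‖ / 2 by positivity)
        have htend : Tendsto (fun p : ℂ × ℂ => (p.2 - k * T, p.1)) (𝓝 (t, t + k * T))
            (𝓝 (t, t)) := by
          have : Continuous fun p : ℂ × ℂ => (p.2 - k * T, p.1) := by fun_prop
          have := this.tendsto (t, t + k * T)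
          simpa using this
        have hmem : ∀ᶠ p : ℂ × ℂ in 𝓝 (t, t + k * T), p.2 - k * T ∈ strip s :=
          (continuousAt_fst.tendsto.comp htend).eventually_mem ((isOpen_strip s).mem_nhds ht)
        refine ⟨_, mem_nhdsWithin_of_mem_nhds ((htend.eventually hstr).and hmem), 2 / ‖v‖, ?_⟩
        rintro ⟨a, a'⟩ ⟨h1, h2⟩
        refine ⟨k, ?_⟩
        have h3 : Φ (a' - k * T) = Φ a' := by
          have := hΦ.apply_add_period (hss h2) k
          rw [sub_add_cancel] at this
          exact this.symm
        simp only [h3, ContinuousLinearMap.toSpanSingleton_apply] at h1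
        set w := a' - k * T - a with hw
        have h4 : ‖w‖ * ‖v‖ ≤ ‖Φ a' - Φ a‖ + ‖v‖ / 2 * ‖w‖ := by
          rw [← norm_smul]
          calc ‖w • v‖ = ‖(Φ a' - Φ a) - (Φ a' - Φ a - w • v)‖ := by congr 1; abel
            _ ≤ _ := (norm_sub_le _ _).trans (by gcongr)
        have h5 : a' - a - k * T = w := by rw [hw]; ring
        simp only [h5]
        rw [div_mul_eq_mul_div, le_div_iff₀ hv0]
        linarith
      · have hpos : 0 < ‖Φ t' - Φ t‖ := norm_pos_iff.2 (sub_ne_zero.2 (Ne.symm heq))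
        have h1 : ∀ᶠ p : ℂ × ℂ in 𝓝 (t, t'), ‖Φ t' - Φ t‖ / 2 < ‖Φ p.2 - Φ p.1‖ := by
          have hc : ContinuousAt (fun p : ℂ × ℂ => ‖Φ p.2 - Φ p.1‖) (t, t') :=
            (((hcont t' ht').comp continuousAt_snd).sub
              ((hcont t ht).comp continuousAt_fst)).norm
          exact hc.eventually_const_lt (by linarith)
        have h2 : ∀ᶠ p : ℂ × ℂ in 𝓝 (t, t'), ‖p.2 - p.1‖ < ‖t' - t‖ + 1 := by
          have hc : Continuous fun p : ℂ × ℂ => ‖p.2 - p.1‖ := by fun_prop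
          exact (hc.tendsto (t, t')).eventually_lt_const (by simp)
        refine ⟨_, mem_nhdsWithin_of_mem_nhds (h1.and h2),
          (‖t' - t‖ + 1) / (‖Φ t' - Φ t‖ / 2), ?_⟩
        rintro p ⟨g1, g2⟩
        refine ⟨0, ?_⟩
        rw [Int.cast_zero, zero_mul, sub_zero, div_mul_eq_mul_div, le_div_iff₀ (by positivity)]
        gcongr
  obtain ⟨κ, hκ⟩ := hloc
  refine ⟨max κ 1, by positivity, fun t ht t' ht' => ?_⟩
  have hred : ∀ t ∈ strip (s / 2), ∃ j : ℤ, t - j * T ∈ R ∧ Φ (t - j * T) = Φ t := by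
    intro t ht
    obtain ⟨j, hj1, hj2⟩ := exists_reduced hΦ.T_pos t
    have hR : t - j * T ∈ R := by
      refine Complex.mem_reProdIm.2 ⟨hj1, ?_⟩
      rw [hj2]; exact abs_le.1 (le_of_lt ht)
    refine ⟨j, hR, ?_⟩
    have := hΦ.apply_add_period (hss (hRs hR)) j
    rw [sub_add_cancel] at this
    exact this.symm
  obtain ⟨j, hj1, hj2⟩ := hred t ht
  obtain ⟨j', hj1', hj2'⟩ := hred t' ht'
  obtain ⟨k, hk⟩ := hκ (t - j * T, t' - j' * T) ⟨hj1, hj1'⟩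
  refine ⟨k + j' - j, ?_⟩
  simp only [hj2, hj2'] at hk
  have e : t' - t - ((k + j' - j : ℤ) : ℂ) * T = t' - j' * T - (t - j * T) - k * T := by
    push_cast; ring
  rw [e]
  exact hk.trans (by gcongr; exact le_max_left _ _)

end VectorFieldAnnulus

/-! ### Comparison of the linearized box with the orbit annulus -/

section Step

variable {V : Set C2} {X η : C2 → C2} {Φ : ℂ → C2} {s ρ M δ ε : ℝ} {Λ : NNReal}

/-- The iterates of `h` shadow the orbit of the vector field. -/
theorem iterate_stepMap_near (hη : StepBounds V η ρ M δ ε) (hT : TubeBounds V X Φ s ρ M Λ)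
    {t : ℂ} (ht : t ∈ strip s) {x : C2} {e : ℝ} (hx : ‖x - Φ t‖ ≤ e) {n : ℕ}
    (hn : (e + n * ε) * Real.exp (n * δ * Λ) < ρ) : ∀ j ≤ n,
      (stepMap (HRel V X η δ))^[j] x ∈ tube Φ s ρ ∧
      ‖(stepMap (HRel V X η δ))^[j] x - Φ (t + (j * δ : ℝ))‖ ≤
        (e + j * ε) * Real.exp (j * δ * Λ) := by
  have hε := hη.eps_nonneg hT
  have hδ := hη.delta_nonneg
  have he : 0 ≤ e := (norm_nonneg _).trans hx
  have hlt : ∀ j ≤ n, (e + j * ε) * Real.exp (j * δ * Λ) < ρ := by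
    intro j hj
    have : (j : ℝ) ≤ n := by exact_mod_cast hj
    exact lt_of_le_of_lt (by gcongr) hn
  have key : ∀ j ≤ n, ‖(stepMap (HRel V X η δ))^[j] x - Φ (t + (j * δ : ℝ))‖ ≤
        (e + j * ε) * Real.exp (j * δ * Λ) := by
    intro j
    induction j with
    | zero => intro _; simpa using hx
    | succ j ih =>
      intro hj
      have h1 := ih (by omega)
      have hball : (stepMap (HRel V X η δ))^[j] x ∈ Metric.ball (Φ (t + (j * δ : ℝ))) ρ :=
        mem_ball_iff_norm.2 (h1.trans_lt (hlt j (by omega)))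
      have h2 := norm_stepMap_sub_orbit_le hη hT (add_real_mem_strip ht _) hball
      rw [Function.iterate_succ_apply']
      have e1 : t + ((j * δ : ℝ) : ℂ) + δ = t + (((j + 1 : ℕ) : ℝ) * δ : ℝ) := by
        push_cast; ring
      rw [e1] at h2
      refine h2.trans ?_
      have h3 : (1 : ℝ) ≤ Real.exp (j * δ * Λ) := Real.one_le_exp (by positivity)
      calc _ ≤ ((e + j * ε) * Real.exp (j * δ * Λ) + ε * Real.exp (j * δ * Λ)) *
            Real.exp (δ * Λ) := by
            gcongr
            exact le_mul_of_one_le_right hε h3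
        _ = (e + (j + 1 : ℕ) * ε) * (Real.exp (j * δ * Λ) * Real.exp (δ * Λ)) := by
            push_cast; ring
        _ = _ := by rw [← Real.exp_add]; congr 2; push_cast; ring
  exact fun j hj => ⟨⟨_, add_real_mem_strip ht _,
    mem_ball_iff_norm.2 ((key j hj).trans_lt (hlt j hj))⟩, key j hj⟩

/-- The box has diameter `O(δ)`. -/
theorem norm_sub_le_of_mem_box (hη : StepBounds V η ρ M δ ε) (hT : TubeBounds V X Φ s ρ M Λ)
    {s' ν : ℝ} (hν : ν < 1 / 3) (hs' : δ * s' < s) {y : C2} (hy : y ∈ box V X η Φ δ s' ν) :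
    ‖y - Φ 0‖ ≤ 2 * (δ * M + ε) + δ * s' * (1 + M) := by
  obtain ⟨t, ht, x, ⟨σ, r, hσ, hr, rfl⟩, hxV, hflow⟩ := hy
  have hM := hT.M_nonneg
  have hδ := hη.delta_nonneg
  have hε := hη.eps_nonneg hT
  set x := Φ (σ * Complex.I) + EuclideanSpace.single 1 r with hx
  have h0 : (0 : ℂ) ∈ strip s := by simpa [strip] using hT.s_pos
  have hσs : (σ : ℂ) * Complex.I ∈ strip s := by simpa [strip] using hσ.trans hs'
  have ht2 : |t| ≤ 2 := abs_le.2 ⟨by linarith [ht.1], by linarith [ht.2]⟩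
  have h1 := hflow.norm_sub_le hT.norm_le
  have h2 : |t * δ| * M ≤ 2 * (δ * M) := by
    rw [abs_mul, abs_of_nonneg hδ, mul_assoc]; gcongr
  have h3 : ‖t • η x‖ ≤ 2 * ε := by
    rw [norm_smul, Real.norm_eq_abs]
    exact mul_le_mul ht2 (hη.norm_le x hxV) (norm_nonneg _) zero_le_two
  have h4 : ‖x - Φ 0‖ ≤ M * (δ * s') + δ * s' := by
    have h5 := hT.norm_sub_le h0 hσs
    rw [sub_zero, norm_mul, Complex.norm_I, mul_one, Complex.norm_real, Real.norm_eq_abs] at h5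
    calc ‖x - Φ 0‖ = ‖(Φ (σ * Complex.I) - Φ 0) + EuclideanSpace.single 1 r‖ := by
          congr 1; rw [hx]; abel
      _ ≤ ‖Φ (σ * Complex.I) - Φ 0‖ + ‖(EuclideanSpace.single 1 r : C2)‖ := norm_add_le _ _
      _ ≤ _ := by
        rw [PiLp.norm_single]
        exact add_le_add (h5.trans (by gcongr)) hr.le
  calc ‖y - Φ 0‖ = ‖(y - (x + t • η x)) + t • η x + (x - Φ 0)‖ := by congr 1; abel
    _ ≤ ‖y - (x + t • η x)‖ + ‖t • η x‖ + ‖x - Φ 0‖ := norm_add₃_le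
    _ ≤ 2 * (δ * M) + 2 * ε + (M * (δ * s') + δ * s') := by
      gcongr
      exact h1.trans h2
    _ = _ := by ring

/-- The curve `z ↦ P(z, 0)` is an approximate solution of `γ' = δX(γ)`, hence close to the orbit of
`X`. -/
theorem norm_P_sub_orbit_le (hT : TubeBounds V X Φ s ρ M Λ) (hδ : 0 ≤ δ) {ν š Z e : ℝ}
    {P : C2 → C2} (hd : DifferentiableOn ℂ P (modelDomain ν š))
    (hder : ∀ u ∈ modelDomain ν š,
      ‖fderiv ℂ P u (EuclideanSpace.single 0 1) - δ • X (P u)‖ ≤ e)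
    (hnear : ∀ u ∈ modelDomain ν š, ‖P u - Φ 0‖ < 2 * ρ) (hZM : M * (δ * Z) < 2 * ρ)
    (hZs : δ * Z < s) (hν : 0 < ν) {z : ℂ} (hz : !₂[z, 0] ∈ modelDomain ν š) (hzZ : ‖z‖ ≤ Z) :
    ‖P !₂[z, 0] - Φ (δ * z)‖ ≤ (‖P 0 - Φ 0‖ + Z * e) * Real.exp (Z * δ * Λ) := by
  have hM := hT.M_nonneg
  have hZ : 0 ≤ Z := (norm_nonneg z).trans hzZ
  obtain ⟨hz1, hz2, hz3, hz4⟩ := mk_mem_modelDomain.1 hz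
  have hconv : ∀ u ∈ Icc (0 : ℝ) 1, -ν < u * z.re ∧ u * z.re < 1 + ν := by
    rintro u ⟨hu0, hu1⟩
    rcases le_total 0 z.re with h | h
    · have := mul_nonneg hu0 h
      have := mul_le_of_le_one_left h hu1
      constructor <;> linarith
    · have := mul_nonpos_of_nonneg_of_nonpos hu0 h
      have := mul_nonneg (sub_nonneg.2 hu1) (neg_nonneg.2 h)
      constructor <;> nlinarith
  have hmem : ∀ u ∈ Icc (0 : ℝ) 1, (!₂[u * z, 0] : C2) ∈ modelDomain ν š := by
    intro u hu
    refine mk_mem_modelDomain.2 ⟨?_, ?_, ?_, hz4⟩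
    · have : ((u : ℂ) * z).re = u * z.re := by simp
      rw [this]; exact (hconv u hu).1
    · have : ((u : ℂ) * z).re = u * z.re := by simp
      rw [this]; exact (hconv u hu).2
    · have : ((u : ℂ) * z).im = u * z.im := by simp
      rw [this, abs_mul, abs_of_nonneg hu.1]
      exact (mul_le_of_le_one_left (abs_nonneg _) hu.2).trans_lt hz3
  have he : 0 ≤ e := (norm_nonneg _).trans (hder _ hz)
  have h0 : (0 : ℂ) ∈ strip s := by simpa [strip] using hT.s_pos
  have hnorm : ∀ u ∈ Icc (0 : ℝ) 1, ‖(δ : ℂ) * (u * z)‖ ≤ δ * Z := by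
    intro u hu
    rw [norm_mul, norm_mul, Complex.norm_real, Complex.norm_real, Real.norm_of_nonneg hδ,
      Real.norm_of_nonneg hu.1]
    gcongr
    exact (mul_le_of_le_one_left (norm_nonneg _) hu.2).trans hzZ
  have hstrip : ∀ u ∈ Icc (0 : ℝ) 1, (δ : ℂ) * (u * z) ∈ strip s := fun u hu =>
    lt_of_le_of_lt ((Complex.abs_im_le_norm _).trans (hnorm u hu)) hZs
  have hmul : ∀ u : ℝ, HasDerivAt (fun u : ℝ => (u : ℂ) * z) z u := fun u => by
    have := (hasDerivAt_id u).ofReal_comp.mul_const z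
    simpa using! this
  have := norm_sub_le_of_approx_solution (κ := δ * z) (ε := Z * e)
    (γ₁ := fun u => P !₂[u * z, 0]) (γ₂ := fun u => Φ (δ * (u * z)))
    (d := fun u => z • fderiv ℂ P !₂[u * z, 0] (EuclideanSpace.single 0 1))
    (hT.lipschitz 0 h0) (by positivity) (fun u hu => ⟨?_, ?_, ?_⟩) (fun u hu => ⟨?_, ?_⟩)
    (right_mem_Icc.2 zero_le_one)
  · simp only [Complex.ofReal_one, Complex.ofReal_zero, one_mul, zero_mul, mul_zero] at this
    have e0 : (!₂[0, 0] : C2) = 0 := by ext i; fin_cases i <;> rfl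
    rw [e0] at this
    refine this.trans ?_
    gcongr
    rw [norm_mul, Complex.norm_real, Real.norm_of_nonneg hδ, mul_comm]
    gcongr
  · exact mem_ball_iff_norm.2 (hnear _ (hmem u hu))
  · have h1 : HasDerivAt (fun z => P !₂[z, 0])
        (fderiv ℂ P !₂[u * z, 0] (EuclideanSpace.single 0 1)) (u * z) :=
      (hd.differentiableAt ((isOpen_modelDomain ν š).mem_nhds (hmem u hu))
        ).hasFDerivAt.comp_hasDerivAt _ (hasDerivAt_mk 0 _)
    exact (h1.scomp u (hmul u)).hasDerivWithinAt
  · have e1 : z • fderiv ℂ P !₂[u * z, 0] (EuclideanSpace.single 0 1) -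
        ((δ : ℂ) * z) • X (P !₂[u * z, 0]) =
        z • (fderiv ℂ P !₂[u * z, 0] (EuclideanSpace.single 0 1) - δ • X (P !₂[u * z, 0])) := by
      rw [smul_sub, ← Complex.coe_smul, smul_smul, mul_comm z]
    rw [e1, norm_smul]
    exact mul_le_mul hzZ (hder _ (hmem u hu)) (norm_nonneg _) hZ
  · have := hT.norm_sub_le h0 (hstrip u hu)
    rw [sub_zero] at this
    exact mem_ball_iff_norm.2 ((this.trans (by gcongr; exact hnorm u hu)).trans_lt hZM)
  · have h1 : HasDerivAt (fun u : ℝ => (δ : ℂ) * (u * z)) (δ * z) u := (hmul u).const_mul _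
    exact ((hT.deriv _ (hstrip u hu)).scomp u h1).hasDerivWithinAt

end Step

namespace LinearizedPair

variable {h : C2 → C2 → Prop} {N : Set C2} {q : ℕ} {α : ℝ} {β : ℂ} {ν s : ℝ} {P : C2 → C2}
  {Φ : ℂ → C2} {T δ σ κ E E' : ℝ}

/-- The period `L = q - α` of the glued curve is close to `T / δ`. -/
theorem abs_period_sub_le (hp : LinearizedPair h N q α β ν s P) (hδ : 0 < δ) (hσ : 0 < σ)
    (hκ : ∀ t ∈ strip σ, ∀ t' ∈ strip σ, ∃ k : ℤ, ‖t' - t - k * T‖ ≤ κ * ‖Φ t' - Φ t‖)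
    (hκ0 : 0 ≤ κ) (hq : δ * q ≤ T) (hq' : T < δ * (q + 1))
    (h0 : ‖P !₂[0, 0] - Φ 0‖ ≤ E)
    (h1 : ‖(stepMap h)^[q] (P !₂[(-α : ℂ), 0]) - Φ ((δ * (q - α) : ℝ) : ℂ)‖ ≤ E)
    (hsmall : 2 * κ * E + δ < T) : |δ * (q - α) - T| ≤ 2 * κ * E := by
  have hα := hp.alpha_mem
  have hα1 := hα.1
  have hα2 := hα.2
  have hs := hp.s_pos
  have hν := hp.nu_pos
  have hmem : (!₂[(-α : ℂ), 0] : C2) ∈ modelDomain ν s := mk_mem_modelDomain.2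
    ⟨by simp; linarith, by simp; linarith, by simpa using hs, by simpa using hs⟩
  rw [hp.iterate_q_P hmem, neg_add_cancel, mul_zero] at h1
  have hreal : ∀ x : ℝ, (x : ℂ) ∈ strip σ := fun x => by simpa [strip] using hσ
  have h2 : ‖Φ ((δ * (q - α) : ℝ) : ℂ) - Φ 0‖ ≤ 2 * E := by
    calc _ = ‖(P !₂[0, 0] - Φ 0) - (P !₂[0, 0] - Φ ((δ * (q - α) : ℝ) : ℂ))‖ := by
          congr 1; abel
      _ ≤ E + E := (norm_sub_le _ _).trans (add_le_add h0 h1)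
      _ = 2 * E := by ring
  obtain ⟨k, hk⟩ := hκ 0 (by simpa using hreal 0) _ (hreal (δ * (q - α)))
  have h3 : |δ * (q - α) - k * T| ≤ 2 * κ * E := by
    have e : ((δ * (q - α) : ℝ) : ℂ) - 0 - k * T = ((δ * (q - α) - k * T : ℝ) : ℂ) := by
      push_cast; ring
    rw [e, Complex.norm_real, Real.norm_eq_abs] at hk
    calc _ ≤ κ * (2 * E) := hk.trans (by gcongr)
      _ = _ := by ring
  have h4 : |δ * (q - α) - T| ≤ δ := by rw [abs_le]; constructor <;> nlinarith
  have hT : 0 < T := by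
    have : 0 ≤ E := (norm_nonneg _).trans h0
    have : 0 ≤ 2 * κ * E := by positivity
    linarith
  obtain ⟨h5, h6⟩ := abs_le.1 h3
  obtain ⟨h7, h8⟩ := abs_le.1 h4
  have hk1 : (k : ℝ) < 2 := by
    by_contra hcon
    push Not at hcon
    nlinarith
  have hk2 : (0 : ℝ) < k := by
    by_contra hcon
    push Not at hcon
    nlinarith
  have : k = 1 := by
    have h9 : k < (2 : ℤ) := by exact_mod_cast hk1
    have h10 : (0 : ℤ) < k := by exact_mod_cast hk2
    omega
  rw [this, Int.cast_one, one_mul] at h3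
  exact h3

/-- A point of the glued curve close to the orbit point `Φ(δτ)` has a parameter close to `τ`. -/
theorem exists_norm_sub_le (hp : LinearizedPair h N q α β ν s P) (hδ : 0 < δ)
    (hκ : ∀ t ∈ strip σ, ∀ t' ∈ strip σ, ∃ k : ℤ, ‖t' - t - k * T‖ ≤ κ * ‖Φ t' - Φ t‖)
    (hκ0 : 0 ≤ κ) (hσ : δ * s ≤ σ) (hT : 0 < T)
    (hE : ∀ z ∈ strip s, z.re ∈ Ico (0 : ℝ) (q - α) →
      ‖gluedCurve h P (q - α) z - Φ (δ * z)‖ ≤ E)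
    (hLT : |δ * (q - α) - T| ≤ E') {e : ℝ} (hsmall : κ * (E + e) + E' < T) {ξ τ : ℂ}
    (hξ : ξ ∈ strip s) (hτ : τ ∈ strip s) (hτ' : τ.re ∈ Icc (0 : ℝ) (q - α))
    (he : ‖gluedCurve h P (q - α) ξ - Φ (δ * τ)‖ ≤ e) :
    ∃ k : ℤ, δ * ‖ξ - k * ((q - α : ℝ) : ℂ) - τ‖ ≤ κ * (E + e) + E' := by
  have hL := hp.period_pos
  obtain ⟨z, m, j, h1, h3, h2, rfl⟩ := exists_canonical hL ξ
  have hm : (0 : ℝ) ≤ m := Nat.cast_nonneg m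
  set ξ₀ : ℂ := z + m with hξ₀
  have hξre : ξ₀.re ∈ Ico (0 : ℝ) (q - α) :=
    ⟨by simp [hξ₀]; linarith [h1.1], by simpa [hξ₀] using h2⟩
  have hξs : ξ₀ ∈ strip s := by simpa [strip, hξ₀] using hξ
  rw [gluedCurve_add_period hL] at he
  have hmem : ∀ w ∈ strip s, (δ : ℂ) * w ∈ strip σ := by
    intro w hw
    have hw' : |w.im| < s := hw
    have e : ((δ : ℂ) * w).im = δ * w.im := by simp
    rw [strip, mem_ofPred_eq, e, abs_mul, abs_of_pos hδ]
    exact lt_of_lt_of_le (by gcongr) hσ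
  obtain ⟨k, hk⟩ := hκ _ (hmem τ hτ) _ (hmem ξ₀ hξs)
  have h4 : ‖Φ (δ * ξ₀) - Φ (δ * τ)‖ ≤ E + e := by
    calc _ = ‖(gluedCurve h P (q - α) ξ₀ - Φ (δ * τ)) -
          (gluedCurve h P (q - α) ξ₀ - Φ (δ * ξ₀))‖ := by congr 1; abel
      _ ≤ e + E := (norm_sub_le _ _).trans (add_le_add he (hE _ hξs hξre))
      _ = E + e := add_comm _ _
  have h5 : ‖(δ : ℂ) * ξ₀ - δ * τ - k * T‖ ≤ κ * (E + e) := hk.trans (by gcongr)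
  have hE'0 : 0 ≤ E' := (abs_nonneg _).trans hLT
  -- the shift `k` is at most one in absolute value
  have hk1 : |(k : ℝ)| ≤ 1 := by
    have h6 := (Complex.abs_re_le_norm _).trans h5
    have e : ((δ : ℂ) * ξ₀ - δ * τ - k * T).re = δ * (ξ₀.re - τ.re) - k * T := by simp; ring
    rw [e] at h6
    obtain ⟨h7, h8⟩ := abs_le.1 h6
    obtain ⟨h9, h10⟩ := abs_le.1 hLT
    have h11 : δ * (ξ₀.re - τ.re) ≤ δ * (q - α) :=
      mul_le_mul_of_nonneg_left (by linarith [hξre.2, hτ'.1]) hδ.le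
    have h12 : δ * -(q - α) ≤ δ * (ξ₀.re - τ.re) :=
      mul_le_mul_of_nonneg_left (by linarith [hξre.1, hτ'.2]) hδ.le
    rw [mul_neg] at h12
    have hk2 : (k : ℝ) < 2 := by
      by_contra hcon
      push Not at hcon
      nlinarith
    have hk3 : (-2 : ℝ) < k := by
      by_contra hcon
      push Not at hcon
      nlinarith
    have h13 : k < (2 : ℤ) := by exact_mod_cast hk2
    have h14 : (-2 : ℤ) < k := by exact_mod_cast hk3
    have h15 : |k| ≤ 1 := abs_le.2 ⟨by omega, by omega⟩
    exact_mod_cast h15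
  refine ⟨j + k, ?_⟩
  have hshift : (δ : ℂ) * (ξ₀ + j * ((q - α : ℝ) : ℂ) - ((j + k : ℤ) : ℂ) * ((q - α : ℝ) : ℂ) - τ) =
      (δ * ξ₀ - δ * τ - k * T) - ((k * (δ * (q - α) - T) : ℝ) : ℂ) := by
    push_cast; ring
  calc δ * ‖ξ₀ + j * ((q - α : ℝ) : ℂ) - ((j + k : ℤ) : ℂ) * ((q - α : ℝ) : ℂ) - τ‖
      = ‖(δ : ℂ) * (ξ₀ + j * ((q - α : ℝ) : ℂ) - ((j + k : ℤ) : ℂ) * ((q - α : ℝ) : ℂ) - τ)‖ := by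
        rw [norm_mul, Complex.norm_real, Real.norm_of_nonneg hδ.le]
    _ ≤ κ * (E + e) + |k * (δ * (q - α) - T)| := by
        rw [hshift, ← Real.norm_eq_abs, ← Complex.norm_real]
        exact (norm_sub_le _ _).trans (add_le_add_left h5 _)
    _ ≤ κ * (E + e) + E' := by
        rw [abs_mul]
        gcongr
        exact (mul_le_of_le_one_left (abs_nonneg _) hk1).trans hLT

/-- The glued curve is injective modulo its period: two parameters of the same point are close to
each other modulo the period by comparison with the orbit of the vector field, and the forward orbit
carries both into the linearized box, where `P` is injective. -/
theorem gluedCurve_injective (hp : LinearizedPair h N q α β ν s P) (hδ : 0 < δ)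
    (hκ : ∀ t ∈ strip σ, ∀ t' ∈ strip σ, ∃ k : ℤ, ‖t' - t - k * T‖ ≤ κ * ‖Φ t' - Φ t‖)
    (hκ0 : 0 ≤ κ) (hσ : δ * s ≤ σ) (hT : 0 < T)
    (hE : ∀ z ∈ strip s, z.re ∈ Ico (0 : ℝ) (q - α) →
      ‖gluedCurve h P (q - α) z - Φ (δ * z)‖ ≤ E)
    (hLT : |δ * (q - α) - T| ≤ E') (hsmall : κ * (E + E) + E' < T) {r : ℝ} (hr : r ≤ ν)
    (hr' : r < 1) (hsmall' : κ * (E + E) + E' < δ * r) :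
    ∀ z ∈ strip s, ∀ z' ∈ strip s, gluedCurve h P (q - α) z = gluedCurve h P (q - α) z' →
      ∃ k : ℤ, z' = z + k * ((q - α : ℝ) : ℂ) := by
  intro z hz z' hz' heq
  have hL := hp.period_pos
  obtain ⟨z₁, m, j, h1, h3, h2, rfl⟩ := exists_canonical hL z
  have hm : (0 : ℝ) ≤ m := Nat.cast_nonneg m
  set z₀ : ℂ := z₁ + m with hz₀
  have hz₀re : z₀.re ∈ Ico (0 : ℝ) (q - α) :=
    ⟨by simp [hz₀]; linarith [h1.1], by simpa [hz₀] using h2⟩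
  have hz₀s : z₀ ∈ strip s := by simpa [strip, hz₀] using hz
  rw [gluedCurve_add_period hL] at heq
  obtain ⟨k, hk⟩ := hp.exists_norm_sub_le hδ hκ hκ0 hσ hT hE hLT hsmall hz' hz₀s
    ⟨hz₀re.1, hz₀re.2.le⟩ (by rw [← heq]; exact hE _ hz₀s hz₀re)
  have hdist : ‖z' - k * ((q - α : ℝ) : ℂ) - z₀‖ < r :=
    lt_of_mul_lt_mul_left (hk.trans_lt hsmall') hδ.le
  set z₂ : ℂ := z' - k * ((q - α : ℝ) : ℂ) with hz₂
  have hz₂s : z₂ ∈ strip s := by simpa [strip, hz₂] using hz'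
  have heq2 : gluedCurve h P (q - α) z₀ = gluedCurve h P (q - α) z₂ := by
    rw [heq, hz₂, ← gluedCurve_add_period hL (z' - k * ((q - α : ℝ) : ℂ)) k, sub_add_cancel]
  obtain ⟨n, l, hnl⟩ := exists_nat_int_add_sub_mem hL z₀.re
  have hshift : ∀ w ∈ strip s, gluedCurve h P (q - α) (w + n - l * ((q - α : ℝ) : ℂ)) =
      (stepMap h)^[n] (gluedCurve h P (q - α) w) := by
    intro w hw
    rw [← hp.gluedCurve_add_nat hw n, ← gluedCurve_add_period hL (w + n - l * ((q - α : ℝ) : ℂ)) l,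
      sub_add_cancel]
  have heq3 := (hshift z₀ hz₀s).trans ((congrArg _ heq2).trans (hshift z₂ hz₂s).symm)
  set a : ℂ := z₀ + n - l * ((q - α : ℝ) : ℂ) with ha
  set b : ℂ := z₂ + n - l * ((q - α : ℝ) : ℂ) with hb
  have hare : a.re = z₀.re + n - l * (q - α) := by simp [ha]
  have hab : ‖b - a‖ < r := by
    have : b - a = z₂ - z₀ := by rw [ha, hb]; ring
    rwa [this]
  have hbre := abs_lt.1 ((Complex.abs_re_le_norm _).trans_lt hab)
  rw [Complex.sub_re] at hbre
  rw [← hare] at hnl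
  have has : a ∈ strip s := by simpa [strip, ha] using hz₀s
  have hbs : b ∈ strip s := by simpa [strip, hb] using hz₂s
  have hr0 : 0 < r := (norm_nonneg _).trans_lt hab
  have hs0 : ‖(0 : ℂ)‖ < s := by simpa using hp.s_pos
  rw [hp.gluedCurve_eq_P_Ico hnl, hp.gluedCurve_eq_P hr hr' hbs (by linarith [hbre.1, hnl.1])
    (by linarith [hbre.2, hnl.2])] at heq3
  have hmema := hp.mem_of_canonical hnl has hs0
  have hmemb : !₂[b, 0] ∈ modelDomain ν s := mk_mem_modelDomain.2
    ⟨by linarith [hbre.1, hnl.1], by linarith [hbre.2, hnl.2], hbs, hs0⟩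
  have hab' : (!₂[a, 0] : C2) = !₂[b, 0] :=
    hp.conj.inj (Or.inl (Or.inl hmema)) (Or.inl (Or.inl hmemb)) heq3
  have hab'' : a = b := congrArg (fun u : C2 => u 0) hab'
  refine ⟨k - j, ?_⟩
  have h4 : z₀ = z₂ := by
    rw [ha, hb] at hab''
    linear_combination hab''
  rw [hz₂] at h4
  rw [Int.cast_sub]
  linear_combination -h4

end LinearizedPair

/-! ### The box around the periodic orbit -/

/-- `ψ` is a Lipschitz local inverse of `f` at `a`. -/
structure LipschitzLocalInverse (f ψ : ℂ → ℂ) (a : ℂ) (r B : ℝ) : Prop where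
  r_pos : 0 < r
  B_pos : 0 < B
  norm_sub_le : ∀ w ∈ Metric.ball (f a) r, ∀ w' ∈ Metric.ball (f a) r,
    ‖ψ w - ψ w'‖ ≤ B * ‖w - w'‖
  right_inv : ∀ w ∈ Metric.ball (f a) r, f (ψ w) = w
  left_inv : ∀ z ∈ Metric.ball a r, ψ (f z) = z

theorem exists_lipschitzLocalInverse {f : ℂ → ℂ} {f' a : ℂ} (hf : HasStrictDerivAt f f' a)
    (hf' : f' ≠ 0) : ∃ ψ r B, LipschitzLocalInverse f ψ a r B := by
  set ψ := hf.localInverse f f' a hf' with hψ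
  have h1 : ∀ᶠ w in 𝓝 (f a), f (ψ w) = w :=
    (hf.hasStrictFDerivAt_equiv hf').eventually_right_inverse
  have h2 : ∀ᶠ z in 𝓝 a, ψ (f z) = z :=
    (hf.hasStrictFDerivAt_equiv hf').eventually_left_inverse
  obtain ⟨K, S, hS, hK⟩ :=
    HasStrictFDerivAt.exists_lipschitzOnWith (hf.to_localInverse hf').hasStrictFDerivAt
  obtain ⟨r, hr, hrS⟩ := Metric.mem_nhds_iff.1 (inter_mem hS h1)
  obtain ⟨r', hr', hrS'⟩ := Metric.mem_nhds_iff.1 h2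
  have hl : Metric.ball (f a) (min r r') ⊆ Metric.ball (f a) r :=
    Metric.ball_subset_ball (min_le_left _ _)
  refine ⟨ψ, min r r', K + 1, lt_min hr hr', by positivity, fun w hw w' hw' => ?_,
    fun w hw => (hrS (hl hw)).2,
    fun z hz => hrS' (Metric.ball_subset_ball (min_le_right _ _) hz)⟩
  have := hK.dist_le_mul w (hrS (hl hw)).1 w' (hrS (hl hw')).1
  rw [dist_eq_norm, dist_eq_norm] at this
  exact this.trans (by gcongr; linarith)

/-- The equations `x + t η(x) = b(t)` have solutions depending continuously on `t`. -/
theorem exists_continuousOn_solution {η : C2 → C2} {c : C2} {R k ε D τ : ℝ}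
    (hε : 0 ≤ ε)
    (hlip : ∀ x ∈ Metric.ball c R, ∀ x' ∈ Metric.ball c R, ‖η x - η x'‖ ≤ k * ‖x - x'‖)
    (hη : ∀ x ∈ Metric.ball c R, ‖η x‖ ≤ ε) (hkτ : τ * k ≤ 1 / 2) {b : ℝ → C2}
    (hb : ∀ t ∈ Icc (-τ) τ, ‖b t - c‖ + τ * ε < R)
    (hbD : ∀ t ∈ Icc (-τ) τ, ∀ t' ∈ Icc (-τ) τ, ‖b t - b t'‖ ≤ D * |t - t'|) :
    ∃ x : ℝ → C2, ContinuousOn x (Icc (-τ) τ) ∧ ∀ t ∈ Icc (-τ) τ, x t ∈ Metric.ball c R ∧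
      x t + t • η (x t) = b t ∧ ‖x t - b t‖ ≤ τ * ε := by
  have habs : ∀ t ∈ Icc (-τ) τ, |t| ≤ τ := fun t ht => abs_le.2 ht
  have hex : ∀ t ∈ Icc (-τ) τ, ∃ x, x ∈ Metric.ball c R ∧ x + t • η x = b t ∧
      ‖x - b t‖ ≤ τ * ε := by
    intro t ht
    have hτ : 0 ≤ τ := (abs_nonneg t).trans (habs t ht)
    have hsub : Metric.closedBall (b t) (τ * ε) ⊆ Metric.ball c R := by
      intro x hx
      rw [mem_closedBall_iff_norm] at hx
      rw [mem_ball_iff_norm]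
      calc ‖x - c‖ = ‖(x - b t) + (b t - c)‖ := by congr 1; abel
        _ ≤ ‖x - b t‖ + ‖b t - c‖ := norm_add_le _ _
        _ < R := by linarith [hb t ht]
    have hmaps : MapsTo (fun x => b t - t • η x) (Metric.closedBall (b t) (τ * ε))
        (Metric.closedBall (b t) (τ * ε)) := by
      intro x hx
      rw [mem_closedBall_iff_norm, sub_sub_cancel_left, norm_neg, norm_smul, Real.norm_eq_abs]
      exact mul_le_mul (habs t ht) (hη x (hsub hx)) (norm_nonneg _) hτ
    have hcontr : ContractingWith (1 / 2) (MapsTo.restrict _ _ _ hmaps) := by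
      refine ⟨by rw [← NNReal.coe_lt_coe]; norm_num, LipschitzWith.of_dist_le_mul fun x y => ?_⟩
      rw [Subtype.dist_eq, Subtype.dist_eq, dist_eq_norm, dist_eq_norm]
      have e : (MapsTo.restrict _ _ _ hmaps x : C2) - MapsTo.restrict _ _ _ hmaps y =
          t • (η y - η x) := by
        simp only [MapsTo.val_restrict_apply, smul_sub]; abel
      rw [e, norm_smul, Real.norm_eq_abs]
      calc |t| * ‖η y - η x‖ ≤ τ * (k * ‖(x : C2) - y‖) := by
            rw [norm_sub_rev (x : C2)]
            exact mul_le_mul (habs t ht) (hlip _ (hsub y.2) _ (hsub x.2)) (norm_nonneg _) hτ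
        _ = τ * k * ‖(x : C2) - y‖ := by ring
        _ ≤ 1 / 2 * ‖(x : C2) - y‖ := by gcongr
        _ = _ := by norm_num
    obtain ⟨x, hx, hfix, -⟩ := hcontr.exists_fixedPoint' Metric.isClosed_closedBall.isComplete
      hmaps (x := b t) (Metric.mem_closedBall_self (by positivity)) (edist_ne_top _ _)
    refine ⟨x, hsub hx, ?_, mem_closedBall_iff_norm.1 hx⟩
    have : b t - t • η x = x := hfix
    rw [← this]
    nth_rw 2 [this]
    abel
  choose! x hx using hex
  refine ⟨x, ?_, hx⟩
  have hl : ∀ t ∈ Icc (-τ) τ, ∀ t' ∈ Icc (-τ) τ, ‖x t - x t'‖ ≤ 2 * (D + ε) * |t - t'| := by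
    intro t ht t' ht'
    have hτ : 0 ≤ τ := (abs_nonneg t).trans (habs t ht)
    have e : x t - x t' = (b t - b t') - (t - t') • η (x t) - t' • (η (x t) - η (x t')) := by
      rw [← (hx t ht).2.1, ← (hx t' ht').2.1, smul_sub, sub_smul]; abel
    have h1 : ‖(t - t') • η (x t)‖ ≤ |t - t'| * ε := by
      rw [norm_smul, Real.norm_eq_abs]; gcongr; exact hη _ (hx t ht).1
    have h2 : ‖t' • (η (x t) - η (x t'))‖ ≤ 1 / 2 * ‖x t - x t'‖ := by
      rw [norm_smul, Real.norm_eq_abs]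
      calc _ ≤ τ * (k * ‖x t - x t'‖) := mul_le_mul (habs t' ht')
            (hlip _ (hx t ht).1 _ (hx t' ht').1) (norm_nonneg _) hτ
        _ = τ * k * ‖x t - x t'‖ := by ring
        _ ≤ _ := by gcongr
    have h3 : ‖x t - x t'‖ ≤ D * |t - t'| + |t - t'| * ε + 1 / 2 * ‖x t - x t'‖ := by
      nth_rw 1 [e]
      refine (norm_sub_le _ _).trans (add_le_add ((norm_sub_le _ _).trans ?_) h2)
      exact add_le_add (hbD t ht t' ht') h1
    linarith
  refine (LipschitzOnWith.of_dist_le' (K := 2 * (D + ε)) fun t ht t' ht' => ?_).continuousOn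
  rw [dist_eq_norm, dist_eq_norm, Real.norm_eq_abs]
  exact hl t ht t' ht'

/-- A point close to the orbit segment `Φ([0, δ])` lies in the box: its backward orbit under the
isotopy crosses the transversal, by the intermediate value theorem. -/
theorem mem_box_of_norm_sub_le {V : Set C2} {X η : C2 → C2} {Φ : ℂ → C2} {s ρ M δ ε : ℝ}
    {Λ : NNReal} (hη : StepBounds V η ρ M δ ε) (hT : TubeBounds V X Φ s ρ M Λ) {ψ : ℂ → ℂ}
    {r B : ℝ} (hψ : LipschitzLocalInverse (fun t => Φ t 0) ψ 0 r B) (hδ : 0 < δ) {τ : ℝ}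
    (hτ : τ ∈ Icc (0 : ℝ) 1) {y : C2} {e e₁ S ν : ℝ} (hy : ‖y - Φ ((τ * δ : ℝ) : ℂ)‖ ≤ e)
    (he₁ : e * Real.exp (2 * δ * Λ) + 2 * ε ≤ e₁) (hν : ν ≤ 1)
    (hρ : e + 3 * (δ * M) + 2 * ε < ρ) (hερ : 4 * ε ≤ ρ) (hr : e₁ + 3 * (δ * M) < r)
    (hr' : 3 * δ < r) (hν' : B * e₁ < δ * (ν / 2)) (hs : B * e₁ < s)
    (hS : (1 + B + M * B) * e₁ < δ * S) : y ∈ box V X η Φ δ S ν := by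
  have hM := hT.M_nonneg
  have hε := hη.eps_nonneg hT
  have hρ0 := hT.rho_pos
  have hB := hψ.B_pos
  have he : 0 ≤ e := (norm_nonneg _).trans hy
  have he₁0 : 0 ≤ e₁ := le_trans (by positivity) he₁
  have hν0 : 0 < ν := by
    have : 0 ≤ B * e₁ := by positivity
    by_contra h
    push Not at h
    nlinarith
  obtain ⟨hτ0, hτ1⟩ := hτ
  have h0 : (0 : ℂ) ∈ strip s := by simpa [strip] using hT.s_pos
  have hreal : ∀ x : ℝ, (x : ℂ) ∈ strip s := fun x => by simpa [strip] using hT.s_pos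
  have hreal_norm : ∀ x : ℝ, ‖Φ x - Φ 0‖ ≤ M * |x| := fun x => by
    simpa using hT.norm_sub_le h0 (hreal x)
  have hδM : 0 ≤ δ * M := by positivity
  -- the integral curve through `y`
  have hyc : ‖y - Φ 0‖ ≤ e + δ * M := by
    have h1 := hreal_norm (τ * δ)
    rw [abs_of_nonneg (by positivity)] at h1
    calc ‖y - Φ 0‖ = ‖(y - Φ ((τ * δ : ℝ) : ℂ)) + (Φ ((τ * δ : ℝ) : ℂ) - Φ 0)‖ := by
          congr 1; abel
      _ ≤ e + M * (τ * δ) := (norm_add_le _ _).trans (add_le_add hy h1)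
      _ ≤ _ := by nlinarith
  have hsub : Metric.closedBall y (2 * (δ * M)) ⊆ Metric.ball (Φ 0) ρ := by
    intro z hz
    rw [mem_closedBall_iff_norm] at hz
    rw [mem_ball_iff_norm]
    calc ‖z - Φ 0‖ = ‖(z - y) + (y - Φ 0)‖ := by congr 1; abel
      _ ≤ _ := norm_add_le _ _
      _ < ρ := by linarith
  have hball2 : Metric.ball (Φ 0) ρ ⊆ Metric.ball (Φ 0) (2 * ρ) :=
    Metric.ball_subset_ball (by linarith)
  obtain ⟨β, hβ0, hβ⟩ := exists_integralCurve (X := X) (τ := 2 * δ) (by positivity) hM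
    (by positivity) ((hT.lipschitz 0 h0).mono (hsub.trans hball2))
    (fun z hz => hT.norm_le z (hT.ball_subset_two h0 (hball2 (hsub hz))))
    (show M * (2 * δ) ≤ 2 * (δ * M) by linarith)
  have hβnorm : ∀ u ∈ Icc (-(2 * δ)) (2 * δ), ‖β u - Φ 0‖ ≤ e + 3 * (δ * M) := by
    intro u hu
    have := mem_closedBall_iff_norm.1 (hβ u hu).1
    calc ‖β u - Φ 0‖ = ‖(β u - y) + (y - Φ 0)‖ := by congr 1; abel
      _ ≤ _ := norm_add_le _ _
      _ ≤ _ := by linarith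
  have htime : ∀ t ∈ Icc (-2 : ℝ) 2, -t * δ ∈ Icc (-(2 * δ)) (2 * δ) := by
    rintro t ⟨h1, h2⟩
    constructor <;> nlinarith
  have hscale : ∀ t ∈ Icc (-2 : ℝ) 2, ∀ u ∈ Icc (0 : ℝ) 1, u * t ∈ Icc (-2 : ℝ) 2 := by
    intro t ht u hu
    rw [mem_Icc, ← abs_le, abs_mul, abs_of_nonneg hu.1]
    exact (mul_le_of_le_one_left (abs_nonneg _) hu.2).trans (abs_le.2 ht)
  -- comparison with the orbit
  have hcomp : ∀ t ∈ Icc (-2 : ℝ) 2,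
      ‖β (-t * δ) - Φ (((τ - t) * δ : ℝ) : ℂ)‖ ≤ e * Real.exp (2 * δ * Λ) := by
    intro t ht
    have htabs : |t| ≤ 2 := abs_le.2 ht
    have := norm_sub_le_of_approx_solution (κ := ((-t * δ : ℝ) : ℂ)) (ε := 0)
      (γ₁ := fun u => β (-(u * t) * δ)) (γ₂ := fun u => Φ (((τ - u * t) * δ : ℝ) : ℂ))
      (d := fun u => (-t * δ) • X (β (-(u * t) * δ)))
      (hT.lipschitz 0 h0) le_rfl (fun u hu => ⟨?_, ?_, ?_⟩) (fun u hu => ⟨?_, ?_⟩)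
      (right_mem_Icc.2 zero_le_one)
    · simp only [one_mul, zero_mul, neg_zero, sub_zero, hβ0, add_zero] at this
      refine this.trans ?_
      rw [Complex.norm_real, Real.norm_eq_abs, abs_mul, abs_neg, abs_of_pos hδ]
      gcongr
    · refine hball2 (hsub (hβ _ (htime _ (hscale t ht u hu))).1)
    · have h1 : HasDerivWithinAt (fun u : ℝ => -(u * t) * δ) (-t * δ) (Icc 0 1) u := by
        have := (((hasDerivAt_id u).mul_const t).neg.mul_const δ).hasDerivWithinAt (s := Icc 0 1)
        simpa using! this
      exact (hβ _ (htime _ (hscale t ht u hu))).2.scomp u h1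
        (fun w hw => htime _ (hscale t ht w hw))
    · rw [Complex.coe_smul]; simp
    · rw [mem_ball_iff_norm]
      have h1 := hreal_norm ((τ - u * t) * δ)
      have h2 : |(τ - u * t) * δ| ≤ 3 * δ := by
        rw [abs_mul, abs_of_pos hδ]
        have := hscale t ht u hu
        gcongr
        exact abs_le.2 ⟨by linarith [this.2], by linarith [this.1]⟩
      have h3 : M * |(τ - u * t) * δ| ≤ M * (3 * δ) := by gcongr
      linarith
    · have h1 : HasDerivAt (fun u : ℝ => (((τ - u * t) * δ : ℝ) : ℂ)) ((-t * δ : ℝ) : ℂ) u := by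
        have := ((((hasDerivAt_id u).mul_const t).const_sub τ).mul_const δ).ofReal_comp
        simpa using! this
      exact (HasDerivAt.scomp (h := fun u : ℝ => (((τ - u * t) * δ : ℝ) : ℂ)) u
        (hT.deriv _ (hreal _)) h1).hasDerivWithinAt
  -- the backward orbit under the isotopy
  have hballV : Metric.ball (Φ 0) (2 * ρ) ⊆ V := hT.ball_subset_two h0
  have h4 : (2 : ℝ) * (2 * ρ) = 4 * ρ := by ring
  obtain ⟨x, hxc, hx⟩ := exists_continuousOn_solution (η := η) (c := Φ 0) (R := 2 * ρ)
    (k := ε / ρ) (ε := ε) (D := δ * M) (τ := 2) (b := fun t => β (-t * δ)) hε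
    (fun x hx x' hx' => by
      have := norm_sub_le_of_differentiableOn_ball (r := 2 * ρ) (B := ε) (by linarith)
        (hη.holo.mono (h4 ▸ hT.ball_subset 0 h0))
        (fun x hx => hη.norm_le x (hT.ball_subset 0 h0 (h4 ▸ hx))) hx hx'
      refine this.trans (le_of_eq ?_)
      field_simp)
    (fun x hx => hη.norm_le x (hballV hx))
    (by rw [← mul_div_assoc, div_le_iff₀ hρ0]; linarith)
    (fun t ht => by linarith [hβnorm _ (htime t ht)])
    (fun t ht t' ht' => by
      have := (convex_Icc (-(2 * δ)) (2 * δ)).norm_image_sub_le_of_norm_hasDerivWithin_le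
        (f := β) (C := M) (fun z hz => (hβ z hz).2)
        (fun z hz => hT.norm_le _ (hballV (hball2 (hsub (hβ z hz).1)))) (htime t' ht')
        (htime t ht)
      refine this.trans (le_of_eq ?_)
      rw [← sub_mul, norm_mul, Real.norm_eq_abs, Real.norm_eq_abs, abs_of_pos hδ,
        show -t - -t' = -(t - t') by ring, abs_neg]
      ring)
  have hxΦ : ∀ t ∈ Icc (-2 : ℝ) 2, ‖x t - Φ (((τ - t) * δ : ℝ) : ℂ)‖ ≤ e₁ := by
    intro t ht
    calc _ = ‖(x t - β (-t * δ)) + (β (-t * δ) - Φ (((τ - t) * δ : ℝ) : ℂ))‖ := by congr 1; abel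
      _ ≤ 2 * ε + e * Real.exp (2 * δ * Λ) :=
        (norm_add_le _ _).trans (add_le_add (hx t ht).2.2 (hcomp t ht))
      _ ≤ e₁ := by linarith
  have htabs : ∀ t ∈ Icc (-2 : ℝ) 2, |(τ - t) * δ| ≤ 3 * δ := by
    intro t ht
    rw [abs_mul, abs_of_pos hδ]
    gcongr
    exact abs_le.2 ⟨by linarith [ht.2], by linarith [ht.1]⟩
  have hcoord : ∀ v w : C2, ‖v 0 - w 0‖ ≤ ‖v - w‖ := fun v w => PiLp.norm_apply_le (v - w) 0
  have hmemΦ : ∀ t ∈ Icc (-2 : ℝ) 2, Φ (((τ - t) * δ : ℝ) : ℂ) 0 ∈ Metric.ball (Φ 0 0) r := by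
    intro t ht
    rw [mem_ball_iff_norm]
    have h1 := (hcoord _ _).trans (hreal_norm ((τ - t) * δ))
    have h2 : M * |(τ - t) * δ| ≤ M * (3 * δ) := by gcongr; exact htabs t ht
    linarith
  have hmemx : ∀ t ∈ Icc (-2 : ℝ) 2, x t 0 ∈ Metric.ball (Φ 0 0) r := by
    intro t ht
    rw [mem_ball_iff_norm]
    have h1 := hreal_norm ((τ - t) * δ)
    have h2 : M * |(τ - t) * δ| ≤ M * (3 * δ) := by gcongr; exact htabs t ht
    have h3 : ‖x t - Φ 0‖ ≤ e₁ + 3 * (δ * M) := by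
      calc _ = ‖(x t - Φ (((τ - t) * δ : ℝ) : ℂ)) + (Φ (((τ - t) * δ : ℝ) : ℂ) - Φ 0)‖ := by
            congr 1; abel
        _ ≤ e₁ + M * |(τ - t) * δ| := (norm_add_le _ _).trans (add_le_add (hxΦ t ht) h1)
        _ ≤ _ := by linarith
    exact ((hcoord _ _).trans h3).trans_lt hr
  have hψx : ∀ t ∈ Icc (-2 : ℝ) 2, ‖ψ (x t 0) - (((τ - t) * δ : ℝ) : ℂ)‖ ≤ B * e₁ := by
    intro t ht
    have h1 : ψ (Φ (((τ - t) * δ : ℝ) : ℂ) 0) = (((τ - t) * δ : ℝ) : ℂ) := by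
      refine hψ.left_inv _ ?_
      rw [mem_ball_iff_norm, sub_zero, Complex.norm_real]
      exact (htabs t ht).trans_lt hr'
    rw [← h1]
    refine (hψ.norm_sub_le _ (hmemx t ht) _ (hmemΦ t ht)).trans ?_
    gcongr
    exact (hcoord _ _).trans (hxΦ t ht)
  -- the crossing time
  have hI : Icc (τ - ν / 2) (τ + ν / 2) ⊆ Icc (-2 : ℝ) 2 :=
    Icc_subset_Icc (by linarith) (by linarith)
  have hcont : ContinuousOn (fun t => (ψ (x t 0)).re) (Icc (τ - ν / 2) (τ + ν / 2)) := by
    have hψc : ContinuousOn ψ (Metric.ball (Φ 0 0) r) := by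
      refine (LipschitzOnWith.of_dist_le' (K := B) fun w hw w' hw' => ?_).continuousOn
      rw [dist_eq_norm, dist_eq_norm]
      exact hψ.norm_sub_le w hw w' hw'
    have h1 : ContinuousOn (fun t => x t 0) (Icc (τ - ν / 2) (τ + ν / 2)) :=
      (EuclideanSpace.proj (0 : Fin 2) : C2 →L[ℂ] ℂ).continuous.comp_continuousOn (hxc.mono hI)
    exact Complex.continuous_re.comp_continuousOn (hψc.comp h1 fun t ht => hmemx t (hI ht))
  have hre : ∀ t ∈ Icc (-2 : ℝ) 2, |(ψ (x t 0)).re - (τ - t) * δ| ≤ B * e₁ := by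
    intro t ht
    have := (Complex.abs_re_le_norm _).trans (hψx t ht)
    rwa [Complex.sub_re, Complex.ofReal_re] at this
  have hle : τ - ν / 2 ≤ τ + ν / 2 := by linarith
  obtain ⟨t, ht, hroot⟩ := intermediate_value_Icc' hle hcont (show (0 : ℝ) ∈ Icc _ _ by
    have h1 := abs_le.1 (hre _ (hI ⟨le_rfl, hle⟩))
    have h2 := abs_le.1 (hre _ (hI ⟨hle, le_rfl⟩))
    constructor
    · nlinarith [h2.2]
    · nlinarith [h1.1])
  have ht2 := hI ht
  set σ : ℝ := (ψ (x t 0)).im with hσ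
  have hroot' : ψ (x t 0) = σ * Complex.I := by
    apply Complex.ext <;> simp [hσ]
    exact hroot
  have hσle : |σ| ≤ B * e₁ := by
    have := (Complex.abs_im_le_norm _).trans (hψx t ht2)
    rwa [Complex.sub_im, Complex.ofReal_im, sub_zero] at this
  have hσs : (σ : ℂ) * Complex.I ∈ strip s := by
    simpa [strip] using hσle.trans_lt hs
  have hdist : ‖x t - Φ (σ * Complex.I)‖ ≤ e₁ + M * (B * e₁) := by
    have h1 := hT.norm_sub_le hσs (hreal ((τ - t) * δ))
    have h2 := hψx t ht2
    rw [hroot', norm_sub_rev] at h2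
    calc _ = ‖(x t - Φ (((τ - t) * δ : ℝ) : ℂ)) +
          (Φ (((τ - t) * δ : ℝ) : ℂ) - Φ (σ * Complex.I))‖ := by congr 1; abel
      _ ≤ e₁ + M * (B * e₁) :=
        (norm_add_le _ _).trans (add_le_add (hxΦ t ht2) (h1.trans (by gcongr)))
  have hBe : 0 ≤ B * e₁ := by positivity
  have hMBe : 0 ≤ M * (B * e₁) := by positivity
  refine ⟨t, ⟨by linarith [ht.1], by linarith [ht.2]⟩, x t,
    ⟨σ, x t 1 - Φ (σ * Complex.I) 1, by nlinarith, ?_, ?_⟩, hballV (hx t ht2).1, ?_⟩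
  · have := (PiLp.norm_apply_le (x t - Φ (σ * Complex.I)) 1).trans hdist
    exact lt_of_le_of_lt this (by nlinarith)
  · have h5 : Φ (σ * Complex.I) 0 = x t 0 := by
      rw [← hroot']; exact hψ.right_inv _ (hmemx t ht2)
    ext i
    fin_cases i
    · simp [h5]
    · simp
  · rw [(hx t ht2).2.1]
    have hmaps : ∀ u ∈ Icc (0 : ℝ) 1, -((1 - u) * t) * δ ∈ Icc (-(2 * δ)) (2 * δ) := fun u hu =>
      htime _ (hscale t ht2 (1 - u) ⟨by linarith [hu.2], by linarith [hu.1]⟩)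
    refine ⟨fun u => β (-((1 - u) * t) * δ), by simp, by simpa using hβ0, fun u hu =>
      ⟨hballV (hball2 (hsub (hβ _ (hmaps u hu)).1)), ?_⟩⟩
    have h1 : HasDerivWithinAt (fun u : ℝ => -((1 - u) * t) * δ) (t * δ) (Icc 0 1) u := by
      have := ((((hasDerivAt_id u).const_sub 1).mul_const t).neg.mul_const δ).hasDerivWithinAt
        (s := Icc 0 1)
      simpa using! this
    exact (hβ _ (hmaps u hu)).2.scomp u h1 hmaps

/-! ### Isolation -/

/-- Dirichlet's theorem: the multiples of a real number return close to the integers. -/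
theorem frequently_abs_mul_sub_int_lt (x : ℝ) {r : ℝ} (hr : 0 < r) :
    ∃ᶠ n : ℕ in atTop, ∃ k : ℤ, |n * x - k| < r := by
  rw [frequently_atTop]
  intro N
  obtain ⟨n, hn⟩ := exists_nat_one_div_lt hr
  obtain ⟨k, hk0, -, hk⟩ := Real.exists_nat_abs_mul_sub_round_le ((N + 1 : ℕ) * x) n.succ_pos
  refine ⟨k * (N + 1), by nlinarith, round (k * ((N + 1 : ℕ) * x)), ?_⟩
  have h1 : (1 : ℝ) / ((n.succ : ℕ) + 1) ≤ 1 / (n + 1) := by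
    push_cast
    gcongr
    linarith
  have h2 : ((k * (N + 1) : ℕ) : ℝ) * x = k * ((N + 1 : ℕ) * x) := by push_cast; ring
  rw [h2]
  exact hk.trans_lt (h1.trans_lt hn)

/-- For irrational `L` the positive integers are dense modulo `L`. -/
theorem exists_nat_int_abs_sub_lt {L : ℝ} (hL : Irrational L) (x : ℝ) {r : ℝ} (hr : 0 < r) :
    ∃ (n : ℕ) (k : ℤ), |x - n - k * L| < r := by
  have hL0 : L ≠ 0 := hL.ne_zero
  have hd : Dense (AddSubgroup.closure {L, 1} : Set ℝ) :=
    dense_addSubgroupClosure_pair_iff.2 (by simpa using hL)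
  obtain ⟨y, hy, hyx⟩ := Metric.dense_iff.1 hd x (r / 2) (by positivity)
  obtain ⟨k, m, rfl⟩ := AddSubgroup.mem_closure_pair.1 hyx
  obtain ⟨n, hn, j, hj⟩ := frequently_atTop.1
    (frequently_abs_mul_sub_int_lt L⁻¹ (r := r / (2 * |L|)) (by positivity)) m.natAbs
  have h1 : |(n : ℝ) - j * L| < r / 2 := by
    have e : (n : ℝ) - j * L = (n * L⁻¹ - j) * L := by field_simp
    rw [e, abs_mul]
    calc _ < r / (2 * |L|) * |L| := by gcongr
      _ = r / 2 := by field_simp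
  have hmn : 0 ≤ m + n := by omega
  refine ⟨(m + n).toNat, k - j, ?_⟩
  have h2 : (((m + n).toNat : ℕ) : ℝ) = m + n := by
    have : (((m + n).toNat : ℕ) : ℤ) = m + n := Int.toNat_of_nonneg hmn
    exact_mod_cast this
  rw [h2]
  rw [Metric.mem_ball, dist_comm, Real.dist_eq] at hy
  simp only [zsmul_eq_mul, mul_one] at hy
  have e : x - (m + n) - ((k - j : ℤ) : ℝ) * L = (x - (k * L + m)) - (n - j * L) := by
    push_cast; ring
  rw [e]
  calc _ ≤ _ := abs_sub _ _
    _ < r := by linarith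

theorem irrational_of_nonResonant {α : ℝ} {β : ℂ} (h : NonResonant α β) : Irrational α := by
  rintro ⟨x, rfl⟩
  have := h x.den 1 x.num (by
    have : (x.den : ℚ) * x = x.num := Rat.den_mul_eq_num x
    have h' : ((x.den : ℚ) : ℂ) * (x : ℂ) = ((x.num : ℚ) : ℂ) := by exact_mod_cast this
    push_cast at h' ⊢
    rw [h']; ring)
  exact x.den_ne_zero (by exact_mod_cast this.1)

namespace LinearizedPair

variable {h : C2 → C2 → Prop} {N : Set C2} {q : ℕ} {α : ℝ} {β : ℂ} {ν s : ℝ} {P : C2 → C2}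

/-- A point of the linearized box that recurs under rotation lies on the glued curve, since its
orbit is both recurrent and attracted to a compact part of that curve. -/
theorem exists_eq_gluedCurve (hp : LinearizedPair h N q α β ν s P) {F : ℂ → C2} {s₁ α₁ : ℝ}
    (hF : ContinuousOn F (strip s₁)) (hper : ∀ θ ∈ strip s₁, ∀ k : ℤ, F (θ + k) = F θ)
    (hrot : ∀ θ ∈ strip s₁, h (F θ) (F (θ + α₁))) {θ : ℂ} (hθ : θ ∈ strip s₁)
    (hbox : F θ ∈ P '' modelDomain ν s) :
    ∃ ξ ∈ strip s, F θ = gluedCurve h P (q - α) ξ := by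
  obtain ⟨u, hu, hPu⟩ := hbox
  rw [← eta_C2 u] at hu hPu
  have hatt := hp.attractedTo_P hu
  rw [hPu] at hatt
  obtain ⟨-, -, hui, -⟩ := mk_mem_modelDomain.1 hu
  set Γ := gluedCurve h P (q - α) '' {ξ | ξ.im = (u 0).im} with hΓ
  have hΓne : Γ.Nonempty := ⟨_, mem_image_of_mem _ rfl⟩
  have hΓc : IsClosed Γ := by
    have e : {ξ : ℂ | ξ.im = (u 0).im} = {ξ | ξ.im ∈ Icc (u 0).im (u 0).im} := by
      ext; simp
    rw [hΓ, e]
    exact (hp.isCompact_gluedCurve_image (abs_lt.1 hui).1 (abs_lt.1 hui).2).isClosed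
  have hmem : ∀ n : ℕ, θ + n * α₁ ∈ strip s₁ := fun n => by
    simpa using add_real_mem_strip hθ (n * α₁)
  have horb : ∀ n : ℕ, F (θ + n * α₁) = (stepMap h)^[n] (F θ) := by
    intro n
    induction n with
    | zero => simp
    | succ n ih =>
      have h1 := (hp.rel_iff _ (by rw [ih]; exact hatt.1 n) _).1 (hrot _ (hmem n))
      rw [Function.iterate_succ_apply', ← ih, ← h1]
      congr 1
      push_cast; ring
  have hzero : Metric.infDist (F θ) Γ ≤ 0 := by
    refine le_of_forall_pos_lt_add fun ε hε => ?_
    have hcont : ContinuousAt F θ := hF.continuousAt ((isOpen_strip s₁).mem_nhds hθ)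
    obtain ⟨r, hr, hr'⟩ := Metric.continuousAt_iff.1 hcont (ε / 2) (by positivity)
    obtain ⟨n, ⟨k, hk⟩, hn⟩ := ((frequently_abs_mul_sub_int_lt α₁ hr).and_eventually
      (hatt.2.eventually_lt_const (show (0 : ℝ) < ε / 2 by positivity))).exists
    have h1 := hper _ (hmem n) (-k)
    have h2 : dist (F (θ + n * α₁ + (-k : ℤ))) (F θ) < ε / 2 := by
      refine hr' ?_
      have e : θ + n * α₁ + (-k : ℤ) - θ = ((n * α₁ - k : ℝ) : ℂ) := by push_cast; ring
      rw [dist_eq_norm, e, Complex.norm_real]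
      exact hk
    rw [h1, horb] at h2
    have := Metric.infDist_le_infDist_add_dist (s := Γ) (x := F θ) (y := (stepMap h)^[n] (F θ))
    rw [dist_comm] at this
    linarith
  have hin : F θ ∈ Γ :=
    (hΓc.mem_iff_infDist_zero hΓne).2 (le_antisymm hzero Metric.infDist_nonneg)
  obtain ⟨ξ, hξ, hξF⟩ := hin
  have hξ' : ξ.im = (u 0).im := hξ
  exact ⟨ξ, by rwa [strip, mem_ofPred_eq, hξ'], hξF.symm⟩

/-- A rotation annulus with a point deep in the linearized box shares a rotation annulus with the
glued curve: both contain a common disc, whose forward orbit fills an annulus because the rotation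
is irrational. -/
theorem exists_common_annulus (hp : LinearizedPair h N q α β ν s P)
    (hP : ∀ u ∈ modelDomain ν s, fderiv ℂ P u (EuclideanSpace.single 0 1) ≠ 0)
    (hinj : ∀ z ∈ strip s, ∀ z' ∈ strip s,
      gluedCurve h P (q - α) z = gluedCurve h P (q - α) z' →
        ∃ k : ℤ, z' = z + k * ((q - α : ℝ) : ℂ)) (hα : Irrational α)
    {σ : ℝ} (hσ : σ ≤ s) {D : Set ℂ} (hD : IsOpen D) (hDσ : D ⊆ strip σ)
    (hDinj : InjOn (fun z => gluedCurve h P (q - α) z 0) D) {A : Set C2} {α₁ : ℝ}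
    (hA : IsRotationAnnulus h α₁ A) {x : C2} (hx : x ∈ A)
    (hloc : ∀ᶠ y in 𝓝 x, y ∈ P '' modelDomain ν s ∧
      ∀ ξ ∈ strip s, y = gluedCurve h P (q - α) ξ → ∃ ξ' ∈ D, y = gluedCurve h P (q - α) ξ') :
    ∃ (B : Set C2) (α₂ : ℝ), B ⊆ gluedCurve h P (q - α) '' strip σ ∩ A ∧ B.Nonempty ∧
      IsRotationAnnulus h α₂ B := by
  obtain ⟨s₁, hs₁, F, hFd, hF', hFper, -, rfl, hrot⟩ := hA
  obtain ⟨θ₀, hθ₀, rfl⟩ := hx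
  set L : ℝ := q - α with hL
  have hL0 : 0 < L := hp.period_pos
  set f := gluedCurve h P L with hf
  have hper : ∀ θ ∈ strip s₁, ∀ k : ℤ, F (θ + k) = F θ := by
    intro θ hθ k
    refine ((hFper θ hθ _ ?_).2 ⟨k, rfl⟩).symm
    simpa using add_real_mem_strip hθ k
  have hDs : D ⊆ strip s := fun z hz => lt_of_lt_of_le (hDσ hz) hσ
  have hfd : ∀ z ∈ strip s, DifferentiableAt ℂ f z := fun z hz =>
    hp.differentiableOn_gluedCurve.differentiableAt ((isOpen_strip s).mem_nhds hz)
  have hFd' : ∀ z ∈ strip s₁, DifferentiableAt ℂ F z := fun z hz =>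
    hFd.differentiableAt ((isOpen_strip s₁).mem_nhds hz)
  have hS : {θ | θ ∈ strip s₁ ∧ ∃ ξ ∈ D, F θ = f ξ} ∈ 𝓝 θ₀ := by
    filter_upwards [(isOpen_strip s₁).mem_nhds hθ₀,
      (hFd' θ₀ hθ₀).continuousAt.eventually hloc] with θ hθ h1
    obtain ⟨ξ, hξ, hξF⟩ := hp.exists_eq_gluedCurve hFd.continuousOn hper hrot hθ h1.1
    exact ⟨hθ, h1.2 ξ hξ hξF⟩
  obtain ⟨-, ξ₀, hξ₀, hFξ₀⟩ := mem_of_mem_nhds hS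
  set pr : C2 →L[ℂ] ℂ := EuclideanSpace.proj 0 with hpr
  have hG : AnalyticAt ℂ (fun θ => F θ 0) θ₀ := by
    rw [Complex.analyticAt_iff_eventually_differentiableAt]
    filter_upwards [(isOpen_strip s₁).mem_nhds hθ₀] with θ hθ
    exact pr.differentiableAt.comp θ (hFd' θ hθ)
  have hdisc : ∀ᶠ ξ in 𝓝 ξ₀, f ξ ∈ F '' strip s₁ := by
    rcases hG.eventually_constant_or_nhds_le_map_nhds with hconst | hopen
    · exfalso
      refine hF' θ₀ hθ₀ ?_
      have : F =ᶠ[𝓝 θ₀] fun _ => F θ₀ := by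
        filter_upwards [hS, hconst] with θ hθ h1
        obtain ⟨-, ξ, hξ, hFξ⟩ := hθ
        have h2 : f ξ 0 = f ξ₀ 0 := by rw [← hFξ, ← hFξ₀]; exact h1
        rw [hFξ, hFξ₀, hDinj hξ hξ₀ h2]
      rw [this.deriv_eq, deriv_const]
    · have h1 := hopen (image_mem_map hS)
      simp only [hFξ₀] at h1
      have h2 : ContinuousAt (fun ξ => f ξ 0) ξ₀ :=
        (pr.differentiableAt.comp ξ₀ (hfd ξ₀ (hDs hξ₀))).continuousAt
      filter_upwards [h2.eventually_mem h1, hD.mem_nhds hξ₀] with ξ hξ hξD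
      obtain ⟨θ, ⟨hθ, ξ', hξ', hFξ'⟩, h3⟩ := hξ
      have h4 : f ξ' 0 = f ξ 0 := by rw [← hFξ']; exact h3
      exact ⟨θ, hθ, by rw [hFξ', hDinj hξ' hξD h4]⟩
  obtain ⟨r, hr, hball⟩ := Metric.eventually_nhds_iff_ball.1 hdisc
  have hc : |ξ₀.im| < σ := hDσ hξ₀
  obtain ⟨ρ, hρ0, hρr, hρσ⟩ : ∃ ρ > 0, 2 * ρ < r ∧ |ξ₀.im| + ρ < σ := by
    refine ⟨min (r / 4) ((σ - |ξ₀.im|) / 2), lt_min (by positivity) (by linarith), ?_, ?_⟩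
    · linarith [min_le_left (r / 4) ((σ - |ξ₀.im|) / 2)]
    · linarith [min_le_right (r / 4) ((σ - |ξ₀.im|) / 2)]
  have hstrip : ∀ ξ : ℂ, |ξ.im - ξ₀.im| < ρ → ξ ∈ strip σ := by
    intro ξ hξ
    have : |ξ.im| ≤ |ξ.im - ξ₀.im| + |ξ₀.im| := by
      simpa using abs_add_le (ξ.im - ξ₀.im) ξ₀.im
    exact lt_of_le_of_lt this (by linarith)
  refine ⟨f '' {z | |z.im - ξ₀.im| < ρ}, 1 / L, ?_, ⟨f ξ₀, ξ₀, by simpa using hρ0, rfl⟩,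
    hp.isRotationAnnulus hP hinj hρ0 (by linarith)⟩
  rintro _ ⟨ξ, hξ, rfl⟩
  refine ⟨mem_image_of_mem f (hstrip ξ hξ), ?_⟩
  have hirr : Irrational L := by
    rw [hL]; exact hα.natCast_sub q
  obtain ⟨n, k, hnk⟩ := exists_nat_int_abs_sub_lt hirr (ξ.re - ξ₀.re) hρ0
  -- the forward orbit of the disc covers the annulus
  have hforward : ∀ n : ℕ, ∀ ξ ∈ strip s, f ξ ∈ F '' strip s₁ → f (ξ + n) ∈ F '' strip s₁ := by
    intro n ξ hξ hmem
    induction n with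
    | zero => simpa using hmem
    | succ n ih =>
      obtain ⟨θ, hθ, hFθ⟩ := ih
      have hξn : ξ + n ∈ strip s := by simpa using add_real_mem_strip hξ n
      refine ⟨θ + α₁, add_real_mem_strip hθ α₁, ?_⟩
      have h1 := hrot θ hθ
      rw [hFθ, hp.rel_iff _ (hp.gluedCurve_mem hξn)] at h1
      rw [h1, ← hp.gluedCurve_add_one hξn]
      congr 1
      push_cast; ring
  set w : ℂ := ξ - n - k * (L : ℂ) with hw
  have hξs : ξ ∈ strip s := lt_of_lt_of_le (hstrip ξ hξ) hσ
  have hws : w ∈ strip s := by simpa [strip, hw] using hξs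
  have hwball : w ∈ Metric.ball ξ₀ r := by
    rw [mem_ball_iff_norm]
    have hre : (w - ξ₀).re = ξ.re - ξ₀.re - n - k * L := by simp [hw]; ring
    have him : (w - ξ₀).im = ξ.im - ξ₀.im := by simp [hw]
    have h1 := Complex.norm_le_abs_re_add_abs_im (w - ξ₀)
    rw [hre, him] at h1
    have h2 : |ξ.im - ξ₀.im| < ρ := hξ
    linarith
  have h1 := hforward n w hws (hball w hwball)
  rwa [hf, ← gluedCurve_add_period hL0 (w + n) k,
    show w + n + k * (L : ℂ) = ξ by rw [hw]; ring] at h1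

end LinearizedPair

/-! ### The annulus for a fixed small parameter -/

/-- A holomorphic function whose derivative is close to a nonzero constant is injective. -/
theorem injOn_of_norm_deriv_sub_le {g g' : ℂ → ℂ} {c : ℂ} {D : Set ℂ} (hD : Convex ℝ D)
    (hc : c ≠ 0) (hg : ∀ z ∈ D, HasDerivAt g (g' z) z) (h : ∀ z ∈ D, ‖g' z - c‖ ≤ ‖c‖ / 2) :
    InjOn g D := by
  intro z hz z' hz' heq
  have h1 := hD.norm_image_sub_le_of_norm_hasDerivWithin_le (f := fun z => g z - c * z)
    (fun w hw => (by simpa using! (hg w hw).sub ((hasDerivAt_id w).const_mul c) :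
      HasDerivAt (fun z => g z - c * z) (g' w - c) w).hasDerivWithinAt) h hz hz'
  have e : g z' - c * z' - (g z - c * z) = -(c * (z' - z)) := by rw [heq]; ring
  rw [e, norm_neg, norm_mul] at h1
  have hc' : 0 < ‖c‖ := norm_pos_iff.2 hc
  have h2 : ‖z' - z‖ ≤ 0 := by
    by_contra hcon
    push Not at hcon
    nlinarith [mul_pos hc' hcon]
  exact (sub_eq_zero.1 (norm_le_zero_iff.1 h2)).symm

section Step

variable {V : Set C2} {X η : C2 → C2} {Φ : ℂ → C2} {s ρ M δ ε : ℝ} {Λ : NNReal} {q : ℕ}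
  {α : ℝ} {β : ℂ} {ν š : ℝ} {P : C2 → C2}

/-- If the box is small, its first `q + 1` images remain in the tube around the orbit annulus. -/
theorem linearizedPair_of_bounds (hX : DifferentiableOn ℂ X V) (hη : StepBounds V η ρ M δ ε)
    (hT : TubeBounds V X Φ s ρ M Λ) (hconj : ConjugatesPair (HRel V X η δ) q α β ν š P)
    (hq : 2 ≤ q) (hν : 0 < ν) (hš : 0 < š) (hα : α ∈ Ioo (-1 : ℝ) 0) (hβ : 0 < β.im) {e : ℝ}
    (hnear : ∀ u ∈ modelDomain ν š, ‖P u - Φ 0‖ ≤ e)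
    (he : (e + (q + 1 : ℕ) * ε) * Real.exp ((q + 1 : ℕ) * δ * Λ) < ρ) :
    LinearizedPair (HRel V X η δ) (tube Φ s ρ) q α β ν š P where
  isOpen := isOpen_tube _ _ _
  rel_iff x hx y := hRel_iff hη hT hx y
  continuousOn := continuousOn_stepMap hη hT
  holo_comp _ _ hD hc hcm := differentiableOn_stepMap_comp hX hη hT hD hc hcm
  lipschitz_at := by
    rintro x ⟨t, ht, hx⟩
    refine ⟨(1 + ε / ρ) * Real.exp (δ * Λ), ?_⟩
    filter_upwards [Metric.isOpen_ball.mem_nhds hx] with y hy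
    exact norm_stepMap_sub_le hη hT ht hy hx
  conj := hconj
  orbit_mem u hu j hj := (iterate_stepMap_near hη hT
    (show (0 : ℂ) ∈ strip s by simpa [strip] using hT.s_pos) (hnear u hu) he j hj).1
  two_le := hq
  nu_pos := hν
  s_pos := hš
  alpha_mem := hα
  beta_pos := hβ

/-- Propagation along the orbit of the comparison between `P(z, 0)` and `Φ(δz)`. -/
theorem norm_iterate_P_sub_le (hη : StepBounds V η ρ M δ ε) (hT : TubeBounds V X Φ s ρ M Λ)
    (hδš : δ * š ≤ s) (hδ : 0 < δ) {E₀ E : ℝ} {n : ℕ}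
    (hE₀ : ∀ z : ℂ, z.re ∈ Ico (0 : ℝ) 1 → |z.im| < š → ‖P !₂[z, 0] - Φ (δ * z)‖ ≤ E₀)
    (hE : (E₀ + n * ε) * Real.exp (n * δ * Λ) ≤ E) (hEρ : E < ρ) {z : ℂ}
    (hz : z.re ∈ Ico (0 : ℝ) 1) (hzi : |z.im| < š) {j : ℕ} (hj : j ≤ n) :
    ‖(stepMap (HRel V X η δ))^[j] (P !₂[z, 0]) - Φ (δ * (z + j))‖ ≤ E := by
  have hε := hη.eps_nonneg hT
  have hmem : (δ : ℂ) * z ∈ strip s := by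
    have e : ((δ : ℂ) * z).im = δ * z.im := by simp
    rw [strip, mem_ofPred_eq, e, abs_mul, abs_of_pos hδ]
    exact lt_of_lt_of_le (by gcongr) hδš
  have h1 := (iterate_stepMap_near hη hT hmem (hE₀ z hz hzi) (hE.trans_lt hEρ) j hj).2
  have e : (δ : ℂ) * z + (j * δ : ℝ) = δ * (z + j) := by push_cast; ring
  rw [e] at h1
  have hE₀' : 0 ≤ E₀ := (norm_nonneg _).trans (hE₀ z hz hzi)
  have hjn : (j : ℝ) ≤ n := by exact_mod_cast hj
  exact (h1.trans (by gcongr)).trans hE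

/-- A rotation annulus with a point near the periodic orbit has a point near the orbit segment
`Φ([0, δ])`. -/
theorem exists_mem_near_segment (hη : StepBounds V η ρ M δ ε) (hT : TubeBounds V X Φ s ρ M Λ)
    (hδ : 0 < δ) {T : ℝ} (hT0 : 0 < T) (hper : ∀ t : ℝ, ∀ k : ℤ, Φ ((t + k * T : ℝ) : ℂ) = Φ t)
    (hq : T < δ * (q + 1)) {e₀ e : ℝ}
    (he : (e₀ + (q + 1 : ℕ) * ε) * Real.exp ((q + 1 : ℕ) * δ * Λ) ≤ e) (heρ : e < ρ)
    {A : Set C2} {α₁ : ℝ} (hA : IsRotationAnnulus (HRel V X η δ) α₁ A) {x : C2} (hx : x ∈ A)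
    {t : ℝ} (hxt : ‖x - Φ t‖ ≤ e₀) :
    ∃ τ ∈ Icc (0 : ℝ) 1, ∃ y ∈ A, ‖y - Φ ((τ * δ : ℝ) : ℂ)‖ ≤ e := by
  obtain ⟨s₁, hs₁, F, -, -, -, -, rfl, hrot⟩ := hA
  obtain ⟨θ, hθ, rfl⟩ := hx
  have hε := hη.eps_nonneg hT
  -- reduce the time to `[0, T)`
  set t' : ℝ := t - ⌊t / T⌋ * T with ht'
  have h1 : ⌊t / T⌋ * T ≤ t := by
    have := Int.floor_le (t / T); rwa [le_div_iff₀ hT0] at this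
  have h2 : t < (⌊t / T⌋ + 1) * T := by
    have := Int.lt_floor_add_one (t / T); rwa [div_lt_iff₀ hT0] at this
  have hΦt : Φ t = Φ t' := by
    rw [← hper t' ⌊t / T⌋, ht', sub_add_cancel]
  set k : ℕ := ⌈(T - t') / δ⌉₊ with hk
  have hk1 : T - t' ≤ k * δ := by
    have := Nat.le_ceil ((T - t') / δ); rwa [div_le_iff₀ hδ] at this
  have hk2 : k * δ < T - t' + δ := by
    have := Nat.ceil_lt_add_one (a := (T - t') / δ) (div_nonneg (by linarith) hδ.le)
    have h3 : (k : ℝ) * δ < ((T - t') / δ + 1) * δ := by gcongr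
    rwa [add_mul, div_mul_cancel₀ _ hδ.ne', one_mul] at h3
  have hkq : k ≤ q + 1 := by
    refine Nat.ceil_le.2 ?_
    rw [div_le_iff₀ hδ]
    push_cast
    linarith
  have hreal : ∀ x : ℝ, (x : ℂ) ∈ strip s := fun x => by simpa [strip] using hT.s_pos
  rw [hΦt] at hxt
  have hnear := iterate_stepMap_near hη hT (hreal t') hxt (he.trans_lt heρ)
  have horb : ∀ j ≤ q + 1, F (θ + j * α₁) = (stepMap (HRel V X η δ))^[j] (F θ) := by
    intro j
    induction j with
    | zero => simp
    | succ j ih =>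
      intro hj
      have h3 : θ + j * α₁ ∈ strip s₁ := by simpa using add_real_mem_strip hθ (j * α₁)
      have h4 := hrot _ h3
      rw [ih (by omega), hRel_iff hη hT (hnear j (by omega)).1] at h4
      rw [Function.iterate_succ_apply', ← h4]
      congr 1
      push_cast; ring
  refine ⟨(t' + k * δ - T) / δ, ⟨div_nonneg (by linarith) hδ.le,
    (div_le_one hδ).2 (by linarith)⟩, F (θ + k * α₁), ⟨θ + k * α₁, ?_, rfl⟩, ?_⟩
  · simpa using add_real_mem_strip hθ (k * α₁)
  · rw [div_mul_cancel₀ _ hδ.ne', horb k hkq]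
    have h3 := (hnear k hkq).2
    have h4 : Φ ((t' + k * δ - T : ℝ) : ℂ) = Φ ((t' : ℂ) + (k * δ : ℝ)) := by
      rw [← hper (t' + k * δ - T) 1, Int.cast_one, one_mul, sub_add_cancel]
      push_cast; rfl
    rw [h4]
    have hkn : (k : ℝ) ≤ (q + 1 : ℕ) := by exact_mod_cast hkq
    have he₀ : 0 ≤ e₀ := (norm_nonneg _).trans hxt
    exact (h3.trans (by gcongr)).trans he

/-- The conclusion for a fixed parameter `δ`, under explicit smallness conditions: `e'` bounds the
size of the linearized box, `E` the distance of the glued curve to the orbit annulus, `e` the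
distance at which other annuli are captured, and `κ` is the quantitative injectivity constant of the
orbit. -/
theorem exists_attracting_isolated_annulus (hX : DifferentiableOn ℂ X V)
    (hη : StepBounds V η ρ M δ ε) (hT : TubeBounds V X Φ s ρ M Λ)
    (hconj : ConjugatesPair (HRel V X η δ) q α β ν š P) (hq : 2 ≤ q) (hν : 0 < ν) (hš : 0 < š)
    (hα : α ∈ Ioo (-1 : ℝ) 0) (hirr : Irrational α) (hβ : 0 < β.im) (hδ : 0 < δ) {T κ : ℝ}
    (hT0 : 0 < T) (hper : ∀ t : ℝ, ∀ k : ℤ, Φ ((t + k * T : ℝ) : ℂ) = Φ t) (hqT : δ * q ≤ T)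
    (hqT' : T < δ * (q + 1)) (hκ0 : 0 ≤ κ)
    (hκ : ∀ t ∈ strip s, ∀ t' ∈ strip s, ∃ k : ℤ, ‖t' - t - k * T‖ ≤ κ * ‖Φ t' - Φ t‖)
    (hδš : δ * š ≤ s) {e' E₀ E e₀ e r : ℝ} {c : ℂ}
    (hnear : ∀ u ∈ modelDomain ν š, ‖P u - Φ 0‖ ≤ e')
    (he' : (e' + (q + 1 : ℕ) * ε) * Real.exp ((q + 1 : ℕ) * δ * Λ) < ρ)
    (hE₀ : ∀ z : ℂ, z.re ∈ Ico (0 : ℝ) 1 → |z.im| < š → ‖P !₂[z, 0] - Φ (δ * z)‖ ≤ E₀)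
    (hE : (E₀ + (q + 1 : ℕ) * ε) * Real.exp ((q + 1 : ℕ) * δ * Λ) ≤ E) (hEρ : E < ρ)
    (hc : c ≠ 0)
    (hder : ∀ u ∈ modelDomain ν š, ‖fderiv ℂ P u (EuclideanSpace.single 0 1) 0 - c‖ ≤ ‖c‖ / 2)
    (hr : 0 < r) (hrν : r ≤ ν) (hr1 : r < 1) (hrš : r ≤ š / 2) (he0 : 0 < e)
    (hbox : ∀ τ ∈ Icc (0 : ℝ) 1, ∀ y, ‖y - Φ ((τ * δ : ℝ) : ℂ)‖ ≤ 2 * e → y ∈ P '' modelDomain ν š)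
    (he : (e₀ + (q + 1 : ℕ) * ε) * Real.exp ((q + 1 : ℕ) * δ * Λ) ≤ e) (heρ : e < ρ)
    (hsmall : κ * (E + 2 * e) + 2 * κ * E < δ * r) (hsmall' : 4 * κ * E < δ * r)
    (hsmallT : 2 * κ * E + δ < T) :
    ∃ A, |δ * (q - α) - T| ≤ 2 * κ * E ∧
      IsRotationAnnulus (HRel V X η δ) (1 / (q - α)) A ∧ IsCompact (closure A) ∧
      closure A ⊆ backwardUnion (HRel V X η δ) q (P '' modelDomain ν š) ∧ P 0 ∈ A ∧
      (∃ U : Set C2, IsOpen U ∧ U.Nonempty ∧ A ⊆ U ∧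
        U ⊆ backwardUnion (HRel V X η δ) q (P '' modelDomain ν š) ∧
        U ⊆ basin (HRel V X η δ) A) ∧
      ∀ (A' : Set C2) (α₁ : ℝ), IsRotationAnnulus (HRel V X η δ) α₁ A' →
        (∃ x ∈ A', ∃ t : ℝ, ‖x - Φ t‖ ≤ e₀) →
        ∃ (B : Set C2) (α₂ : ℝ), B ⊆ A ∩ A' ∧ B.Nonempty ∧
          IsRotationAnnulus (HRel V X η δ) α₂ B := by
  have hp := linearizedPair_of_bounds hX hη hT hconj hq hν hš hα hβ hnear he'
  set h := HRel V X η δ with hh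
  set f := gluedCurve h P (q - α) with hf
  have hα1 := hα.1
  have hα2 := hα.2
  have hq2 : (2 : ℝ) ≤ q := by exact_mod_cast hq
  have hs := hT.s_pos
  have hδT : δ * r < T := by nlinarith
  have hiter : ∀ z : ℂ, z.re ∈ Ico (0 : ℝ) 1 → |z.im| < š → ∀ j ≤ q + 1,
      ‖(stepMap h)^[j] (P !₂[z, 0]) - Φ (δ * (z + j))‖ ≤ E := fun z hz hzi j hj =>
    norm_iterate_P_sub_le hη hT hδš hδ hE₀ hE hEρ hz hzi hj
  have hcurve : ∀ z ∈ strip š, z.re ∈ Ico (0 : ℝ) (q - α) → ‖f z - Φ (δ * z)‖ ≤ E := by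
    intro z hz hzr
    have h0 : z.re - (⌊z.re⌋₊ : ℝ) ∈ Ico (0 : ℝ) 1 :=
      ⟨by linarith [Nat.floor_le hzr.1], by linarith [Nat.lt_floor_add_one z.re]⟩
    have h1 : (z - (⌊z.re⌋₊ : ℂ)).re ∈ Ico (0 : ℝ) 1 := by simpa using h0
    have h2 : (z - (⌊z.re⌋₊ : ℂ)).re + ⌊z.re⌋₊ < q - α := by simpa using hzr.2
    have h3 : |(z - (⌊z.re⌋₊ : ℂ)).im| < š := by simpa using! hz
    have h4 := LinearizedPair.gluedCurve_canonical (h := h) (P := P) hp.period_pos 0 h1 h2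
    have h5 := hiter _ h1 h3 ⌊z.re⌋₊ ((hp.le_q h1.1 h2).trans (Nat.le_succ q))
    rw [← h4] at h5
    simpa using h5
  have hLT : |δ * (q - α) - T| ≤ 2 * κ * E := by
    refine hp.abs_period_sub_le hδ hs hκ hκ0 hqT hqT' ?_ ?_ hsmallT
    · simpa using hiter 0 (by simp) (by simpa using hš) 0 (by omega)
    · have := hiter (-α : ℂ) (by simp; constructor <;> linarith) (by simpa using hš) q (by omega)
      have e : (δ : ℂ) * (-α + q) = ((δ * (q - α) : ℝ) : ℂ) := by push_cast; ring
      rwa [e] at this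
  have hEE : κ * (E + E) + 2 * κ * E < δ * r := by linarith
  have hinj := hp.gluedCurve_injective hδ hκ hκ0 hδš hT0 hcurve hLT (hEE.trans hδT) hrν hr1 hEE
  have hP0 : ∀ u ∈ modelDomain ν š, fderiv ℂ P u (EuclideanSpace.single 0 1) 0 ≠ 0 := by
    intro u hu h0
    have := hder u hu
    rw [h0, zero_sub, norm_neg] at this
    linarith [norm_pos_iff.2 hc]
  have hP : ∀ u ∈ modelDomain ν š, fderiv ℂ P u (EuclideanSpace.single 0 1) ≠ 0 := by
    intro u hu h0
    exact hP0 u hu (by rw [h0]; rfl)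
  have hopen : ∀ u ∈ modelDomain ν š, map P (𝓝 u) = 𝓝 (P u) := fun u hu =>
    map_nhds_eq_of_injOn (isOpen_modelDomain ν š) hp.differentiableOn_P
      (hconj.inj.mono fun _ hu => Or.inl (Or.inl hu)) hP0 hu
  have hcl : closure (f '' strip (š / 2)) ⊆ f '' {z | z.im ∈ Icc (-(š / 2)) (š / 2)} := by
    refine closure_minimal (image_mono fun z hz => ?_)
      (hp.isCompact_gluedCurve_image (by linarith) (by linarith)).isClosed
    exact abs_le.1 (le_of_lt hz)
  refine ⟨f '' strip (š / 2), hLT, ?_, ?_, ?_, ?_, hp.exists_basin hopen (by positivity)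
    (by linarith), ?_⟩
  · simpa [strip] using hp.isRotationAnnulus hP hinj (c := 0) (r := š / 2) (by positivity)
      (by simp; linarith)
  · exact (hp.isCompact_gluedCurve_image (by linarith) (by linarith)).of_isClosed_subset
      isClosed_closure hcl
  · refine hcl.trans ?_
    rintro _ ⟨z, hz, rfl⟩
    have hz' : |z.im| ≤ š / 2 := abs_le.2 hz
    exact hp.mem_backwardUnion (show |z.im| < š by linarith)
  · refine ⟨0, by simpa [strip] using hš, ?_⟩
    rw [hf, hp.gluedCurve_eq_P_Ico (by simp)]
    congr 1
    ext i; fin_cases i <;> rfl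
  · rintro A' α₁ hA' ⟨x, hx, t, hxt⟩
    obtain ⟨τ, hτ, y, hy, hyτ⟩ := exists_mem_near_segment hη hT hδ hT0 hper hqT' he heρ hA' hx hxt
    set D : Set ℂ := {z | z.re ∈ Ioo (-r) (1 + r)} ∩ strip (š / 2) with hD
    have hDo : IsOpen D := (isOpen_Ioo.preimage Complex.continuous_re).inter (isOpen_strip _)
    have hDc : Convex ℝ D :=
      ((convex_Ioo (-r) (1 + r)).linear_preimage Complex.reLm).inter (convex_strip _)
    have hDs : ∀ z ∈ D, z ∈ strip š := fun z hz => by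
      have h1 : |z.im| < š / 2 := hz.2
      exact show |z.im| < š by linarith
    have hDf : ∀ z ∈ D, f z = P !₂[z, 0] := fun z hz =>
      hp.gluedCurve_eq_P hrν hr1 (hDs z hz) hz.1.1 hz.1.2
    have hDmem : ∀ z ∈ D, !₂[z, 0] ∈ modelDomain ν š := fun z hz => mk_mem_modelDomain.2
      ⟨by linarith [hz.1.1], by linarith [hz.1.2], hDs z hz, by simpa using hš⟩
    have hDinj : InjOn (fun z => f z 0) D := by
      have h1 : InjOn (fun z => P !₂[z, 0] 0) D :=
        injOn_of_norm_deriv_sub_le hDc hc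
          (fun z hz => (EuclideanSpace.proj 0 : C2 →L[ℂ] ℂ).hasFDerivAt.comp_hasDerivAt z
            (hp.hasDerivAt_slice (hDmem z hz))) (fun z hz => hder _ (hDmem z hz))
      intro z hz z' hz' hzz
      refine h1 hz hz' ?_
      simp only [hDf z hz, hDf z' hz'] at hzz
      exact hzz
    refine hp.exists_common_annulus hP hinj hirr (by linarith) hDo (fun z hz => hz.2) hDinj hA'
      hy ?_
    filter_upwards [Metric.ball_mem_nhds y he0] with y' hy'
    have hy'τ : ‖y' - Φ ((τ * δ : ℝ) : ℂ)‖ ≤ 2 * e := by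
      calc _ = ‖(y' - y) + (y - Φ ((τ * δ : ℝ) : ℂ))‖ := by congr 1; abel
        _ ≤ e + e := (norm_add_le _ _).trans (add_le_add (mem_ball_iff_norm.1 hy').le hyτ)
        _ = 2 * e := by ring
    refine ⟨hbox τ hτ y' hy'τ, ?_⟩
    rintro ξ hξ rfl
    have e1 : ((τ * δ : ℝ) : ℂ) = δ * (τ : ℂ) := by push_cast; ring
    rw [e1] at hy'τ
    obtain ⟨k, hk⟩ := hp.exists_norm_sub_le hδ hκ hκ0 hδš hT0 hcurve hLT (hsmall.trans hδT) hξ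
      (τ := (τ : ℂ)) (by simpa [strip] using hš)
      ⟨by simpa using hτ.1, by simp; linarith [hτ.2]⟩ hy'τ
    have hk' : ‖ξ - k * ((q - α : ℝ) : ℂ) - τ‖ < r :=
      lt_of_mul_lt_mul_left (hk.trans_lt hsmall) hδ.le
    refine ⟨ξ - k * ((q - α : ℝ) : ℂ), ⟨?_, ?_⟩, ?_⟩
    · have h1 := abs_lt.1 ((Complex.abs_re_le_norm _).trans_lt hk')
      rw [Complex.sub_re, Complex.ofReal_re] at h1
      exact ⟨by linarith [h1.1, hτ.1], by linarith [h1.2, hτ.2]⟩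
    · have h1 := (Complex.abs_im_le_norm _).trans_lt hk'
      rw [Complex.sub_im _ (τ : ℂ), Complex.ofReal_im, sub_zero] at h1
      exact h1.trans_le hrš
    · rw [← LinearizedPair.gluedCurve_add_period hp.period_pos (ξ - k * ((q - α : ℝ) : ℂ)) k,
        sub_add_cancel]

end Step

/-! ### Choice of the parameters -/

theorem TubeBounds.mono {V : Set C2} {X : C2 → C2} {Φ : ℂ → C2} {s s' ρ M : ℝ} {Λ : NNReal}
    (hT : TubeBounds V X Φ s ρ M Λ) (hs' : 0 < s') (h : s' ≤ s) : TubeBounds V X Φ s' ρ M Λ where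
  s_pos := hs'
  rho_pos := hT.rho_pos
  norm_le := hT.norm_le
  ball_subset t ht := hT.ball_subset t (lt_of_lt_of_le ht h)
  lipschitz t ht := hT.lipschitz t (lt_of_lt_of_le ht h)
  deriv t ht := hT.deriv t (lt_of_lt_of_le ht h)

theorem eventually_mul_lt {b : ℝ → ℝ} (hb : Tendsto b (𝓝[>] 0) (𝓝 0)) (c : ℝ) {d : ℝ}
    (hd : 0 < d) : ∀ᶠ δ in 𝓝[>] (0 : ℝ), c * b δ < d := by
  have := hb.const_mul c
  rw [mul_zero] at this
  exact this.eventually_lt_const hd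

theorem norm_le_add_norm_C2 (v : C2) : ‖v‖ ≤ ‖v 0‖ + ‖v 1‖ := by
  have e : v = EuclideanSpace.single 0 (v 0) + EuclideanSpace.single 1 (v 1) := by
    ext i; fin_cases i <;> simp
  calc ‖v‖ = ‖(EuclideanSpace.single 0 (v 0) + EuclideanSpace.single 1 (v 1) : C2)‖ := by rw [← e]
    _ ≤ ‖(EuclideanSpace.single 0 (v 0) : C2)‖ + ‖(EuclideanSpace.single 1 (v 1) : C2)‖ :=
      norm_add_le _ _
    _ = _ := by rw [PiLp.norm_single, PiLp.norm_single]

/-- The comparisons between powers of `δ` used below. -/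
theorem rpow_comparisons {δ a p : ℝ} (hδ : 0 < δ) (hδ1 : δ < 1) (ha : 0 < a)
    (hp : 20 * (a + 1) < p) :
    δ ^ p ≤ δ ∧ δ ^ (p - 1) ≤ δ ^ 2 ∧ δ ^ (p - a) ≤ δ ^ 2 ∧ δ ^ (p / 2 - a) ≤ δ ^ 2 ∧
      δ * δ ^ (p / 2 + 2) ≤ δ ^ 2 ∧
      δ ^ p ≤ δ ^ (1 / 3 : ℝ) * (δ * δ ^ (p / 2 + 2)) ∧
      δ ^ (p - 1) ≤ δ ^ (1 / 3 : ℝ) * (δ * δ ^ (p / 2 + 2)) ∧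
      δ ^ (p - a) ≤ δ ^ (1 / 3 : ℝ) * (δ * δ ^ (p / 2 + 2)) ∧
      δ ^ (2 / 3 * p) ≤ δ ^ (1 / 3 : ℝ) * (δ * δ ^ (p / 2 + 2)) := by
  have e : δ ^ (1 / 3 : ℝ) * (δ * δ ^ (p / 2 + 2)) = δ ^ (1 / 3 + (1 + (p / 2 + 2))) := by
    rw [Real.rpow_add hδ (1 / 3), Real.rpow_add hδ 1, Real.rpow_one]
  have e' : δ * δ ^ (p / 2 + 2) = δ ^ (1 + (p / 2 + 2)) := by
    rw [Real.rpow_add hδ 1, Real.rpow_one]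
  have key : ∀ {x y : ℝ}, y ≤ x → δ ^ x ≤ δ ^ y := fun h =>
    Real.rpow_le_rpow_of_exponent_ge hδ hδ1.le h
  have key2 : ∀ {x : ℝ}, 2 ≤ x → δ ^ x ≤ δ ^ 2 := fun h => by
    have := key h
    rwa [Real.rpow_two] at this
  refine ⟨?_, key2 (by linarith), key2 (by linarith), key2 (by linarith), ?_, ?_, ?_, ?_, ?_⟩
  · simpa using key (show 1 ≤ p by linarith)
  · rw [e']; exact key2 (by linarith)
  all_goals rw [e]; exact key (by linarith)

/-- A set at Hausdorff distance at most `d` from `A` has a point at distance less than `2d` from any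
given point of `A`. -/
theorem exists_dist_lt_of_hausdorffEDist_le {A A' : Set C2} {x : C2} (hx : x ∈ A) {d : ℝ}
    (hd : 0 < d) (h : Metric.hausdorffEDist A A' ≤ ENNReal.ofReal d) :
    ∃ y ∈ A', dist x y < 2 * d := by
  have h1 : Metric.hausdorffEDist A A' < ENNReal.ofReal (2 * d) :=
    h.trans_lt ((ENNReal.ofReal_lt_ofReal_iff (by positivity)).2 (by linarith))
  obtain ⟨y, hy, hxy⟩ := Metric.exists_edist_lt_of_hausdorffEDist_lt hx h1
  exact ⟨y, hy, by rwa [edist_dist, ENNReal.ofReal_lt_ofReal_iff (by positivity)] at hxy⟩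

set_option maxHeartbeats 1000000 in
theorem theorem8p3
    -- the fixed data, independent of `δ`: the vector field and its annulus, and the constants
    (V : Set C2) (hVo : IsOpen V) (hVb : Bornology.IsBounded V)
    (X : C2 → C2) (hX : DifferentiableOn ℂ X V)
    (M : ℝ) (hXM : ∀ x ∈ V, ‖X x‖ ≤ M)
    (ζ : C2) (T sstar : ℝ) (Φ : ℂ → C2) (hΦ : VectorFieldAnnulus V X ζ T sstar Φ)
    (a p : ℝ) (ha : 0 < a) (hp : 20 * (a + 1) < p)
    (s' ν₁ ν₂ K : ℝ) (hs' : 0 < s') (hν₁ : 0 < ν₁) (hν₁₂ : ν₁ ≤ ν₂) (hν₂ : ν₂ < 1 / 3)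
    (hK : 0 < K) :
    ∃ C > 0, ∃ δ₀ > 0, ∀ δ : ℝ, 0 < δ → δ < δ₀ →
      Int.fract (T / δ) ∈ Ioo (1 / 10 : ℝ) (9 / 10) →
      -- the perturbation
      ∀ η : C2 → C2, DifferentiableOn ℂ η V → (∀ x ∈ V, ‖η x‖ ≤ M * δ ^ p) →
      -- the linearization assumption, with `P = N⁻¹`
      ∀ (α' : ℝ) (β' : ℂ) (ν' š : ℝ) (P : C2 → C2),
        α' ∈ Ioo (-1 : ℝ) 0 →
        K⁻¹ ≤ ν' → ν' ≤ K → K⁻¹ ≤ š → š ≤ K →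
        ConjugatesPair (HRel V X η δ) ⌊T / δ⌋₊ α' β' ν' š P →
        box V X η Φ δ (δ ^ (p / 2 + 2)) ν₁ ⊆ P '' modelDomain ν' š →
        P '' modelDomain ν' š ⊆ box V X η Φ δ s' ν₂ →
        (∀ i, ‖P 0 i - ζ i‖ < δ ^ (p - a)) →
        (∀ u ∈ modelDomain ν' š,
          ‖fderiv ℂ P u (EuclideanSpace.single 0 1) - δ • X (P u)‖ ≤ K * δ ^ (p / 2 - a)) →
        NonResonant α' β' →
        -- the dissipative case
        0 < β'.im →
        ∃ (A : Set C2) (α : ℝ),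
          -- the invariant annulus
          IsRotationAnnulus (HRel V X η δ) α A ∧
          |α - δ / T| ≤ C * δ ^ 2 ∧
          IsCompact (closure A) ∧
          closure A ⊆ backwardUnion (HRel V X η δ) ⌊T / δ⌋₊ (P '' modelDomain ν' š) ∧
          P 0 ∈ A ∧
          -- it is attracting, with a nonempty open basin
          (∃ U : Set C2, IsOpen U ∧ U.Nonempty ∧ A ⊆ U ∧
            U ⊆ backwardUnion (HRel V X η δ) ⌊T / δ⌋₊ (P '' modelDomain ν' š) ∧
            U ⊆ basin (HRel V X η δ) A) ∧
          -- it is isolated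
          (∀ (A' : Set C2) (α₁ : ℝ), IsRotationAnnulus (HRel V X η δ) α₁ A' →
            (Metric.hausdorffEDist A A' ≤ ENNReal.ofReal (δ ^ (2 / 3 * p)) ∨
              ∃ x ∈ A', ∃ t : ℝ, dist x (Φ t) ≤ 2 * δ ^ (2 / 3 * p)) →
            ∃ (B : Set C2) (α₂ : ℝ), B ⊆ A ∩ A' ∧ B.Nonempty ∧
              IsRotationAnnulus (HRel V X η δ) α₂ B) := by
  have hT0 := hΦ.T_pos
  have hss := hΦ.sstar_pos
  obtain ⟨ρ, Λ, hTube⟩ := hΦ.exists_tubeBounds hVo hX hXM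
  obtain ⟨κ, hκ0, hκ⟩ := hΦ.exists_norm_sub_le hTube (by linarith)
  set s : ℝ := sstar / 2 / 2 with hs
  have hs0 : 0 < s := by positivity
  have hTs : TubeBounds V X Φ s ρ M Λ := hTube.mono hs0 (by rw [hs]; linarith)
  have hρ := hTs.rho_pos
  have hM := hTs.M_nonneg
  have h0s : (0 : ℂ) ∈ strip s := by simpa [strip] using hs0
  have hX0' : 0 < ‖X ζ 0‖ := norm_pos_iff.2 hΦ.transverse
  -- a local inverse of the first component of the orbit
  obtain ⟨ψ, rψ, B, hψ⟩ : ∃ ψ r B, LipschitzLocalInverse (fun t => Φ t 0) ψ 0 r B := by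
    have h1 := hΦ.hasStrictDerivAt (show (0 : ℂ) ∈ strip sstar by simpa [strip] using hss)
    rw [hΦ.base] at h1
    have h2 : HasStrictDerivAt (fun t => Φ t 0) (X ζ 0) 0 :=
      (EuclideanSpace.proj 0 : C2 →L[ℂ] ℂ).hasStrictFDerivAt.comp_hasStrictDerivAt 0 h1
    exact exists_lipschitzLocalInverse h2 hΦ.transverse
  have hrψ := hψ.r_pos
  have hB := hψ.B_pos
  -- `G` bounds the expansion over `q + 1` steps and `Z` the size of the domain of `P(·, 0)`. The box
  -- has size `C₁ δ`, annuli are captured at distance `C₂ δ^(1/3) δ^(p/2+3)` from the orbit, `C₃` is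
  -- the corresponding constant on the transversal, and the glued curve is `CE δ²`-close to the orbit.
  set G : ℝ := Real.exp ((T + 1) * Λ) with hG
  have hG0 : 0 < G := Real.exp_pos _
  set Z : ℝ := 1 + K with hZ
  set C₁ : ℝ := 4 * M + s' * (1 + M) with hC₁
  set C₂ : ℝ := (4 + (T + 1) * M) * G with hC₂
  set C₃ : ℝ := 2 * C₂ * Real.exp (2 * Λ) + 2 * M with hC₃
  set CE : ℝ := ((2 + Z * K) * Real.exp (Z * Λ) + (T + 1) * M) * G with hCE
  set r : ℝ := min (K⁻¹ / 2) (1 / 2) with hr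
  have hr0 : 0 < r := lt_min (by positivity) (by norm_num)
  have hC₁0 : 0 ≤ C₁ := by positivity
  have hC₂0 : 0 < C₂ := by positivity
  have hC₃0 : 0 ≤ C₃ := by positivity
  have hCE0 : 0 ≤ CE := by positivity
  have hid : Tendsto (fun δ : ℝ => δ) (𝓝[>] 0) (𝓝 0) := nhdsWithin_le_nhds
  have hcbrt : Tendsto (fun δ : ℝ => δ ^ (1 / 3 : ℝ)) (𝓝[>] 0) (𝓝 0) := by
    have := (Real.continuousAt_rpow_const 0 (1 / 3 : ℝ) (Or.inr (by norm_num))).tendsto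
    rw [Real.zero_rpow (by norm_num)] at this
    exact this.mono_left nhdsWithin_le_nhds
  have hev : ∀ᶠ δ in 𝓝[>] (0 : ℝ), (1 * δ < 1 ∧ (5 * M + 2 * C₂) * δ < ρ ∧ s' * δ < s ∧
      (C₁ + (T + 1) * M) * G * δ < ρ ∧ M * Z * δ < 2 * ρ ∧ Z * δ < s ∧ CE * δ < ρ) ∧
      ((K + Λ * C₁) * δ < ‖X ζ 0‖ / 2 ∧ κ * (3 * CE + 2 * C₂) * δ < r ∧ 4 * κ * CE * δ < r ∧
      3 * δ < T ∧ (C₃ + 3 * M) * δ < rψ ∧ 3 * δ < rψ ∧ B * C₃ * δ < s) ∧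
      B * C₃ * δ ^ (1 / 3 : ℝ) < ν₁ / 2 ∧ (1 + B + M * B) * C₃ * δ ^ (1 / 3 : ℝ) < 1 := by
    refine .and (.and ?_ (.and ?_ (.and ?_ (.and ?_ (.and ?_ (.and ?_ ?_))))))
      (.and (.and ?_ (.and ?_ (.and ?_ (.and ?_ (.and ?_ (.and ?_ ?_)))))) (.and ?_ ?_))
    · exact eventually_mul_lt hid _ one_pos
    · exact eventually_mul_lt hid _ hρ
    · exact eventually_mul_lt hid _ hs0
    · exact eventually_mul_lt hid _ hρ
    · exact eventually_mul_lt hid _ (by positivity)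
    · exact eventually_mul_lt hid _ hs0
    · exact eventually_mul_lt hid _ hρ
    · exact eventually_mul_lt hid _ (by positivity)
    · exact eventually_mul_lt hid _ hr0
    · exact eventually_mul_lt hid _ hr0
    · exact eventually_mul_lt hid _ hT0
    · exact eventually_mul_lt hid _ hrψ
    · exact eventually_mul_lt hid _ hrψ
    · exact eventually_mul_lt hid _ hs0
    · exact eventually_mul_lt hcbrt _ (by positivity)
    · exact eventually_mul_lt hcbrt _ one_pos
  obtain ⟨δ₀, hδ₀, hsub⟩ := mem_nhdsGT_iff_exists_Ioo_subset.1 hev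
  refine ⟨2 / T ^ 2, by positivity, δ₀, hδ₀, ?_⟩
  intro δ hδ hδδ₀ _ η hηd hηM α' β' ν' š P hα' hKν _ hKš hšK hconj hbox₁ hbox₂ hP0 hPder hres hβ'
  obtain ⟨⟨h1, h2, h3, h4, h5, h6, h7⟩, ⟨h8, h9, h10, h11, h12, h13, h14⟩, h15, h16⟩ :=
    hsub ⟨hδ, hδδ₀⟩
  rw [one_mul] at h1
  obtain ⟨p1, p2, p3, p4, p5, p6, p7, p8, p9⟩ := rpow_comparisons hδ h1 ha hp
  set u : ℝ := δ ^ (1 / 3 : ℝ) with hu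
  set ω : ℝ := δ * δ ^ (p / 2 + 2) with hω
  have hu0 : 0 < u := Real.rpow_pos_of_pos hδ _
  have hω0 : 0 < ω := mul_pos hδ (Real.rpow_pos_of_pos hδ _)
  have hu1 : u ≤ 1 := Real.rpow_le_one hδ.le h1.le (by norm_num)
  have hδ2 : δ ^ 2 ≤ δ := by nlinarith only [hδ, h1]
  have huω : u * ω ≤ δ ^ 2 := (mul_le_of_le_one_left hω0.le hu1).trans p5
  have huω' : u * ω ≤ δ := huω.trans hδ2
  set ε : ℝ := M * δ ^ p with hε
  have hε0 : 0 ≤ ε := by positivity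
  have hεδ : ε ≤ M * δ := by rw [hε]; gcongr
  set q : ℕ := ⌊T / δ⌋₊ with hq
  have hqT : δ * q ≤ T := by
    have := Nat.floor_le (div_nonneg hT0.le hδ.le)
    rw [le_div_iff₀ hδ] at this
    linarith only [this]
  have hqT' : T < δ * (q + 1) := by
    have := Nat.lt_floor_add_one (T / δ)
    rw [div_lt_iff₀ hδ] at this
    linarith only [this]
  have hq2 : 2 ≤ q := by
    refine Nat.le_floor ?_
    rw [le_div_iff₀ hδ]
    push_cast
    linarith only [h11, hδ]
  have hν' : 0 < ν' := lt_of_lt_of_le (by positivity) hKν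
  have hš : 0 < š := lt_of_lt_of_le (by positivity) hKš
  have hMδ : 0 ≤ M * δ := by positivity
  have hC₂δ : 0 ≤ C₂ * δ := by positivity
  have h2' : 5 * (M * δ) + 2 * (C₂ * δ) < ρ := by linarith only [h2]
  have h12' : C₃ * δ + 3 * (M * δ) < rψ := by linarith only [h12]
  have hη : StepBounds V η ρ M δ ε := ⟨hηd, hηM, hδ.le, by linarith only [hεδ, h2', hMδ, hC₂δ]⟩
  have h4ε : 4 * ε ≤ ρ := by linarith only [hεδ, h2', hMδ, hC₂δ]
  have hqδ : (q + 1 : ℕ) * δ ≤ T + 1 := by push_cast; linarith only [hqT, h1]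
  have hexp : Real.exp ((q + 1 : ℕ) * δ * Λ) ≤ G := by rw [hG]; gcongr
  -- the accumulated perturbation
  have hqε : (q + 1 : ℕ) * ε ≤ (T + 1) * M * δ ^ (p - 1) := by
    have e : δ ^ p = δ * δ ^ (p - 1) := by
      rw [← Real.rpow_one_add' hδ.le (by linarith only [hp, ha])]; congr 1; ring
    calc _ = ((q + 1 : ℕ) * δ) * (M * δ ^ (p - 1)) := by rw [hε, e]; ring
      _ ≤ (T + 1) * (M * δ ^ (p - 1)) := by gcongr
      _ = _ := by ring
  have hqε2 : (q + 1 : ℕ) * ε ≤ (T + 1) * M * δ ^ 2 := hqε.trans (by gcongr)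
  have hqε1 : (q + 1 : ℕ) * ε ≤ (T + 1) * M * δ := hqε2.trans (by gcongr)
  have hqεω : (q + 1 : ℕ) * ε ≤ (T + 1) * M * (u * ω) := hqε.trans (by gcongr)
  have hbase : Φ 0 = ζ := hΦ.base
  -- size of the linearized box
  have hnear : ∀ v ∈ modelDomain ν' š, ‖P v - Φ 0‖ ≤ C₁ * δ := by
    intro v hv
    have := norm_sub_le_of_mem_box hη hTs hν₂ (by linarith only [h3])
      (hbox₂ (mem_image_of_mem P hv))
    refine this.trans ?_
    rw [hC₁]
    linarith only [hεδ]
  have hnearρ : (C₁ * δ + (q + 1 : ℕ) * ε) * Real.exp ((q + 1 : ℕ) * δ * Λ) < ρ := by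
    refine lt_of_le_of_lt ?_ h4
    calc _ ≤ (C₁ * δ + (T + 1) * M * δ) * G := by gcongr
      _ = _ := by ring
  have hC₁ρ : C₁ * δ < ρ := by
    refine lt_of_le_of_lt ?_ hnearρ
    have h17 : (0 : ℝ) ≤ (q + 1 : ℕ) * ε := by positivity
    have h18 : (1 : ℝ) ≤ Real.exp ((q + 1 : ℕ) * δ * Λ) := Real.one_le_exp (by positivity)
    have h19 : 0 ≤ C₁ * δ := by positivity
    nlinarith only [h17, h18, h19]
  -- distance of `P(·, 0)` to the orbit
  have hPζ : ‖P 0 - Φ 0‖ ≤ 2 * δ ^ (p - a) := by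
    rw [hbase]
    refine (norm_le_add_norm_C2 _).trans ?_
    have h17 := (hP0 0).le
    have h18 := (hP0 1).le
    simp only [PiLp.sub_apply]
    linarith only [h17, h18]
  have hE₀ : ∀ z : ℂ, z.re ∈ Ico (0 : ℝ) 1 → |z.im| < š →
      ‖P !₂[z, 0] - Φ (δ * z)‖ ≤ (2 + Z * K) * Real.exp (Z * Λ) * δ ^ 2 := by
    rintro z ⟨hz0, hz1⟩ hzi
    have hzZ : ‖z‖ ≤ Z := by
      refine (Complex.norm_le_abs_re_add_abs_im z).trans ?_
      rw [abs_of_nonneg hz0, hZ]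
      linarith only [hz1, hzi, hšK]
    have hzm : !₂[z, 0] ∈ modelDomain ν' š :=
      mk_mem_modelDomain.2 ⟨by linarith only [hz0, hν'], by linarith only [hz1, hν'], hzi,
        by simpa using hš⟩
    have h17 := norm_P_sub_orbit_le hTs hδ.le (Z := Z)
      (hconj.holo.mono fun _ hv => Or.inl (Or.inl hv)) hPder
      (fun v hv => (hnear v hv).trans_lt (by linarith only [hC₁ρ, hρ]))
      (by linarith only [h5]) (by linarith only [h6]) hν' hzm hzZ
    have hZ0 : 0 ≤ Z := by positivity
    have h18 : Z * δ * Λ ≤ Z * Λ := by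
      have : Z * δ ≤ Z := mul_le_of_le_one_right hZ0 h1.le
      gcongr
    calc _ ≤ _ := h17
      _ ≤ (2 * δ ^ 2 + Z * (K * δ ^ 2)) * Real.exp (Z * Λ) := by
        gcongr
        exact hPζ.trans (by gcongr)
      _ = _ := by ring
  have hE : ((2 + Z * K) * Real.exp (Z * Λ) * δ ^ 2 + (q + 1 : ℕ) * ε) *
      Real.exp ((q + 1 : ℕ) * δ * Λ) ≤ CE * δ ^ 2 := by
    calc _ ≤ ((2 + Z * K) * Real.exp (Z * Λ) * δ ^ 2 + (T + 1) * M * δ ^ 2) * G := by gcongr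
      _ = _ := by rw [hCE]; ring
  have hCEδ : CE * δ ^ 2 ≤ CE * δ := by gcongr
  -- the tangent of `P(·, 0)` is transverse to the second axis
  have hder : ∀ v ∈ modelDomain ν' š,
      ‖fderiv ℂ P v (EuclideanSpace.single 0 1) 0 - δ * X ζ 0‖ ≤ ‖(δ : ℂ) * X ζ 0‖ / 2 := by
    intro v hv
    have h17 : ‖X (P v) - X (Φ 0)‖ ≤ Λ * (C₁ * δ) := by
      have := (hTs.lipschitz 0 h0s).dist_le_mul (P v)
        (mem_ball_iff_norm.2 ((hnear v hv).trans_lt (by linarith only [hC₁ρ, hρ]))) (Φ 0)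
        (Metric.mem_ball_self (by positivity))
      rw [dist_eq_norm, dist_eq_norm] at this
      exact this.trans (by gcongr; exact hnear v hv)
    set w : C2 := fderiv ℂ P v (EuclideanSpace.single 0 1) with hw
    have h18 : ‖w - δ • X ζ‖ ≤ K * δ ^ 2 + δ * (Λ * (C₁ * δ)) := by
      rw [hbase] at h17
      calc _ = ‖(w - δ • X (P v)) + δ • (X (P v) - X ζ)‖ := by
            congr 1; rw [smul_sub]; abel
        _ ≤ K * δ ^ (p / 2 - a) + δ * (Λ * (C₁ * δ)) := by
            refine (norm_add_le _ _).trans (add_le_add (hPder v hv) ?_)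
            rw [norm_smul, Real.norm_of_nonneg hδ.le]
            gcongr
        _ ≤ _ := by gcongr
    have h19 : w 0 - δ * X ζ 0 = (w - δ • X ζ) 0 := by simp
    rw [h19, norm_mul, Complex.norm_real, Real.norm_of_nonneg hδ.le]
    refine (PiLp.norm_apply_le _ 0).trans (h18.trans ?_)
    calc _ = δ * ((K + Λ * C₁) * δ) := by ring
      _ ≤ δ * (‖X ζ 0‖ / 2) := by gcongr
      _ = _ := by ring
  -- points near the orbit belong to the linearized box
  have hexp2 : Real.exp (2 * δ * Λ) ≤ Real.exp (2 * Λ) := by gcongr; linarith only [h1]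
  have hεω : ε ≤ M * (u * ω) := by rw [hε]; gcongr
  have hbox : ∀ τ ∈ Icc (0 : ℝ) 1, ∀ y, ‖y - Φ ((τ * δ : ℝ) : ℂ)‖ ≤ 2 * (C₂ * (u * ω)) →
      y ∈ P '' modelDomain ν' š := by
    intro τ hτ y hy
    have h17 : C₂ * (u * ω) ≤ C₂ * δ := by gcongr
    have h18 : C₃ * (u * ω) ≤ C₃ * δ := by gcongr
    refine hbox₁ (mem_box_of_norm_sub_le hη hTs hψ hδ hτ hy (e₁ := C₃ * (u * ω)) ?_
      (by linarith only [hν₁₂, hν₂]) (by linarith only [h17, h2', hεδ]) h4ε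
      (by linarith only [h18, h12']) h13 ?_ ?_ ?_)
    · calc _ ≤ 2 * (C₂ * (u * ω)) * Real.exp (2 * Λ) + 2 * (M * (u * ω)) := by gcongr
        _ = _ := by rw [hC₃]; ring
    · have h19 : ω ≤ δ := p5.trans hδ2
      calc _ = B * C₃ * u * ω := by ring
        _ ≤ B * C₃ * u * δ := by gcongr
        _ < ν₁ / 2 * δ := by gcongr
        _ = _ := by ring
    · calc _ ≤ B * (C₃ * δ) := by gcongr
        _ < s := by linarith only [h14]
    · calc _ = (1 + B + M * B) * C₃ * u * ω := by ring
        _ < 1 * ω := by gcongr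
        _ = _ := one_mul _
  have hcapture : (4 * (u * ω) + (q + 1 : ℕ) * ε) * Real.exp ((q + 1 : ℕ) * δ * Λ) ≤
      C₂ * (u * ω) := by
    calc _ ≤ (4 * (u * ω) + (T + 1) * M * (u * ω)) * G := by gcongr
      _ = _ := by rw [hC₂]; ring
  have hr1 : r ≤ 1 / 2 := min_le_right _ _
  have hrK : r ≤ K⁻¹ / 2 := min_le_left _ _
  have hK0 : 0 < K⁻¹ := by positivity
  have hCEr : 4 * κ * (CE * δ ^ 2) < δ * r := by
    calc _ = δ * (4 * κ * CE * δ) := by ring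
      _ < δ * r := by gcongr
  have hδš : δ * š ≤ s := by
    calc δ * š ≤ δ * Z := by gcongr; linarith only [hšK, hZ]
      _ ≤ s := by linarith only [h6]
  have hδr : δ * r ≤ δ * (1 / 2) := by gcongr
  have hsmallT : 2 * κ * (CE * δ ^ 2) + δ < T := by linarith only [hCEr, hδr, h11, hδ]
  obtain ⟨A, hLT, hA1, hA2, hA3, hA4, hA5, hA6⟩ := exists_attracting_isolated_annulus hX hη hTs
    hconj hq2 hν' hš hα' (irrational_of_nonResonant hres) hβ' hδ hT0
    (fun t k => by
      have := hΦ.apply_add_period (t := t) (by simpa [strip] using hss) k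
      simpa using this)
    hqT hqT' hκ0.le hκ hδš hnear hnearρ hE₀ hE (hCEδ.trans_lt h7)
    (mul_ne_zero (by exact_mod_cast hδ.ne') hΦ.transverse) hder hr0
    (by linarith only [hrK, hKν, hK0]) (by linarith only [hr1]) (by linarith only [hrK, hKš])
    (show 0 < C₂ * (u * ω) by positivity) hbox hcapture
    (by have : C₂ * (u * ω) ≤ C₂ * δ := by gcongr
        linarith only [this, h2', hMδ, hC₂δ])
    (by
      have h17 : κ * (C₂ * (u * ω)) ≤ κ * (C₂ * δ ^ 2) := by gcongr
      calc _ = 3 * κ * (CE * δ ^ 2) + 2 * (κ * (C₂ * (u * ω))) := by ring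
        _ ≤ 3 * κ * (CE * δ ^ 2) + 2 * (κ * (C₂ * δ ^ 2)) := by gcongr
        _ = δ * (κ * (3 * CE + 2 * C₂) * δ) := by ring
        _ < δ * r := by gcongr)
    hCEr hsmallT
  refine ⟨A, 1 / (q - α'), hA1, ?_, hA2, hA3, hA4, hA5, ?_⟩
  · have hα2 := hα'.2
    have hq2' : (2 : ℝ) ≤ q := by exact_mod_cast hq2
    have hL : T / (2 * δ) ≤ q - α' := by
      rw [div_le_iff₀ (by positivity)]
      nlinarith only [hα2, hqT', hq2', hδ]
    have hL0 : 0 < (q : ℝ) - α' := by linarith only [hα2, hq2']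
    have h17 : |δ * (q - α') - T| ≤ δ := hLT.trans (by linarith only [hCEr, hδr, hδ])
    have e : 1 / (q - α') - δ / T = -(δ * (q - α') - T) / ((q - α') * T) := by
      field_simp
      ring
    rw [e, abs_div, abs_neg, abs_of_pos (mul_pos hL0 hT0)]
    calc _ ≤ δ / (T / (2 * δ) * T) := by gcongr
      _ = _ := by field_simp
  · rintro A' α₁ hA' hclose
    refine hA6 A' α₁ hA' ?_
    have hd : 0 < δ ^ (2 / 3 * p) := Real.rpow_pos_of_pos hδ _
    rcases hclose with hH | ⟨x, hx, t, hxt⟩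
    · obtain ⟨x, hx, hxP⟩ := exists_dist_lt_of_hausdorffEDist_le hA4 hd hH
      refine ⟨x, hx, 0, ?_⟩
      rw [dist_comm, dist_eq_norm] at hxP
      rw [Complex.ofReal_zero]
      calc _ = ‖(x - P 0) + (P 0 - Φ 0)‖ := by congr 1; abel
        _ ≤ 2 * δ ^ (2 / 3 * p) + 2 * δ ^ (p - a) :=
          (norm_add_le _ _).trans (add_le_add hxP.le hPζ)
        _ ≤ _ := by linarith only [p8, p9]
    · refine ⟨x, hx, t, ?_⟩
      rw [dist_eq_norm] at hxt
      have : 0 ≤ u * ω := by positivity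
      linarith only [this, hxt, p9]
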